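/- **Models.** A *DEC-POMDP* with $n$ players consists of a finite set $S$ of states with initial state $s^{in}$, for each player $i\le n$ a finite non-empty set $Act_i$ of actions and a finite set $\mathcal O_i$ of observations, rational transition probabilities $P(s,\vec a)\in\Delta(S)$ and rational observation probabilities $O(s,\vec a,s')\in\Delta(\mathcal O_1\times\dots\times\mathcal O_n)$, for $s,s'\in S$ and $\vec a\in Act_1\times\dots\times Act_n$. A strategy of player $i$ maps every finite sequence of observations of $i$ to a probability distribution on $Act_i$. In each step the players choose $\vec a$ independently by their strategies, the next state $s'$ is drawn from $P(s,\vec a)$, and the observations $\vec o$ are drawn from $O(s,\vec a,s')$. $\Pr^{\vec\sigma}_{\mathcal P}(\diamond T)$ is the probability that a play visits a state of $T\subseteq S$. A *distributed IMC* with $m$ players consists of $m$ modules $(S_j,Act_j,\to_j,\rightsquigarrow_j,s^{in}_j)$, with $S_j$, $Act_j$ finite, action transitions $\to_j\subseteq S_j\times Act_j\times S_j$ and finitely many delay transitions $\rightsquigarrow_j\subseteq S_j\times\mathbb Q_{>0}\times S_j$. For every action $a$ some player $j$ with $a\in Act_j$ is required to have no cycle of action transitions that involves $a$. In a local state a player chooses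 an outgoing action transition, or $\bot$ if there is none. The players that took part in the last step (initially all) choose anew, independently, by their strategies, which are measurable maps from timed local histories (the steps in which the player took part, with local choices, labels, local states and times) to distributions over available choices; the others keep their choices. If some action $a$ is enabled, i.e. all players $j$ with $a\in Act_j$ have chosen an $a$-transition, a scheduler (a measurable map from histories and global choices to distributions over enabled actions) picks an enabled action, and its participants move at once. Otherwise all delay transitions out of the current local states get independent exponential delays with their rates, and the one with the minimum delay is taken after that delay; if there is none, the play stays in its state forever. $\Pr^{\vec\sigma,\delta}_{\mathcal G}(\diamond T')$ is the probability that a play reaches a global state in $T'\subseteq S_1\times\dots\times S_m$ and stays there for a non-zero amount of time. **Proposition.** There is an algorithm that, given any $n$, any DEC-POMDP $\mathcal P$ with $n$ players and any set $T$ of states of $\mathcal P$ (finite sets given as lists, $P$ and $O$ as tables, numbers in binary), constructs in time polynomial in the size of this input a distributed IMC $\mathcal G$ with $n+1$ players and a set $T'$ of global states of $\mathcal G$ (given as a list) such that $\Pr^{\vec\sigma,\delta}_{\mathcal G}(\diamond T')$ does not depend on the scheduler $\delta$, so that it may be written $\Pr^{\vec\sigma}_{\mathcal G}(\diamond T')$,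 and such that for every real $p$ $$\exists\,\vec\sigma:\ \Pr^{\vec\sigma}_{\mathcal G}(\diamond T')=p\quad\Longleftrightarrow\quad\exists\,\vec\sigma':\ \Pr^{\vec\sigma'}_{\mathcal P}(\diamond T)=p .$$ -/

import Mathlib

open MeasureTheory ProbabilityTheory
open scoped ENNReal

/-! ### Finite sequences as a measurable space -/

/-- A set of finite sequences is measurable iff, for every length `n`, its members of length `n`
form a measurable subset of `αⁿ`. -/
instance listMeasurableSpace {α : Type*} [MeasurableSpace α] : MeasurableSpace (List α) :=
  ⨅ n : ℕ, MeasurableSpace.map (List.ofFn : (Fin n → α) → List α) inferInstance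

theorem measurableSet_list {α : Type*} [MeasurableSpace α] {s : Set (List α)} :
    MeasurableSet s ↔ ∀ n : ℕ, MeasurableSet ((List.ofFn : (Fin n → α) → List α) ⁻¹' s) := by
  unfold listMeasurableSpace
  rw [MeasurableSpace.measurableSet_iInf]
  rfl

theorem measurable_ofFn {α : Type*} [MeasurableSpace α] (n : ℕ) :
    Measurable (List.ofFn : (Fin n → α) → List α) :=
  fun _ hs => measurableSet_list.1 hs n

theorem measurable_of_ofFn {α β : Type*} [MeasurableSpace α] [MeasurableSpace β]
    {f : List α → β} (hf : ∀ n : ℕ, Measurable fun x : Fin n → α => f (List.ofFn x)) :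
    Measurable f :=
  fun _ hs => measurableSet_list.2 fun n => hf n hs

theorem measurable_list_cons {α : Type*} [MeasurableSpace α] :
    Measurable fun p : α × List α => p.1 :: p.2 := by
  intro s hs
  rcases isEmpty_or_nonempty α with hα | ⟨⟨d⟩⟩
  · rw [Set.eq_empty_of_isEmpty ((fun p : α × List α => p.1 :: p.2) ⁻¹' s)]
    exact MeasurableSet.empty
  have h : (fun p : α × List α => p.1 :: p.2) ⁻¹' s = ⋃ n : ℕ,
      ({p : α × List α | p.2.length = n} ∩
        (fun p : α × List α => (Fin.cons p.1 fun i : Fin n => p.2.getD i d : Fin (n + 1) → α)) ⁻¹'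
          ((List.ofFn : (Fin (n + 1) → α) → List α) ⁻¹' s)) := by
    ext ⟨a, l⟩
    have key : List.ofFn (Fin.cons a fun i : Fin l.length => l.getD i d : Fin (l.length + 1) → α)
        = a :: l := by
      rw [List.ofFn_cons]
      congr 1
      apply List.ext_getElem <;> simp
    constructor
    · intro h
      refine Set.mem_iUnion.2 ⟨l.length, rfl, ?_⟩
      change List.ofFn _ ∈ s
      rw [key]; exact h
    · intro h
      obtain ⟨n, hn, h⟩ := Set.mem_iUnion.1 h
      obtain rfl : l.length = n := hn
      change List.ofFn _ ∈ s at h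
      rw [key] at h; exact h
  rw [h]
  refine MeasurableSet.iUnion fun n => MeasurableSet.inter ?_ ?_
  · have hl : Measurable (List.length : List α → ℕ) :=
      measurable_of_ofFn fun n => by simp
    exact (hl.comp measurable_snd) (measurableSet_singleton n)
  · have hc : Measurable fun p : α × List α =>
        (Fin.cons p.1 fun i : Fin n => p.2.getD i d : Fin (n + 1) → α) := by
      refine measurable_pi_iff.2 fun i => ?_
      refine Fin.cases ?_ (fun i => ?_) i
      · simpa using measurable_fst
      · simp only [Fin.cons_succ]
        have hd : Measurable fun l : List α => l.getD i d := by
          refine measurable_of_ofFn fun m => ?_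
          by_cases hi : (i : ℕ) < m
          · simpa [List.getD_eq_getElem?_getD, hi] using
              (measurable_pi_apply (⟨i, hi⟩ : Fin m) : Measurable fun x : Fin m → α => x ⟨i, hi⟩)
          · simp [List.getD_eq_getElem?_getD, hi]
        exact hd.comp measurable_snd
    exact hc (measurableSet_list.1 hs (n + 1))

theorem measurable_getLast {α β : Type*} [MeasurableSpace α] [MeasurableSpace β]
    {f : Option α → β} (hf : Measurable fun a => f (some a)) :
    Measurable fun l : List α => f l.getLast? := by
  refine measurable_of_ofFn fun n => ?_
  cases n with
  | zero => simp
  | succ n =>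
    have : (fun x : Fin (n + 1) → α => f (List.ofFn x).getLast?) = fun x => f (some (x (Fin.last n))) := by
      funext x
      rw [List.getLast?_eq_some_getLast (by simp), List.getLast_ofFn_succ]
    rw [this]
    exact hf.comp (measurable_pi_apply _)

theorem measurable_filter_map {α β : Type*} [MeasurableSpace α] [MeasurableSpace β]
    {p : α → Prop} [DecidablePred p] (hp : MeasurableSet {a | p a}) {g : α → β} (hg : Measurable g) :
    Measurable fun l : List α => (l.filter p).map g := by
  refine measurable_of_ofFn fun n => ?_
  induction n with
  | zero => simp
  | succ n ih =>
    have h : (fun x : Fin (n + 1) → α => ((List.ofFn x).filter p).map g) = fun x =>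
        if p (x 0) then g (x 0) :: ((List.ofFn fun i : Fin n => x i.succ).filter p).map g
        else ((List.ofFn fun i : Fin n => x i.succ).filter p).map g := by
      funext x
      by_cases hx : p (x 0) <;> simp [List.ofFn_succ, hx]
    have htail : Measurable fun x : Fin (n + 1) → α =>
        ((List.ofFn fun i : Fin n => x i.succ).filter p).map g :=
      ih.comp (measurable_pi_iff.2 fun i => measurable_pi_apply _)
    rw [h]
    refine Measurable.ite (measurable_pi_apply 0 hp) ?_ htail
    exact measurable_list_cons.comp ((hg.comp (measurable_pi_apply 0)).prodMk htail)

/-! ### The law of a random sequence given by a one-step law -/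

/-- The history consisting of the records `0, …, n` of a sequence. -/
def prefixHistory {α : Type*} (n : ℕ) (x : (i : Finset.Iic n) → α) : List α :=
  List.ofFn fun i : Fin (n + 1) => x ⟨i, Finset.mem_Iic.2 (Nat.le_of_lt_succ i.2)⟩

theorem measurable_prefixHistory {α : Type*} [MeasurableSpace α] (n : ℕ) :
    Measurable (prefixHistory n : ((i : Finset.Iic n) → α) → List α) :=
  (measurable_ofFn (n + 1)).comp (measurable_pi_iff.2 fun _ => measurable_pi_apply _)

/-- The probability measure on infinite sequences under which, for every finite sequence `h` of
records that has been produced so far, the next record has law `κ h` (Ionescu-Tulcea). -/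
noncomputable def sequenceLaw {α : Type*} [MeasurableSpace α] (κ : Kernel (List α) α)
    [IsMarkovKernel κ] : Measure (ℕ → α) :=
  Kernel.trajMeasure (X := fun _ => α) (κ [])
    fun n => κ.comap (prefixHistory n) (measurable_prefixHistory n)

instance isProbabilityMeasure_sequenceLaw {α : Type*} [MeasurableSpace α] (κ : Kernel (List α) α)
    [IsMarkovKernel κ] : IsProbabilityMeasure (sequenceLaw κ) := by
  unfold sequenceLaw; infer_instance

/-! ### Data, programs and their running time -/

/-- Binary trees: the data on which programs operate, and the names of states and actions. -/
inductive BTree where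
  | nil : BTree
  | cons : BTree → BTree → BTree
  deriving DecidableEq

namespace BTree

/-- The number of nodes and leaves. -/
def size : BTree → ℕ
  | nil => 1
  | cons a b => a.size + b.size + 1

/-- The left subtree. -/
def hd : BTree → BTree
  | nil => nil
  | cons a _ => a

/-- The right subtree. -/
def tl : BTree → BTree
  | nil => nil
  | cons _ b => b

/-- The encoding of finite sequences. -/
def ofList (l : List BTree) : BTree := l.foldr cons nil

/-- The encoding of bits. -/
def ofBool : Bool → BTree
  | false => nil
  | true => cons nil nil

/-- The binary encoding of natural numbers, least significant bit first. -/
def ofNat (n : ℕ) : BTree := ofList (n.bits.map ofBool)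

/-- The encoding of a non-negative rational number by numerator and denominator in binary. -/
def ofRat (q : ℚ≥0) : BTree := cons (ofNat q.num) (ofNat q.den)

/-- An injection into the natural numbers. -/
def code : BTree → ℕ
  | nil => 0
  | cons a b => Nat.pair a.code b.code + 1

theorem code_injective : Function.Injective code := by
  intro a
  induction a with
  | nil => intro b h; cases b <;> simp_all [code]
  | cons a b iha ihb =>
    intro c h
    cases c with
    | nil => simp [code] at h
    | cons c d =>
      have h := Nat.pair_eq_pair.1 (Nat.succ_injective h)
      rw [iha h.1, ihb h.2]

instance : Countable BTree := code_injective.countable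

instance : MeasurableSpace BTree := ⊤

instance : DiscreteMeasurableSpace BTree := ⟨fun _ => trivial⟩

end BTree

/-- Programs of a WHILE language on binary trees. A program transforms one tree. -/
inductive Prog where
  | skip : Prog
  | nil : Prog
  | hd : Prog
  | tl : Prog
  | pair : Prog → Prog → Prog
  | seq : Prog → Prog → Prog
  | cond : Prog → Prog → Prog → Prog
  | loop : Prog → Prog → Prog

/-- `Runs f x y t`: on input `x` the program `f` halts with output `y` after `t` steps. An
elementary operation, and every copy or test of the current tree, costs as many steps as the current
tree has nodes. Truth is represented by trees other than `nil`. -/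
inductive Runs : Prog → BTree → BTree → ℕ → Prop where
  | skip (x : BTree) : Runs .skip x x x.size
  | nil (x : BTree) : Runs .nil x .nil x.size
  | hd (x : BTree) : Runs .hd x x.hd x.size
  | tl (x : BTree) : Runs .tl x x.tl x.size
  | pair {f g : Prog} {x y z : BTree} {t u : ℕ} :
      Runs f x y t → Runs g x z u → Runs (.pair f g) x (.cons y z) (t + u + x.size)
  | seq {f g : Prog} {x y z : BTree} {t u : ℕ} :
      Runs f x y t → Runs g y z u → Runs (.seq f g) x z (t + u + 1)
  | condTrue {c f g : Prog} {x a b y : BTree} {s t : ℕ} :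
      Runs c x (.cons a b) s → Runs f x y t → Runs (.cond c f g) x y (s + t + x.size)
  | condFalse {c f g : Prog} {x y : BTree} {s t : ℕ} :
      Runs c x .nil s → Runs g x y t → Runs (.cond c f g) x y (s + t + x.size)
  | loopDone {c f : Prog} {x : BTree} {s : ℕ} :
      Runs c x .nil s → Runs (.loop c f) x x (s + x.size)
  | loopStep {c f : Prog} {x a b y z : BTree} {s t u : ℕ} :
      Runs c x (.cons a b) s → Runs f x y t → Runs (.loop c f) y z u →
        Runs (.loop c f) x z (s + t + u + x.size)

/-! ### Decentralized partially observable Markov decision processes -/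

/-- A DEC-POMDP with `n` players. Its finite sets of states, of actions and of observations are
initial segments of the natural numbers; actions of different players count as different. -/
structure DecPOMDP (n : ℕ) where
  /-- number of states -/
  numS : ℕ
  /-- initial state -/
  init : Fin numS
  /-- number of actions of each player -/
  numAct : Fin n → ℕ
  numAct_pos : ∀ i, 0 < numAct i
  /-- number of observations of each player -/
  numObs : Fin n → ℕ
  /-- `P s a s'`: probability to move from `s` to `s'` under the global action `a` -/
  P : Fin numS → (∀ i, Fin (numAct i)) → Fin numS → ℚ≥0
  P_sum : ∀ s a, ∑ s', P s a s' = 1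
  /-- `O s a s' o`: probability of the global observation `o` on the transition `s, a, s'` -/
  O : Fin numS → (∀ i, Fin (numAct i)) → Fin numS → (∀ i, Fin (numObs i)) → ℚ≥0
  O_sum : ∀ s a s', ∑ o, O s a s' o = 1

namespace DecPOMDP

variable {n : ℕ} (M : DecPOMDP n)

/-- Global actions. -/
abbrev GAct : Type := ∀ i, Fin (M.numAct i)

/-- Global observations. -/
abbrev GObs : Type := ∀ i, Fin (M.numObs i)

/-- One step `(a, o, s')` of a play: the global action, the global observation, the next state. -/
abbrev Rec : Type := M.GAct × M.GObs × Fin M.numS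

/-- Strategy profiles: every player randomizes over its actions, depending on the sequence of the
observations it has received. -/
abbrev Profile : Type := ∀ i, List (Fin (M.numObs i)) → PMF (Fin (M.numAct i))

/-- The current state after a history. -/
def lastState (h : List M.Rec) : Fin M.numS :=
  match h.getLast? with
  | none => M.init
  | some r => r.2.2

/-- The law of the next step after the history `h`. -/
noncomputable def stepPMF (σ : M.Profile) (h : List M.Rec) : PMF M.Rec :=
  PMF.ofFintype
    (fun r => (∏ i, σ i (h.map fun r' => r'.2.1 i) (r.1 i)) *
      (((M.P (M.lastState h) r.1 r.2.2 : NNReal) : ℝ≥0∞) *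
        ((M.O (M.lastState h) r.1 r.2.2 r.2.1 : NNReal) : ℝ≥0∞)))
    (by
      have hO : ∀ s a s', ∑ o, ((M.O s a s' o : NNReal) : ℝ≥0∞) = 1 := by
        intro s a s'
        have := M.O_sum s a s'
        exact_mod_cast this
      have hP : ∀ s a, ∑ s', ((M.P s a s' : NNReal) : ℝ≥0∞) = 1 := by
        intro s a
        have := M.P_sum s a
        exact_mod_cast this
      rw [Fintype.sum_prod_type]
      simp_rw [Fintype.sum_prod_type_right, ← Finset.mul_sum, hO, mul_one, hP, mul_one]
      rw [← Fintype.piFinset_univ, ← Finset.prod_univ_sum]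
      refine Finset.prod_eq_one fun i _ => ?_
      exact (tsum_fintype _).symm.trans (PMF.tsum_coe _))

/-- The one-step law as a Markov kernel. -/
noncomputable def stepKernel (σ : M.Profile) : Kernel (List M.Rec) M.Rec where
  toFun h := (M.stepPMF σ h).toMeasure
  measurable' := measurable_of_ofFn fun _ => .of_discrete

instance (σ : M.Profile) : IsMarkovKernel (M.stepKernel σ) :=
  ⟨fun h => inferInstanceAs (IsProbabilityMeasure (M.stepPMF σ h).toMeasure)⟩

/-- The probability measure on plays induced by a strategy profile. A play from the initial state is
given by the sequence of its steps. -/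
noncomputable def playLaw (σ : M.Profile) : Measure (ℕ → M.Rec) := sequenceLaw (M.stepKernel σ)

/-- The state of a play after `k` steps. -/
def stateAt (ρ : ℕ → M.Rec) : ℕ → Fin M.numS
  | 0 => M.init
  | k + 1 => (ρ k).2.2

/-- The plays that reach the target set. -/
def reach (T : Finset (Fin M.numS)) : Set (ℕ → M.Rec) := {ρ | ∃ k, M.stateAt ρ k ∈ T}

/-- All tuples in `Fin (k 0) × ⋯ × Fin (k (n - 1))`, in lexicographic order. -/
def allTuples : (n : ℕ) → (k : Fin n → ℕ) → List (∀ i, Fin (k i))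
  | 0, _ => [fun i => i.elim0]
  | n + 1, k => (List.finRange (k 0)).flatMap fun x =>
      (allTuples n fun i => k i.succ).map fun f => Fin.cons x f

/-- The encoding of an element of an initial segment of the natural numbers. -/
def ofFin {k : ℕ} (x : Fin k) : BTree := .ofNat x

/-- The encoding of a tuple. -/
def ofTuple {n : ℕ} {k : Fin n → ℕ} (f : ∀ i, Fin (k i)) : BTree :=
  .ofList ((List.finRange n).map fun i => ofFin (f i))

/-- The encoding of the set `Fin k` by the list of its elements. -/
def ofRange (k : ℕ) : BTree := .ofList ((List.finRange k).map ofFin)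

/-- The encoding of a DEC-POMDP and a target set: finite sets are listed, the transition function
and the observation function are given as tables, all numbers are in binary. -/
def encode (T : Finset (Fin M.numS)) : BTree :=
  .ofList [
    ofRange M.numS,
    ofFin M.init,
    .ofList ((List.finRange n).map fun i => ofRange (M.numAct i)),
    .ofList ((List.finRange n).map fun i => ofRange (M.numObs i)),
    .ofList ((List.finRange M.numS).flatMap fun s => (allTuples n M.numAct).flatMap fun a =>
      (List.finRange M.numS).map fun s' =>
        .ofList [ofFin s, ofTuple a, ofFin s', .ofRat (M.P s a s')]),
    .ofList ((List.finRange M.numS).flatMap fun s => (allTuples n M.numAct).flatMap fun a =>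
      (List.finRange M.numS).flatMap fun s' => (allTuples n M.numObs).map fun o =>
        .ofList [ofFin s, ofTuple a, ofFin s', ofTuple o, .ofRat (M.O s a s' o)]),
    .ofList (((List.finRange M.numS).filter (· ∈ T)).map ofFin)]

end DecPOMDP

/-! ### Distributed interactive Markov chains -/

/-- An interactive Markov chain with finitely many states, actions and transitions. States and
actions are named by binary trees. -/
structure IMC where
  states : Finset BTree
  init : BTree
  init_mem : init ∈ states
  acts : Finset BTree
  /-- action transitions `(s, a, s')` -/
  trans : Finset (BTree × BTree × BTree)
  trans_mem : ∀ e ∈ trans, e.1 ∈ states ∧ e.2.1 ∈ acts ∧ e.2.2 ∈ states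
  /-- delay transitions `(s, rate, s')` -/
  delays : Finset (BTree × ℚ≥0 × BTree)
  delays_mem : ∀ e ∈ delays, e.1 ∈ states ∧ 0 < e.2.1 ∧ e.2.2 ∈ states

/-- A local choice: an action transition, or `⊥`. -/
inductive Choice where
  | bot : Choice
  | trans : BTree × BTree × BTree → Choice

namespace Choice

theorem exists_injective : ∃ f : Choice → Option (BTree × BTree × BTree), Function.Injective f := by
  refine ⟨fun c => match c with | bot => none | trans e => some e, ?_⟩
  intro a b h
  cases a <;> cases b <;> simp_all

instance : Countable Choice := exists_injective.choose_spec.countable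

instance : MeasurableSpace Choice := ⊤

instance : DiscreteMeasurableSpace Choice := ⟨fun _ => trivial⟩

/-- The choice is an action transition labelled `a`. -/
def HasLabel (a : BTree) : Choice → Prop
  | bot => False
  | trans e => e.2.1 = a

/-- The target of the chosen transition (`s` for the choice `⊥`). -/
def target (s : BTree) : Choice → BTree
  | bot => s
  | trans e => e.2.2

end Choice

/-- The choices available in the local state `s`: an action transition from `s`, or `⊥` if there is
no such transition. -/
def IMC.Available (M : IMC) (s : BTree) : Choice → Prop
  | .bot => ∀ e ∈ M.trans, e.1 ≠ s
  | .trans e => e ∈ M.trans ∧ e.1 = s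

/-- The labels of steps: an action; a delay transition of a player; `halt` if no action is enabled
and there is no delay transition, so that the play stays in its state forever. -/
inductive Label (n : ℕ) where
  | act : BTree → Label n
  | delay : Fin n → Label n
  | halt : Label n

namespace Label

theorem exists_injective (n : ℕ) : ∃ f : Label n → Option (BTree ⊕ Fin n), Function.Injective f := by
  refine ⟨fun c => match c with
    | act a => some (.inl a) | delay j => some (.inr j) | halt => none, ?_⟩
  intro a b h
  cases a <;> cases b <;> simp_all

instance {n : ℕ} : Countable (Label n) := (exists_injective n).choose_spec.countable

instance {n : ℕ} : MeasurableSpace (Label n) := ⊤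

instance {n : ℕ} : DiscreteMeasurableSpace (Label n) := ⟨fun _ => trivial⟩

end Label

/-- The decisions of a scheduler: an action, or `none` (the symbol `⊥`). -/
instance : MeasurableSpace (Option BTree) := ⊤

instance : DiscreteMeasurableSpace (Option BTree) := ⟨fun _ => trivial⟩

/-- A distributed IMC with `n` players. Modules synchronise on the actions they share; every action
has a participant whose action transitions have no cycle that involves this action. -/
structure DistIMC (n : ℕ) where
  mod : Fin n → IMC
  acyclic : ∀ a, (∃ j, a ∈ (mod j).acts) → ∃ j, a ∈ (mod j).acts ∧
    ∀ s s', (s, a, s') ∈ (mod j).trans →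
      ¬ Relation.ReflTransGen (fun u v => ∃ b, (u, b, v) ∈ (mod j).trans) s' s

namespace DistIMC

/-- Global states. -/
abbrev GState (n : ℕ) : Type := Fin n → BTree

/-- Global choices. -/
abbrev GChoice (n : ℕ) : Type := Fin n → Choice

/-- One step `(c, a, s, t)` of a play: the global choice made in the current state, the label of the
transition then taken, the next state, and the absolute time of the transition. -/
abbrev Rec (n : ℕ) : Type := GChoice n × Label n × GState n × ℝ

/-- One step `(c, a, s, t)` of a local play: local choice, label, next local state, time. -/
abbrev LRec (n : ℕ) : Type := Choice × Label n × BTree × ℝ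

variable {n : ℕ} (G : DistIMC n)

/-- The initial global state. -/
def init : GState n := fun j => (G.mod j).init

/-- The global states of the distributed IMC. -/
def globalStates : Set (GState n) := {s | ∀ j, s j ∈ (G.mod j).states}

/-- The players that synchronise over a label, and thus take part in (and observe) its step. -/
def Sync : Label n → Set (Fin n)
  | .act a => {j | a ∈ (G.mod j).acts}
  | .delay j => {j}
  | .halt => ∅

/-- The actions enabled in a global choice. -/
def Enabled (c : GChoice n) : Set BTree :=
  {a | (∃ j, a ∈ (G.mod j).acts) ∧ ∀ j, a ∈ (G.mod j).acts → (c j).HasLabel a}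

/-- The current global state after a (global) history. -/
def lastState (h : List (Rec n)) : GState n :=
  match h.getLast? with
  | none => G.init
  | some r => r.2.2.1

/-- The time of the last transition of a history. -/
def lastTime (h : List (Rec n)) : ℝ :=
  match h.getLast? with
  | none => 0
  | some r => r.2.2.2

open Classical in
/-- The local history of player `j`: the local parts of the steps that `j` observes. -/
noncomputable def localHist (j : Fin n) (h : List (Rec n)) : List (LRec n) :=
  (h.filter fun r => j ∈ G.Sync r.2.1).map fun r => (r.1 j, r.2.1, r.2.2.1 j, r.2.2.2)

/-- The current local state of player `j` after a local history. -/
def localLast (j : Fin n) (h : List (LRec n)) : BTree :=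
  match h.getLast? with
  | none => (G.mod j).init
  | some r => r.2.2.1

theorem measurable_lastState : Measurable G.lastState :=
  measurable_getLast (f := fun o : Option (Rec n) => match o with | none => G.init | some r => r.2.2.1)
    (by fun_prop)

theorem measurable_lastTime : Measurable (lastTime : List (Rec n) → ℝ) :=
  measurable_getLast (f := fun o : Option (Rec n) => match o with | none => (0 : ℝ) | some r => r.2.2.2)
    (by fun_prop)

theorem measurable_localHist (j : Fin n) : Measurable (G.localHist j) := by
  classical
  have hp : MeasurableSet {r : Rec n | j ∈ G.Sync r.2.1} :=
    (measurable_fst.comp measurable_snd) (.of_discrete : MeasurableSet {l : Label n | j ∈ G.Sync l})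
  have hg : Measurable fun r : Rec n => ((r.1 j, r.2.1, r.2.2.1 j, r.2.2.2) : LRec n) := by fun_prop
  unfold localHist
  convert measurable_filter_map hp hg using 1

/-- A strategy of player `j`: a measurable map from local histories to probability distributions
over the choices available in the last local state. -/
structure Strategy (j : Fin n) where
  kernel : Kernel (List (LRec n)) Choice
  markov : IsMarkovKernel kernel
  available : ∀ h, ∀ᵐ c ∂(kernel h), (G.mod j).Available (G.localLast j h) c

/-- Strategy profiles. -/
abbrev Profile : Type := ∀ j, G.Strategy j

/-- A scheduler: a measurable map that assigns to a history and a global choice a probability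
distribution over the enabled actions, or `⊥` if no action is enabled. -/
structure Scheduler where
  kernel : Kernel (List (Rec n) × GChoice n) (Option BTree)
  markov : IsMarkovKernel kernel
  enabled : ∀ h c, ∀ᵐ o ∂(kernel (h, c)), match o with
    | some a => a ∈ G.Enabled c
    | none => G.Enabled c = ∅

attribute [instance] Strategy.markov Scheduler.markov

/-- Schedulers exist. -/
instance : Nonempty G.Scheduler := by
  classical
  let f : List (Rec n) × GChoice n → Option BTree := fun x =>
    if h : (G.Enabled x.2).Nonempty then some h.choose else none
  have hf : Measurable f :=
    (Measurable.of_discrete (f := fun c : GChoice n =>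
      if h : (G.Enabled c).Nonempty then some h.choose else none)).comp measurable_snd
  refine ⟨⟨Kernel.deterministic f hf, inferInstance, fun h c => ?_⟩⟩
  rw [Kernel.deterministic_apply, ae_dirac_eq, Filter.eventually_pure]
  by_cases he : (G.Enabled c).Nonempty
  · simpa [f, he] using he.choose_spec
  · simpa [f, he] using Set.not_nonempty_iff_eq_empty.1 he

/-- Player `j` makes a new choice after the history `h`: it takes part in the last step, or there has
been no step yet. -/
def Chooses (j : Fin n) (h : List (Rec n)) : Prop :=
  match h.getLast? with
  | none => True
  | some r => j ∈ G.Sync r.2.1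

/-- The previous choice of player `j`. -/
def prevChoice (j : Fin n) (h : List (Rec n)) : Choice :=
  match h.getLast? with
  | none => .bot
  | some r => r.1 j

theorem measurableSet_chooses (j : Fin n) : MeasurableSet {h | G.Chooses j h} := by
  refine measurableSet_setOfPred.2 ?_
  refine measurable_getLast (f := fun o : Option (Rec n) => match o with
    | none => True
    | some r => j ∈ G.Sync r.2.1) ?_
  exact (Measurable.of_discrete (f := fun l : Label n => j ∈ G.Sync l)).comp
    (measurable_fst.comp measurable_snd)

theorem measurable_prevChoice (j : Fin n) :
    Measurable (prevChoice j : List (Rec n) → Choice) :=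
  measurable_getLast (f := fun o : Option (Rec n) => match o with | none => Choice.bot | some r => r.1 j)
    ((measurable_pi_apply j).comp measurable_fst)

/-- The law of the choice of player `j` after a history: a player who makes a new choice uses its
strategy on its local history, the others keep their previous choices. -/
noncomputable def choiceLaw (σ : G.Profile) (j : Fin n) : Kernel (List (Rec n)) Choice :=
  open Classical in
  Kernel.piecewise (G.measurableSet_chooses j)
    ((σ j).kernel.comap (G.localHist j) (G.measurable_localHist j))
    (Kernel.deterministic (prevChoice j) (measurable_prevChoice j))

instance (σ : G.Profile) (j : Fin n) : IsMarkovKernel (G.choiceLaw σ j) := by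
  unfold choiceLaw; infer_instance

/-- The global choice after a history: the players choose independently. -/
noncomputable def choiceKernel (σ : G.Profile) : Kernel (List (Rec n)) (GChoice n) where
  toFun h := Measure.pi fun j => G.choiceLaw σ j h
  measurable' := by
    refine Measure.measurable_of_measurable_coe _ fun s _ => ?_
    have h : ∀ h : List (Rec n), (Measure.pi fun j => G.choiceLaw σ j h) s
        = ∑' c : s, ∏ j, G.choiceLaw σ j h {(c : GChoice n) j} := by
      intro h
      rw [← Measure.tsum_indicator_apply_singleton _ s .of_discrete, tsum_subtype s
        (fun c : GChoice n => ∏ j, G.choiceLaw σ j h {c j})]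
      refine tsum_congr fun c => ?_
      by_cases hc : c ∈ s
      · simp [hc, Measure.pi_singleton]
      · simp [hc]
    simp_rw [h]
    refine Measurable.tsum fun c => ?_
    refine Finset.measurable_prod _ fun j _ => ?_
    exact (G.choiceLaw σ j).measurable_coe .of_discrete

instance (σ : G.Profile) : IsMarkovKernel (G.choiceKernel σ) :=
  ⟨fun h => inferInstanceAs (IsProbabilityMeasure (Measure.pi fun j => G.choiceLaw σ j h))⟩

open Classical in
/-- The step on action `a`: its participants move to the targets of their choices, at once. -/
noncomputable def actStep (h : List (Rec n)) (c : GChoice n) (a : BTree) :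
    Label n × GState n × ℝ :=
  (.act a,
    fun j => if a ∈ (G.mod j).acts then (c j).target (G.lastState h j) else G.lastState h j,
    lastTime h)

/-- The delay transitions `(j, rate, s')` of the players `j` out of their local states. -/
def edges (s : GState n) : Finset (Fin n × ℚ≥0 × BTree) :=
  Finset.univ.biUnion fun j =>
    ((G.mod j).delays.filter fun e => e.1 = s j).image fun e => (j, e.2.1, e.2.2)

theorem edges_pos {s : GState n} (e : G.edges s) : (0 : ℝ) < (e.1.2.1 : ℝ) := by
  obtain ⟨e, he⟩ := e
  simp only [edges, Finset.mem_biUnion, Finset.mem_image, Finset.mem_filter] at he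
  obtain ⟨j, -, d, ⟨hd, -⟩, rfl⟩ := he
  exact_mod_cast ((G.mod j).delays_mem d hd).2.1

/-- The independent, exponentially distributed delays of the delay transitions out of a state. -/
noncomputable def delayLaw (s : GState n) : Measure (G.edges s → ℝ) :=
  Measure.pi fun e => expMeasure (e.1.2.1 : ℝ)

/-- The transition `e` has the minimum delay. -/
def wins {s : GState n} (e : G.edges s) : Set (G.edges s → ℝ) := {x | ∀ e', e' ≠ e → x e < x e'}

open Classical in
/-- The law of the label, the next state and the waiting time if no action is enabled in the state
`s`: the delay transition with the minimum delay is taken after this delay. -/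
noncomputable def raceLaw (s : GState n) : Measure (Label n × GState n × ℝ) :=
  if (G.edges s).Nonempty then
    ∑ e : G.edges s, ((G.delayLaw s).restrict (G.wins e)).map fun x =>
      (.delay e.1.1, Function.update s e.1.1 e.1.2.2, x e)
  else Measure.dirac (.halt, s, 0)

theorem measurableSet_wins {s : GState n} (e : G.edges s) : MeasurableSet (G.wins e) := by
  have : G.wins e = ⋂ e', ⋂ (_ : e' ≠ e), {x : G.edges s → ℝ | x e < x e'} := by
    ext x; simp [wins]
  rw [this]
  exact MeasurableSet.iInter fun e' => MeasurableSet.iInter fun _ =>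
    measurableSet_lt (measurable_pi_apply e) (measurable_pi_apply e')

instance (s : GState n) (e : G.edges s) : IsProbabilityMeasure (expMeasure (e.1.2.1 : ℝ)) :=
  isProbabilityMeasure_expMeasure (G.edges_pos e)

instance (s : GState n) : IsProbabilityMeasure (G.delayLaw s) := by
  unfold delayLaw; infer_instance

theorem delayLaw_tie {s : GState n} {e e' : G.edges s} (h : e ≠ e') :
    G.delayLaw s {x | x e = x e'} = 0 := by
  classical
  have hna : ∀ r : ℝ, NullSingletonClass (expMeasure r) := fun r => by
    unfold expMeasure gammaMeasure; infer_instance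
  have hind : iIndepFun (fun (i : G.edges s) (x : G.edges s → ℝ) => x i) (G.delayLaw s) :=
    iIndepFun_pi (X := fun _ => id) fun _ => aemeasurable_id
  have hpair := (indepFun_iff_map_prod_eq_prod_map_map (measurable_pi_apply e).aemeasurable
    (measurable_pi_apply e').aemeasurable).1 (hind.indepFun h)
  have hmap : ∀ i : G.edges s, (G.delayLaw s).map (fun x => x i) = expMeasure (i.1.2.1 : ℝ) :=
    fun i => (measurePreserving_eval (fun e : G.edges s => expMeasure (e.1.2.1 : ℝ)) i).map_eq
  have hd : MeasurableSet {p : ℝ × ℝ | p.1 = p.2} := measurableSet_eq_fun measurable_fst measurable_snd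
  have : {x : G.edges s → ℝ | x e = x e'} = (fun x => (x e, x e')) ⁻¹' {p : ℝ × ℝ | p.1 = p.2} := rfl
  rw [this, ← Measure.map_apply (by fun_prop) hd, hpair, hmap, hmap,
    Measure.measure_prod_null hd]
  refine Filter.Eventually.of_forall fun a => ?_
  have : Prod.mk a ⁻¹' {p : ℝ × ℝ | p.1 = p.2} = {a} := by ext b; simp [eq_comm]
  change expMeasure _ (Prod.mk a ⁻¹' {p : ℝ × ℝ | p.1 = p.2}) = 0
  rw [this]
  exact measure_singleton a

theorem sum_wins {s : GState n} (hs : (G.edges s).Nonempty) :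
    ∑ e, G.delayLaw s (G.wins e) = 1 := by
  classical
  have hdisj : Pairwise (Function.onFun Disjoint fun e : G.edges s => G.wins e) := by
    intro e e' h
    refine Set.disjoint_left.2 fun x hx hx' => ?_
    exact lt_asymm (hx e' h.symm) (hx' e h)
  rw [← tsum_fintype (L := .unconditional _), ← measure_iUnion hdisj fun e => G.measurableSet_wins e,
    ← prob_compl_eq_zero_iff (MeasurableSet.iUnion fun e => G.measurableSet_wins e)]
  refine measure_mono_null (t := ⋃ e : G.edges s, ⋃ e' : G.edges s, ⋃ (_ : e ≠ e'),
    {x | x e = x e'}) ?_ ?_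
  · intro x hx
    by_contra hne
    simp only [Set.mem_iUnion, not_exists] at hne
    obtain ⟨e₀, he₀⟩ := hs
    obtain ⟨e, -, he⟩ := Finset.exists_min_image Finset.univ x ⟨⟨e₀, he₀⟩, Finset.mem_univ _⟩
    refine hx (Set.mem_iUnion.2 ⟨e, fun e' h => lt_of_le_of_ne (he e' (Finset.mem_univ _)) ?_⟩)
    exact fun h' => hne e e' h.symm h'
  · simp only [measure_iUnion_null_iff]
    exact fun e e' h => G.delayLaw_tie h

instance (s : GState n) : IsProbabilityMeasure (G.raceLaw s) := by
  unfold raceLaw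
  split_ifs with hs
  · refine ⟨?_⟩
    rw [Measure.finsetSum_apply]
    rw [← G.sum_wins hs]
    refine Finset.sum_congr rfl fun e _ => ?_
    rw [Measure.map_apply (by fun_prop) MeasurableSet.univ, Set.preimage_univ,
      Measure.restrict_apply_univ]
  · infer_instance

/-- `raceLaw` as a Markov kernel. -/
noncomputable def raceKernel : Kernel (GState n) (Label n × GState n × ℝ) where
  toFun := G.raceLaw
  measurable' := .of_discrete

instance : IsMarkovKernel G.raceKernel := ⟨fun s => inferInstanceAs (IsProbabilityMeasure (G.raceLaw s))⟩

/-- The step after a history if no action is enabled: the waiting time is added to the time. -/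
noncomputable def delayKernel : Kernel (List (Rec n)) (Label n × GState n × ℝ) :=
  ((G.raceKernel.comap G.lastState G.measurable_lastState) ×ₖ
    (Kernel.deterministic lastTime measurable_lastTime)).map
      fun p => (p.1.1, p.1.2.1, p.2 + p.1.2.2)

instance : IsMarkovKernel G.delayKernel := by
  unfold delayKernel
  exact Kernel.IsMarkovKernel.map _ (by fun_prop)

theorem measurable_actStep :
    Measurable fun x : (List (Rec n) × GChoice n) × BTree => G.actStep x.1.1 x.1.2 x.2 := by
  classical
  have h : Measurable fun x : ((GState n × ℝ) × GChoice n) × BTree =>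
      ((.act x.2, fun j => if x.2 ∈ (G.mod j).acts then (x.1.2 j).target (x.1.1.1 j) else x.1.1.1 j,
        x.1.1.2) : Label n × GState n × ℝ) := by
    refine Measurable.prodMk (Measurable.of_discrete.comp measurable_snd) (Measurable.prodMk ?_
      (by fun_prop))
    exact (Measurable.of_discrete (f := fun y : GState n × GChoice n × BTree => fun j =>
      if y.2.2 ∈ (G.mod j).acts then (y.2.1 j).target (y.1 j) else y.1 j)).comp
      (by fun_prop : Measurable fun x : ((GState n × ℝ) × GChoice n) × BTree =>
        (x.1.1.1, x.1.2, x.2))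
  have h' : Measurable fun x : (List (Rec n) × GChoice n) × BTree =>
      (((G.lastState x.1.1, lastTime x.1.1), x.1.2), x.2) :=
    (((G.measurable_lastState.comp (measurable_fst.comp measurable_fst)).prodMk
      (measurable_lastTime.comp (measurable_fst.comp measurable_fst))).prodMk
      (measurable_snd.comp measurable_fst)).prodMk measurable_snd
  convert h.comp h' using 1
  funext x
  simp only [actStep, Function.comp]

/-- The label, the next state and the time of the next step, given the history, the global choice
and the decision of the scheduler. -/
noncomputable def moveKernel :
    Kernel ((List (Rec n) × GChoice n) × Option BTree) (Label n × GState n × ℝ) where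
  toFun x := match x.2 with
    | some a => Measure.dirac (G.actStep x.1.1 x.1.2 a)
    | none => G.delayKernel x.1.1
  measurable' := by
    refine measurable_from_prod_countable_left fun o => ?_
    cases o with
    | none => exact G.delayKernel.measurable.comp measurable_fst
    | some a =>
      exact Measure.measurable_dirac.comp (G.measurable_actStep.comp
        (measurable_id.prodMk measurable_const))

instance : IsMarkovKernel G.moveKernel := by
  refine ⟨fun x => ?_⟩
  obtain ⟨x, o⟩ := x
  cases o with
  | none => exact inferInstanceAs (IsProbabilityMeasure (G.delayKernel x.1))
  | some a => exact inferInstanceAs (IsProbabilityMeasure (Measure.dirac (G.actStep x.1 x.2 a)))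

/-- The law of the next step after a history: the players choose, the scheduler picks an enabled
action if there is one, and the corresponding transition is taken. -/
noncomputable def stepKernel (σ : G.Profile) (δ : G.Scheduler) : Kernel (List (Rec n)) (Rec n) :=
  (G.choiceKernel σ ⊗ₖ (δ.kernel ⊗ₖ G.moveKernel)).map fun p => (p.1, p.2.2)

instance (σ : G.Profile) (δ : G.Scheduler) : IsMarkovKernel (G.stepKernel σ δ) := by
  unfold stepKernel
  exact Kernel.IsMarkovKernel.map _ (by fun_prop)

/-- The probability measure on plays induced by a strategy profile and a scheduler. A play from the
initial state is given by the sequence of its steps. -/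
noncomputable def playLaw (σ : G.Profile) (δ : G.Scheduler) : Measure (ℕ → Rec n) :=
  sequenceLaw (G.stepKernel σ δ)

/-- The state of a play after `k` steps. -/
def stateAt (ρ : ℕ → Rec n) : ℕ → GState n
  | 0 => G.init
  | k + 1 => (ρ k).2.2.1

/-- The absolute time at which a play enters the state `stateAt ρ k`. -/
def timeAt (ρ : ℕ → Rec n) : ℕ → ℝ
  | 0 => 0
  | k + 1 => (ρ k).2.2.2

/-- The plays that reach a state of the target set and stay there for a non-zero amount of time. -/
def reach (T : Finset (GState n)) : Set (ℕ → Rec n) :=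
  {ρ | ∃ k, G.stateAt ρ k ∈ T ∧ (timeAt ρ k < timeAt ρ (k + 1) ∨ (ρ k).2.1 = .halt)}

/-- The encoding of transitions `(s, a, s')`. -/
def encTrans (e : BTree × BTree × BTree) : BTree := .ofList [e.1, e.2.1, e.2.2]

/-- The encoding of delay transitions `(s, rate, s')`. -/
def encDelay (e : BTree × ℚ≥0 × BTree) : BTree := .ofList [e.1, .ofRat e.2.1, e.2.2]

/-- The tree `y` encodes the module `M`; finite sets are given by lists of their elements, in any
order and possibly with repetitions. -/
def EncodesModule (y : BTree) (M : IMC) : Prop :=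
  ∃ (S A : List BTree) (R : List (BTree × BTree × BTree)) (D : List (BTree × ℚ≥0 × BTree)),
    S.toFinset = M.states ∧ A.toFinset = M.acts ∧ R.toFinset = M.trans ∧ D.toFinset = M.delays ∧
    y = .ofList [.ofList S, M.init, .ofList A, .ofList (R.map encTrans), .ofList (D.map encDelay)]

/-- The tree `y` encodes the distributed IMC `G` and the set `T` of global states. -/
def Encodes (y : BTree) (T : Finset (GState n)) : Prop :=
  ∃ (m : Fin n → BTree) (L : List (GState n)),
    (∀ j, EncodesModule (m j) (G.mod j)) ∧ L.toFinset = T ∧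
    y = .cons (.ofList ((List.finRange n).map m))
      (.ofList (L.map fun s => .ofList ((List.finRange n).map s)))

end DistIMC

/-!
# Distributed IMCs can simulate DEC-POMDPs

The distributed IMC has one module per player of the DEC-POMDP `M`, and an environment, player `0`,
that keeps track of the state of `M`. All delay transitions belong to the environment. The
simulation proceeds in rounds, one per step of `M`.

* A round begins in `startState s`. Only there do the players have a choice: player `i` selects a
  transition that stands for an action of `M` (`choiceOf`). A module commits itself to one action
  transition at a time, so the environment cannot wait to see which of several actions the player
  takes. Instead, it asks the players one after the other and offers each of them its actions in
  turn. The player either rejects the offer by an action transition, which is taken at once, or lets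
  a delay of rate `1` elapse, which means that it accepts.
* The next state and the observations are selected by races of exponential delays whose rates are
  the probabilities `M.P` and `M.O`. As these add up to `1`, the waiting time has the standard
  exponential distribution, independently of the outcome (`map_restrict_pi_expMeasure`,
  `lintegral_raceLaw`).
* A player, too, commits itself to one action transition at a time, so different observations cannot
  be announced by different actions. Instead, player `i` receives one tick per possible observation,
  and the environment pauses after the tick that belongs to the actual one (`script`). The
  observation is thus encoded in the times of the ticks.

The environment takes part in every action and offers at most one at a time. Hence a scheduler never
has a choice (`scheduler_eq`). The number of delays in a round is fixed, and all waiting times are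
standard exponential and independent of the simulated process. The reach probability is therefore
the limit of `roundValue`, which is like the recursion `horizonValue` for reach probabilities of
`M`, except that the decisions of the players depend also on the shared sequence of delays
(`toDistIMC_playLaw_reach`).

A profile of `M` is simulated by letting the players decode their observations from the times of the
ticks (`decode_localRound`, `toDistIMC_playLaw_simProfile`). Conversely, the delays and the random
choices of the players can be drawn in advance. A profile of the distributed IMC is then a mixture
of deterministic profiles of `M`, and its reach probability is the average of theirs
(`Responds.lintegral_horizonValue`). The shared delays may correlate the players, and a mixture of
profiles is not in general a profile. But an average lies between two of the averaged values, and
the reach probabilities of `M` form an interval (`exists_iSup_horizonValue_eq`): they are affine in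
each single decision and lower semicontinuous in the profile. So some profile of `M` has exactly the
required reach probability (`exists_profile_of_toDistIMC`).

The reduction is a function on trees that is composed from iterations over lists with polynomially
bounded results. The class `PolyTime` is closed under these (`polyTime_reduction`), and the result
encodes the distributed IMC above (`encodes_reduction`).
-/

/-! ### Measurable functions of finite sequences -/

theorem measurable_list_length {α : Type*} [MeasurableSpace α] :
    Measurable (List.length : List α → ℕ) :=
  measurable_of_ofFn fun n => by simp

theorem measurable_list_getD {α : Type*} [MeasurableSpace α] (i : ℕ) (d : α) :
    Measurable fun l : List α => l.getD i d := by
  refine measurable_of_ofFn fun m => ?_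
  by_cases hi : i < m
  · simpa [List.getD_eq_getElem?_getD, hi] using
      (measurable_pi_apply (⟨i, hi⟩ : Fin m) : Measurable fun x : Fin m → α => x ⟨i, hi⟩)
  · simp [List.getD_eq_getElem?_getD, hi]

theorem measurable_of_ofFn_prod {α β γ : Type*} [MeasurableSpace α] [MeasurableSpace β]
    [MeasurableSpace γ] {f : List α × β → γ}
    (hf : ∀ n : ℕ, Measurable fun p : (Fin n → α) × β => f (List.ofFn p.1, p.2)) :
    Measurable f := by
  rcases isEmpty_or_nonempty α with hα | ⟨⟨d⟩⟩
  · have h0 : ∀ p : List α × β, f p = f (List.ofFn (fun i : Fin 0 => i.elim0), p.2) := by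
      rintro ⟨l, b⟩
      cases l with
      | nil => simp
      | cons a _ => exact (hα.false a).elim
    rw [funext h0]
    exact (hf 0).comp (measurable_const.prodMk measurable_snd)
  intro s hs
  have h : f ⁻¹' s = ⋃ n : ℕ, ({p : List α × β | p.1.length = n} ∩
      (fun p : List α × β => f (List.ofFn (fun i : Fin n => p.1.getD i d), p.2)) ⁻¹' s) := by
    ext ⟨l, b⟩
    have key : List.ofFn (fun i : Fin l.length => l.getD i d) = l := by
      apply List.ext_getElem <;> simp
    simp only [Set.mem_preimage, Set.mem_iUnion, Set.mem_inter_iff, Set.mem_ofPred_eq]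
    constructor
    · intro h
      refine ⟨l.length, rfl, ?_⟩
      rwa [key]
    · rintro ⟨n, rfl, h⟩
      rwa [key] at h
  rw [h]
  refine MeasurableSet.iUnion fun n => MeasurableSet.inter ?_ ?_
  · exact (measurable_list_length.comp measurable_fst) (measurableSet_singleton n)
  · refine (Measurable.comp (hf n) (g := fun p : (Fin n → α) × β => f (List.ofFn p.1, p.2))
      (f := fun p : List α × β => ((fun i : Fin n => p.1.getD i d), p.2)) ?_) hs
    exact (measurable_pi_iff.2 fun i => (measurable_list_getD _ d).comp measurable_fst).prodMk
      measurable_snd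

theorem measurable_list_snoc {α : Type*} [MeasurableSpace α] :
    Measurable fun p : List α × α => p.1 ++ [p.2] := by
  refine measurable_of_ofFn_prod fun n => ?_
  have h : (fun p : (Fin n → α) × α => List.ofFn p.1 ++ [p.2])
      = fun p => List.ofFn (Fin.snoc p.1 p.2 : Fin (n + 1) → α) := by
    funext p
    rw [List.ofFn_succ']
    simp [List.concat_eq_append]
  rw [h]
  refine (measurable_ofFn (n + 1)).comp (measurable_pi_iff.2 fun i => ?_)
  refine Fin.lastCases ?_ (fun j => ?_) i
  · simpa using measurable_snd
  · have := (measurable_pi_apply j).comp (measurable_fst : Measurable (Prod.fst : (Fin n → α) × α → _))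
    simpa [Function.comp_def] using this

theorem Measurable.list_snoc {α β : Type*} [MeasurableSpace α] [MeasurableSpace β]
    {f : β → List α} {g : β → α} (hf : Measurable f) (hg : Measurable g) :
    Measurable fun b => f b ++ [g b] :=
  measurable_list_snoc.comp (hf.prodMk hg)

/-- Left folds are measurable. -/
theorem measurable_list_foldl {α β : Type*} [MeasurableSpace α] [MeasurableSpace β]
    {f : β → α → β} (hf : Measurable fun p : β × α => f p.1 p.2) (b : β) :
    Measurable fun l : List α => l.foldl f b := by
  refine measurable_of_ofFn fun n => ?_
  induction n with
  | zero => simp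
  | succ n ih =>
    have h : (fun x : Fin (n + 1) → α => (List.ofFn x).foldl f b) = fun x =>
        f ((List.ofFn fun i : Fin n => x i.castSucc).foldl f b) (x (Fin.last n)) := by
      funext x
      rw [List.ofFn_succ', List.concat_eq_append, List.foldl_append]
      rfl
    rw [h]
    exact hf.comp ((ih.comp (measurable_pi_iff.2 fun i => measurable_pi_apply _)).prodMk
      (measurable_pi_apply _))

/-! ### Reaching a goal in a random sequence -/

section Reach

variable {α : Type*}

/-- The history that consists of the first `n` records of a sequence. -/
def firstRecords (ρ : ℕ → α) (n : ℕ) : List α := List.ofFn fun i : Fin n => ρ i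

theorem firstRecords_succ (ρ : ℕ → α) (n : ℕ) :
    firstRecords ρ (n + 1) = firstRecords ρ n ++ [ρ n] := by
  unfold firstRecords
  rw [List.ofFn_succ', List.concat_eq_append]
  simp

variable [MeasurableSpace α]

theorem measurable_firstRecords (n : ℕ) : Measurable fun ρ : ℕ → α => firstRecords ρ n :=
  (measurable_ofFn n).comp (measurable_pi_iff.2 fun _ => measurable_pi_apply _)

/-- One step of the expectation of a payoff: a step that satisfies `good` pays `1` and ends the
game, otherwise the payoff is that of the extended history. -/
noncomputable def valueStep (κ : Kernel (List α) α) (good : List α → α → Prop)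
    (f : List α → ℝ≥0∞) (h : List α) : ℝ≥0∞ :=
  open Classical in ∫⁻ r, (if good h r then 1 else f (h ++ [r])) ∂(κ h)

/-- The probability that, after the history `h`, one of the next `m` steps is good. -/
noncomputable def valueIter (κ : Kernel (List α) α) (good : List α → α → Prop) :
    ℕ → List α → ℝ≥0∞
  | 0 => fun _ => 0
  | m + 1 => valueStep κ good (valueIter κ good m)

variable {κ : Kernel (List α) α} {good : List α → α → Prop}

theorem measurable_goodIntegrand (hg : MeasurableSet {p : List α × α | good p.1 p.2})
    {f : List α → ℝ≥0∞} (hf : Measurable f) [∀ h r, Decidable (good h r)] :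
    Measurable fun p : List α × α => (if good p.1 p.2 then 1 else f (p.1 ++ [p.2])) :=
  Measurable.ite hg measurable_const (hf.comp measurable_list_snoc)

theorem measurable_valueStep [IsSFiniteKernel κ]
    (hg : MeasurableSet {p : List α × α | good p.1 p.2})
    {f : List α → ℝ≥0∞} (hf : Measurable f) : Measurable (valueStep κ good f) := by
  classical
  unfold valueStep
  exact Measurable.lintegral_kernel_prod_right' (measurable_goodIntegrand hg hf)

theorem measurable_valueIter [IsSFiniteKernel κ]
    (hg : MeasurableSet {p : List α × α | good p.1 p.2}) (m : ℕ) :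
    Measurable (valueIter κ good m) := by
  induction m with
  | zero => exact measurable_const
  | succ m ih => exact measurable_valueStep hg ih

theorem valueStep_mono {f g : List α → ℝ≥0∞} (h : ∀ l, f l ≤ g l) (l : List α) :
    valueStep κ good f l ≤ valueStep κ good g l := by
  refine lintegral_mono fun r => ?_
  split_ifs
  · exact le_rfl
  · exact h _

theorem valueIter_le_succ (m : ℕ) (l : List α) :
    valueIter κ good m l ≤ valueIter κ good (m + 1) l := by
  induction m generalizing l with
  | zero => exact zero_le
  | succ m ih => exact valueStep_mono ih l

theorem monotone_valueIter (l : List α) : Monotone fun m => valueIter κ good m l :=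
  monotone_nat_of_le_succ fun m => valueIter_le_succ m l

/-- The probability that, after the history `h`, some step is good. -/
noncomputable def value (κ : Kernel (List α) α) (good : List α → α → Prop) (h : List α) : ℝ≥0∞ :=
  ⨆ m, valueIter κ good m h

theorem valueStep_value [IsSFiniteKernel κ]
    (hg : MeasurableSet {p : List α × α | good p.1 p.2}) (l : List α) :
    valueStep κ good (value κ good) l = value κ good l := by
  classical
  have h : ∀ r, (if good l r then 1 else value κ good (l ++ [r]))
      = ⨆ m, (if good l r then 1 else valueIter κ good m (l ++ [r])) := by
    intro r
    split_ifs
    · simp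
    · rfl
  calc valueStep κ good (value κ good) l
      = ∫⁻ r, ⨆ m, (if good l r then 1 else valueIter κ good m (l ++ [r])) ∂(κ l) := by
        unfold valueStep
        refine lintegral_congr fun r => ?_
        rw [← h r]
    _ = ⨆ m, ∫⁻ r, (if good l r then 1 else valueIter κ good m (l ++ [r])) ∂(κ l) := by
        refine lintegral_iSup (fun m => ?_) fun m k hmk r => ?_
        · exact (measurable_goodIntegrand hg (measurable_valueIter hg m)).comp
            measurable_prodMk_left
        · dsimp only
          split_ifs
          · exact le_rfl
          · exact monotone_valueIter _ hmk
    _ = ⨆ m, valueIter κ good (m + 1) l := by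
        refine iSup_congr fun m => ?_
        rw [valueIter, valueStep]
    _ = value κ good l := (monotone_valueIter l).iSup_nat_add 1

/-- The law of the first `n + 1` records extends the law of the first `n` records by one step. -/
theorem lintegral_sequenceLaw_succ [IsMarkovKernel κ] (n : ℕ) {F : List α × α → ℝ≥0∞}
    (hF : Measurable F) :
    ∫⁻ ρ, F (firstRecords ρ n, ρ n) ∂(sequenceLaw κ)
      = ∫⁻ ρ, (∫⁻ r, F (firstRecords ρ n, r) ∂(κ (firstRecords ρ n))) ∂(sequenceLaw κ) := by
  cases n with
  | zero =>
    have h0 : (sequenceLaw κ).map (fun ρ => ρ 0) = κ [] := by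
      unfold sequenceLaw Kernel.trajMeasure
      have h1 : (fun ρ : ℕ → α => ρ 0) = (fun x : (i : Finset.Iic 0) → α =>
          x ⟨0, Finset.mem_Iic.2 le_rfl⟩) ∘ (Preorder.frestrictLe (π := fun _ : ℕ => α) 0) := rfl
      rw [h1, ← Measure.map_map (by fun_prop) (by fun_prop),
        Measure.map_comp _ _ (by fun_prop), Kernel.traj_map_frestrictLe, Kernel.partialTraj_self,
        Measure.id_comp, Measure.map_map (by fun_prop) (by fun_prop)]
      convert Measure.map_id
      rfl
    have h2 : ∀ ρ : ℕ → α, firstRecords ρ 0 = [] := fun ρ => by simp [firstRecords]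
    simp_rw [h2]
    rw [lintegral_const, measure_univ, mul_one, ← h0,
      lintegral_map (f := fun r => F ([], r)) (hF.comp measurable_prodMk_left)
        (measurable_pi_apply 0)]
  | succ n =>
    have key := Kernel.map_frestrictLe_trajMeasure_compProd_eq_map_trajMeasure
      (X := fun _ : ℕ => α) (μ₀ := κ [])
      (κ := fun n => κ.comap (prefixHistory n) (measurable_prefixHistory n)) (a := n)
    have hG : Measurable fun p : ((i : Finset.Iic n) → α) × α => F (prefixHistory n p.1, p.2) :=
      hF.comp (((measurable_prefixHistory n).comp measurable_fst).prodMk measurable_snd)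
    have h1 : ∀ ρ : ℕ → α, prefixHistory n (Preorder.frestrictLe (π := fun _ : ℕ => α) n ρ)
        = firstRecords ρ (n + 1) := fun ρ => rfl
    have h2 := congrArg (fun μ => ∫⁻ p, F (prefixHistory n p.1, p.2) ∂μ) key
    rw [Measure.lintegral_compProd hG, lintegral_map hG (by fun_prop),
      lintegral_map (hG.lintegral_kernel_prod_right') (by fun_prop)] at h2
    exact h2.symm

/-- The probability of a good step is the limit of the finite-horizon recursion. -/
theorem sequenceLaw_exists_good [IsMarkovKernel κ]
    (hg : MeasurableSet {p : List α × α | good p.1 p.2}) :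
    sequenceLaw κ {ρ | ∃ k, good (firstRecords ρ k) (ρ k)} = value κ good [] := by
  classical
  have hmeas : ∀ k, MeasurableSet {ρ : ℕ → α | good (firstRecords ρ k) (ρ k)} := fun k =>
    ((measurable_firstRecords k).prodMk (measurable_pi_apply k)) hg
  -- Mixed payoff: a good step among the first `j` steps, else the value with the remaining horizon.
  have key : ∀ N j, j ≤ N → valueIter κ good N [] = ∫⁻ ρ, (if ∃ k < j, good (firstRecords ρ k) (ρ k)
      then 1 else valueIter κ good (N - j) (firstRecords ρ j)) ∂(sequenceLaw κ) := by
    intro N j hj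
    induction j with
    | zero => simp [firstRecords]
    | succ j ih =>
      rw [ih (Nat.le_of_succ_le hj)]
      obtain ⟨m, hm⟩ : ∃ m, N - j = m + 1 := ⟨N - j - 1, by omega⟩
      have hm' : N - (j + 1) = m := by omega
      rw [hm, hm']
      set A : Set (ℕ → α) := {ρ | ∃ k < j, good (firstRecords ρ k) (ρ k)} with hA
      have hAm : MeasurableSet A := by
        have : A = ⋃ k, ⋃ (_ : k < j), {ρ : ℕ → α | good (firstRecords ρ k) (ρ k)} := by
          ext ρ; simp [hA]
        rw [this]
        exact MeasurableSet.iUnion fun k => MeasurableSet.iUnion fun _ => hmeas k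
      let B : List α → Prop := fun h => ∃ k, ∃ hk : k < h.length, k < j ∧ good (h.take k) h[k]
      have htake : ∀ (ρ : ℕ → α) k, k < j → (firstRecords ρ j).take k = firstRecords ρ k := by
        intro ρ k hk
        apply List.ext_getElem
        · simp [firstRecords, hk.le]
        · intro i h1 h2; simp [firstRecords]
      have hAB : ∀ ρ, ρ ∈ A ↔ B (firstRecords ρ j) := by
        intro ρ
        constructor
        · rintro ⟨k, hk, h⟩
          refine ⟨k, by simpa [firstRecords] using hk, hk, ?_⟩
          rw [htake ρ k hk]; simpa [firstRecords] using h
        · rintro ⟨k, hk', hk, h⟩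
          refine ⟨k, hk, ?_⟩
          rw [htake ρ k hk] at h; simpa [firstRecords] using h
      have hBm : MeasurableSet {h : List α | B h} := by
        refine measurableSet_list.2 fun n => ?_
        have : (List.ofFn : (Fin n → α) → List α) ⁻¹' {h | B h} = ⋃ k : Fin n, ⋃ (_ : (k : ℕ) < j),
            {x | good ((List.ofFn fun i : Fin k => x ⟨i, i.2.trans k.2⟩)) (x k)} := by
          ext x
          have ht : ∀ k (hk : k < n), (List.ofFn x).take k
              = List.ofFn fun i : Fin k => x ⟨i, i.2.trans hk⟩ := by
            intro k hk
            apply List.ext_getElem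
            · simp [hk.le]
            · intro i h1 h2; simp
          simp only [Set.mem_preimage, Set.mem_ofPred_eq, Set.mem_iUnion, exists_prop, B]
          constructor
          · rintro ⟨k, hk, hkj, h⟩
            have hk' : k < n := by simpa using hk
            refine ⟨⟨k, hk'⟩, hkj, ?_⟩
            rw [ht k hk'] at h; simpa using h
          · rintro ⟨k, hkj, h⟩
            refine ⟨k, by simp, hkj, ?_⟩
            rw [ht k k.2]; simpa using h
        rw [this]
        refine MeasurableSet.iUnion fun k => MeasurableSet.iUnion fun _ => ?_
        have hc : Measurable fun x : Fin n → α =>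
            ((List.ofFn fun i : Fin k => x ⟨i, i.2.trans k.2⟩), x k) :=
          ((measurable_ofFn (k : ℕ)).comp (measurable_pi_iff.2 fun i : Fin k =>
            measurable_pi_apply (⟨i, i.2.trans k.2⟩ : Fin n))).prodMk (measurable_pi_apply k)
        exact hc hg
      have hF : Measurable fun p : List α × α => if B p.1 then 1 else
          if good p.1 p.2 then 1 else valueIter κ good m (p.1 ++ [p.2]) :=
        Measurable.ite (measurable_fst hBm) measurable_const
          (measurable_goodIntegrand hg (measurable_valueIter hg m))
      have hstep := lintegral_sequenceLaw_succ (κ := κ) j hF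
      have hL : ∀ ρ : ℕ → α, (if ∃ k < j, good (firstRecords ρ k) (ρ k) then 1
          else valueIter κ good (m + 1) (firstRecords ρ j))
          = ∫⁻ r, (if B (firstRecords ρ j) then 1 else if good (firstRecords ρ j) r then 1
            else valueIter κ good m (firstRecords ρ j ++ [r])) ∂(κ (firstRecords ρ j)) := by
        intro ρ
        have := hAB ρ
        by_cases h : ∃ k < j, good (firstRecords ρ k) (ρ k)
        · rw [if_pos h]; simp [this.1 h]
        · rw [if_neg h]; simp only [mt this.2 h, if_false]; rfl
      have hR : ∀ ρ : ℕ → α, (if ∃ k < j + 1, good (firstRecords ρ k) (ρ k) then 1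
          else valueIter κ good m (firstRecords ρ (j + 1)))
          = if B (firstRecords ρ j) then 1 else if good (firstRecords ρ j) (ρ j) then 1
            else valueIter κ good m (firstRecords ρ j ++ [ρ j]) := by
        intro ρ
        have := hAB ρ
        have h1 : (∃ k < j + 1, good (firstRecords ρ k) (ρ k)) ↔
            ρ ∈ A ∨ good (firstRecords ρ j) (ρ j) := by
          constructor
          · rintro ⟨k, hk, h⟩
            rcases Nat.lt_succ_iff_lt_or_eq.1 hk with hk | rfl
            · exact Or.inl ⟨k, hk, h⟩
            · exact Or.inr h
          · rintro (⟨k, hk, h⟩ | h)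
            · exact ⟨k, by omega, h⟩
            · exact ⟨j, by omega, h⟩
        rw [firstRecords_succ]
        simp only [h1, this]
        by_cases h2 : B (firstRecords ρ j) <;> simp [h2]
      simp_rw [hL, hR]
      exact hstep.symm
  have hU : {ρ : ℕ → α | ∃ k, good (firstRecords ρ k) (ρ k)}
      = ⋃ N : ℕ, {ρ | ∃ k < N, good (firstRecords ρ k) (ρ k)} := by
    ext ρ
    simp only [Set.mem_ofPred_eq, Set.mem_iUnion]
    exact ⟨fun ⟨k, h⟩ => ⟨k + 1, k, by omega, h⟩, fun ⟨_, k, _, h⟩ => ⟨k, h⟩⟩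
  have hmono : Monotone fun N : ℕ => {ρ : ℕ → α | ∃ k < N, good (firstRecords ρ k) (ρ k)} :=
    fun N N' hN ρ ⟨k, hk, h⟩ => ⟨k, hk.trans_le hN, h⟩
  rw [hU, hmono.measure_iUnion, value]
  refine iSup_congr fun N => ?_
  rw [key N N le_rfl]
  have hm : MeasurableSet {ρ : ℕ → α | ∃ k < N, good (firstRecords ρ k) (ρ k)} := by
    have : {ρ : ℕ → α | ∃ k < N, good (firstRecords ρ k) (ρ k)}
        = ⋃ k, ⋃ (_ : k < N), {ρ : ℕ → α | good (firstRecords ρ k) (ρ k)} := by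
      ext ρ; simp
    rw [this]
    exact MeasurableSet.iUnion fun k => MeasurableSet.iUnion fun _ => hmeas k
  simp only [Nat.sub_self, valueIter]
  rw [← lintegral_indicator_one hm]
  refine lintegral_congr fun ρ => ?_
  simp [Set.indicator_apply]

end Reach

namespace DecPOMDP

/-! ### Reach probabilities of a DEC-POMDP -/

variable {n : ℕ} (M : DecPOMDP n)

/-- The transition probabilities as extended non-negative reals. -/
noncomputable def transProb (s : Fin M.numS) (a : M.GAct) (s' : Fin M.numS) : ℝ≥0∞ :=
  ((M.P s a s' : NNReal) : ℝ≥0∞)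

/-- The observation probabilities as extended non-negative reals. -/
noncomputable def obsProb (s : Fin M.numS) (a : M.GAct) (s' : Fin M.numS) (o : M.GObs) : ℝ≥0∞ :=
  ((M.O s a s' o : NNReal) : ℝ≥0∞)

variable {M}

/-- The profile that is played after the global observation `o` has been received. -/
def Profile.after (σ : M.Profile) (o : M.GObs) : M.Profile := fun i l => σ i (o i :: l)

/-- The expectation of `f` over the next state and the next observation. -/
noncomputable def envAverage (s : Fin M.numS) (a : M.GAct) (f : Fin M.numS → M.GObs → ℝ≥0∞) :
    ℝ≥0∞ :=
  ∑ s', M.transProb s a s' * ∑ o, M.obsProb s a s' o * f s' o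

theorem envAverage_add (s : Fin M.numS) (a : M.GAct) (f g : Fin M.numS → M.GObs → ℝ≥0∞) :
    envAverage s a (fun s' o => f s' o + g s' o) = envAverage s a f + envAverage s a g := by
  simp only [envAverage, mul_add, Finset.sum_add_distrib]

theorem envAverage_mul (s : Fin M.numS) (a : M.GAct) (c : ℝ≥0∞)
    (f : Fin M.numS → M.GObs → ℝ≥0∞) :
    envAverage s a (fun s' o => c * f s' o) = c * envAverage s a f := by
  simp only [envAverage, Finset.mul_sum]
  refine Finset.sum_congr rfl fun s' _ => Finset.sum_congr rfl fun o _ => ?_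
  ring

theorem envAverage_mono (s : Fin M.numS) (a : M.GAct) {f g : Fin M.numS → M.GObs → ℝ≥0∞}
    (h : ∀ s' o, f s' o ≤ g s' o) : envAverage s a f ≤ envAverage s a g := by
  unfold envAverage
  gcongr with s' _ o _
  exact h s' o

/-- The probability to visit `T` within the first `k` states of a play from `s`. -/
noncomputable def horizonValue (T : Finset (Fin M.numS)) :
    ℕ → Fin M.numS → M.Profile → ℝ≥0∞
  | 0 => fun _ _ => 0
  | k + 1 => fun s σ => if s ∈ T then 1 else
      ∑ a : M.GAct, (∏ i, σ i [] (a i)) *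
        envAverage s a fun s' o => horizonValue T k s' (σ.after o)

theorem horizonValue_succ (T : Finset (Fin M.numS)) (k : ℕ) (s : Fin M.numS) (σ : M.Profile) :
    horizonValue T (k + 1) s σ = if s ∈ T then 1 else
      ∑ a : M.GAct, (∏ i, σ i [] (a i)) *
        envAverage s a fun s' o => horizonValue T k s' (σ.after o) := rfl

theorem valueIter_stepKernel (T : Finset (Fin M.numS)) (σ : M.Profile) (m : ℕ)
    (h : List M.Rec) :
    valueIter (M.stepKernel σ) (fun h _ => M.lastState h ∈ T) m h
      = horizonValue T m (M.lastState h) fun i l => σ i ((h.map fun r => r.2.1 i) ++ l) := by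
  classical
  induction m generalizing h with
  | zero => rfl
  | succ m ih =>
    rw [valueIter, valueStep, horizonValue_succ]
    by_cases hT : M.lastState h ∈ T
    · simp [hT]
    simp only [hT, if_false]
    simp_rw [ih]
    change ∫⁻ r, _ ∂(M.stepPMF σ h).toMeasure = _
    rw [lintegral_fintype, Fintype.sum_prod_type]
    refine Finset.sum_congr rfl fun a _ => ?_
    rw [Fintype.sum_prod_type_right, envAverage, Finset.mul_sum]
    refine Finset.sum_congr rfl fun s' _ => ?_
    rw [Finset.mul_sum, Finset.mul_sum]
    refine Finset.sum_congr rfl fun o _ => ?_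
    rw [PMF.toMeasure_apply_singleton _ _ (measurableSet_singleton _)]
    have h1 : M.lastState (h ++ [(a, o, s')]) = s' := by simp [lastState]
    rw [h1]
    have h2 : (fun i l => σ i (((h ++ [(a, o, s')]).map fun r : M.Rec => r.2.1 i) ++ l))
        = Profile.after (fun i l => σ i ((h.map fun r => r.2.1 i) ++ l)) o := by
      funext i l
      simp [Profile.after]
    rw [h2]
    simp only [stepPMF, PMF.ofFintype_apply, List.append_nil, transProb, obsProb]
    ring

theorem measurableSet_of_list_rec (p : List M.Rec × M.Rec → Prop) : MeasurableSet {x | p x} := by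
  have : Measurable fun x : List M.Rec × M.Rec => p x :=
    measurable_of_ofFn_prod fun n => .of_discrete
  exact measurableSet_setOfPred.2 this

theorem playLaw_reach (T : Finset (Fin M.numS)) (σ : M.Profile) :
    M.playLaw σ (M.reach T) = ⨆ k, horizonValue T k M.init σ := by
  have h1 : M.reach T = {ρ | ∃ k, M.lastState (firstRecords ρ k) ∈ T} := by
    ext ρ
    simp only [reach, Set.mem_ofPred_eq]
    refine exists_congr fun k => ?_
    cases k with
    | zero => simp [stateAt, firstRecords, lastState]
    | succ k => rw [firstRecords_succ]; simp [stateAt, lastState]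
  rw [h1, playLaw, sequenceLaw_exists_good (good := fun h _ => M.lastState h ∈ T)
    (measurableSet_of_list_rec _), value]
  refine iSup_congr fun m => ?_
  rw [valueIter_stepKernel]
  simp [lastState]

theorem horizonValue_le_succ (T : Finset (Fin M.numS)) (k : ℕ) (s : Fin M.numS)
    (σ : M.Profile) : horizonValue T k s σ ≤ horizonValue T (k + 1) s σ := by
  induction k generalizing s σ with
  | zero => exact zero_le
  | succ k ih =>
    rw [horizonValue_succ, horizonValue_succ]
    split_ifs
    · exact le_rfl
    · gcongr with a _
      exact envAverage_mono _ _ fun s' o => ih _ _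

theorem monotone_horizonValue (T : Finset (Fin M.numS)) (s : Fin M.numS) (σ : M.Profile) :
    Monotone fun k => horizonValue T k s σ :=
  monotone_nat_of_le_succ fun k => horizonValue_le_succ T k s σ

/-- The value with horizon `k` depends only on the decisions after fewer than `k` observations. -/
theorem horizonValue_congr (T : Finset (Fin M.numS)) (k : ℕ) (s : Fin M.numS) {σ τ : M.Profile}
    (h : ∀ i l, l.length < k → σ i l = τ i l) : horizonValue T k s σ = horizonValue T k s τ := by
  induction k generalizing s σ τ with
  | zero => rfl
  | succ k ih =>
    rw [horizonValue_succ, horizonValue_succ]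
    split_ifs
    · rfl
    refine Finset.sum_congr rfl fun a _ => ?_
    congr 1
    · exact Finset.prod_congr rfl fun i _ => by rw [h i [] (by simp)]
    · congr 1
      funext s' o
      exact ih s' fun i l hl => h i _ (by simpa using hl)

/-! ### The attained reach probabilities form an interval -/

/-- `σ` arises from `σ₀` and `σ₁`, which agree except possibly in the decision of player `i` after
the observations `l`, by randomizing this decision with weights `c` and `d`. -/
structure Mixes (c d : ℝ≥0∞) (i : Fin n) (l : List (Fin (M.numObs i)))
    (σ₀ σ₁ σ : M.Profile) : Prop where
  left : ∀ j l', (⟨j, l'⟩ : Σ j, List (Fin (M.numObs j))) ≠ ⟨i, l⟩ → σ j l' = σ₀ j l'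
  right : ∀ j l', (⟨j, l'⟩ : Σ j, List (Fin (M.numObs j))) ≠ ⟨i, l⟩ → σ j l' = σ₁ j l'
  mix : ∀ a, σ i l a = c * σ₀ i l a + d * σ₁ i l a

/-- A play visits a decision point at most once, so the value is affine in a single decision. -/
theorem Mixes.horizonValue_eq {c d : ℝ≥0∞} (hcd : c + d = 1) (T : Finset (Fin M.numS)) (k : ℕ)
    (s : Fin M.numS) {i : Fin n} {l : List (Fin (M.numObs i))} {σ₀ σ₁ σ : M.Profile}
    (h : Mixes c d i l σ₀ σ₁ σ) :
    horizonValue T k s σ = c * horizonValue T k s σ₀ + d * horizonValue T k s σ₁ := by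
  classical
  induction k generalizing s l σ₀ σ₁ σ with
  | zero => simp [horizonValue]
  | succ k ih =>
    simp only [horizonValue_succ]
    split_ifs
    · simp [hcd]
    rw [Finset.mul_sum, Finset.mul_sum, ← Finset.sum_add_distrib]
    refine Finset.sum_congr rfl fun a _ => ?_
    cases l with
    | nil =>
      have e0 : ∀ o, σ.after o = σ₀.after o := fun o => by
        funext j l'; exact h.left _ _ (by rintro ⟨⟩)
      have e1 : ∀ o, σ.after o = σ₁.after o := fun o => by
        funext j l'; exact h.right _ _ (by rintro ⟨⟩)
      have e2 : ∀ j ∈ Finset.univ.erase i, σ j [] (a j) = σ₀ j [] (a j) := fun j hj => by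
        rw [h.left j [] (by rintro ⟨⟩; simp at hj)]
      have e3 : ∀ j ∈ Finset.univ.erase i, σ j [] (a j) = σ₁ j [] (a j) := fun j hj => by
        rw [h.right j [] (by rintro ⟨⟩; simp at hj)]
      simp_rw [← e0, ← e1]
      rw [← Finset.mul_prod_erase _ _ (Finset.mem_univ i),
        ← Finset.mul_prod_erase _ (fun j => σ₀ j [] (a j)) (Finset.mem_univ i),
        ← Finset.mul_prod_erase _ (fun j => σ₁ j [] (a j)) (Finset.mem_univ i),
        ← Finset.prod_congr rfl e2, ← Finset.prod_congr rfl e3, h.mix]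
      ring
    | cons x l =>
      have e0 : ∀ j, σ j [] = σ₀ j [] := fun j => h.left _ _ (by rintro ⟨⟩)
      have e1 : ∀ j, σ j [] = σ₁ j [] := fun j => h.right _ _ (by rintro ⟨⟩)
      simp_rw [← e0, ← e1]
      have e2 : (fun s' o => horizonValue T k s' (σ.after o)) = fun s' o =>
          c * horizonValue T k s' (σ₀.after o) + d * horizonValue T k s' (σ₁.after o) := by
        funext s' o
        by_cases ho : o i = x
        · subst ho
          refine ih s' (l := l) ⟨fun j l' hne => h.left _ _ ?_, fun j l' hne => h.right _ _ ?_,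
            fun b => h.mix b⟩
          all_goals
            rintro heq
            apply hne
            obtain rfl : j = i := congrArg Sigma.fst heq
            simpa using heq
        · have f0 : σ.after o = σ₀.after o := by
            funext j l'
            refine h.left _ _ fun heq => ho ?_
            obtain rfl : j = i := congrArg Sigma.fst heq
            simp only [Sigma.mk.injEq, heq_eq_eq, true_and, List.cons.injEq] at heq
            exact heq.1
          have f1 : σ.after o = σ₁.after o := by
            funext j l'
            refine h.right _ _ fun heq => ho ?_
            obtain rfl : j = i := congrArg Sigma.fst heq
            simp only [Sigma.mk.injEq, heq_eq_eq, true_and, List.cons.injEq] at heq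
            exact heq.1
          rw [← f0, ← f1, ← add_mul, hcd, one_mul]
      rw [e2, envAverage_add, envAverage_mul, envAverage_mul]
      ring

/-- The limit value, too, is affine in a single decision. -/
theorem Mixes.iSup_horizonValue_eq {c d : ℝ≥0∞} (hcd : c + d = 1) (T : Finset (Fin M.numS))
    (s : Fin M.numS) {i : Fin n} {l : List (Fin (M.numObs i))} {σ₀ σ₁ σ : M.Profile}
    (h : Mixes c d i l σ₀ σ₁ σ) :
    ⨆ k, horizonValue T k s σ
      = c * (⨆ k, horizonValue T k s σ₀) + d * ⨆ k, horizonValue T k s σ₁ := by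
  simp_rw [h.horizonValue_eq hcd]
  rw [ENNReal.mul_iSup, ENNReal.mul_iSup, ENNReal.iSup_add_iSup_of_monotone]
  · exact fun k m hkm => mul_le_mul_right (monotone_horizonValue _ _ _ hkm) _
  · exact fun k m hkm => mul_le_mul_right (monotone_horizonValue _ _ _ hkm) _

/-- Convex combinations of probability distributions on a finite type. -/
noncomputable def mixPMF {α : Type*} [Fintype α] {c d : ℝ≥0∞} (hcd : c + d = 1) (p q : PMF α) :
    PMF α :=
  PMF.ofFintype (fun a => c * p a + d * q a) (by
    rw [Finset.sum_add_distrib, ← Finset.mul_sum, ← Finset.mul_sum, ← tsum_fintype (L := .unconditional _),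
      ← tsum_fintype (L := .unconditional _), p.tsum_coe, q.tsum_coe, mul_one, mul_one, hcd])

/-- Profiles that differ in a single decision can be mixed in that decision. -/
theorem exists_mixes {c d : ℝ≥0∞} (hcd : c + d = 1) {i : Fin n} {l : List (Fin (M.numObs i))}
    {σ₀ σ₁ : M.Profile}
    (h : ∀ j l', (⟨j, l'⟩ : Σ j, List (Fin (M.numObs j))) ≠ ⟨i, l⟩ → σ₁ j l' = σ₀ j l') :
    ∃ σ, Mixes c d i l σ₀ σ₁ σ := by
  classical
  refine ⟨fun j l' => if (⟨j, l'⟩ : Σ j, List (Fin (M.numObs j))) = ⟨i, l⟩ then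
    mixPMF hcd (σ₀ j l') (σ₁ j l') else σ₀ j l', ⟨fun j l' hne => ?_, fun j l' hne => ?_, fun a => ?_⟩⟩
  · simp [hne]
  · simp [hne, h j l' hne]
  · simp [mixPMF]

/-- A number between `x` and `y` is a convex combination of `x` and `y`. -/
theorem exists_weights {x y p : ℝ≥0∞} (hx : x ≤ p) (hy : p ≤ y) (hy' : y ≠ ∞) :
    ∃ c d : ℝ≥0∞, c + d = 1 ∧ c * x + d * y = p := by
  have hxy := hx.trans hy
  lift y to NNReal using hy'
  lift p to NNReal using ne_top_of_le_ne_top ENNReal.coe_ne_top hy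
  lift x to NNReal using ne_top_of_le_ne_top ENNReal.coe_ne_top hx
  have hx1 : (x : ℝ) ≤ p := by exact_mod_cast hx
  have hy1 : (p : ℝ) ≤ y := by exact_mod_cast hy
  obtain ⟨a, b, ha, hb, hab, h⟩ : (p : ℝ) ∈ segment ℝ (x : ℝ) y := by
    rw [segment_eq_Icc (hx1.trans hy1)]; exact ⟨hx1, hy1⟩
  lift a to NNReal using ha
  lift b to NNReal using hb
  refine ⟨a, b, by exact_mod_cast hab, ?_⟩
  simp only [smul_eq_mul] at h
  exact_mod_cast h

/-- The intermediate value property of reach probabilities. The profile `σ` is turned into `σ'` by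
switching one decision after the other. The value exceeds `p` at some stage, because it is lower
semicontinuous, and it is affine in the decision that is switched at the first such stage. -/
theorem exists_iSup_horizonValue_eq (T : Finset (Fin M.numS)) (s : Fin M.numS) {σ σ' : M.Profile}
    {p : ℝ≥0∞} (hσ : ⨆ k, horizonValue T k s σ ≤ p) (hσ' : p ≤ ⨆ k, horizonValue T k s σ')
    (htop : ∀ τ : M.Profile, ⨆ k, horizonValue T k s τ ≠ ∞) :
    ∃ τ : M.Profile, ⨆ k, horizonValue T k s τ = p := by
  classical
  rcases hσ'.eq_or_lt with h | h
  · exact ⟨σ', h.symm⟩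
  let τ : ℕ → M.Profile := fun k i l =>
    if Encodable.encode (⟨i, l⟩ : Σ i, List (Fin (M.numObs i))) < k then σ' i l else σ i l
  -- A finite horizon sees only finitely many decisions, and these are all switched at some stage.
  have hex : ∃ k, p < ⨆ m, horizonValue T m s (τ k) := by
    obtain ⟨m, hm⟩ := lt_iSup_iff.1 h
    have hfin : {x : Σ i, List (Fin (M.numObs i)) | x.2.length < m}.Finite := by
      have : {x : Σ i, List (Fin (M.numObs i)) | x.2.length < m}
          = ⋃ i, (Sigma.mk i) '' {l | l.length < m} := by
        ext ⟨i, l⟩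
        simp only [Set.mem_ofPred_eq, Set.mem_iUnion, Set.mem_image]
        constructor
        · exact fun h => ⟨i, l, h, rfl⟩
        · rintro ⟨j, l', h, h'⟩
          obtain rfl : j = i := congrArg Sigma.fst h'
          simp only [Sigma.mk.injEq, heq_eq_eq, true_and] at h'
          rwa [← h']
      rw [this]
      exact Set.finite_iUnion fun i => (List.finite_length_lt _ _).image _
    obtain ⟨k, hk⟩ := (hfin.image Encodable.encode).bddAbove
    refine ⟨k + 1, lt_iSup_iff.2 ⟨m, ?_⟩⟩
    rw [horizonValue_congr T m s (σ := τ (k + 1)) (τ := σ')]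
    · exact hm
    · intro i l hl
      have := hk ⟨⟨i, l⟩, hl, rfl⟩
      simp only [τ]
      rw [if_pos (Nat.lt_succ_of_le this)]
  have hspec := Nat.find_spec hex
  obtain ⟨k, hk⟩ : ∃ k, Nat.find hex = k + 1 := by
    refine Nat.exists_eq_succ_of_ne_zero fun h0 => ?_
    rw [h0] at hspec
    have : τ 0 = σ := by funext i l; simp [τ]
    rw [this] at hspec
    exact absurd hspec (not_lt.2 hσ)
  have hmin : ⨆ m, horizonValue T m s (τ k) ≤ p := not_lt.1 (Nat.find_min hex (by omega))
  rw [hk] at hspec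
  by_cases hx : ∃ x : Σ i, List (Fin (M.numObs i)), Encodable.encode x = k
  · obtain ⟨⟨i, l⟩, hx⟩ := hx
    obtain ⟨c, d, hcd, hp⟩ := exists_weights hmin hspec.le (htop _)
    obtain ⟨υ, hυ⟩ := exists_mixes hcd (σ₀ := τ k) (σ₁ := τ (k + 1)) (i := i) (l := l) (by
      intro j l' hne
      have : Encodable.encode (⟨j, l'⟩ : Σ i, List (Fin (M.numObs i))) ≠ k := fun he =>
        hne (Encodable.encode_injective (he.trans hx.symm))
      simp only [τ]
      congr 1
      exact propext ⟨fun h => by omega, fun h => by omega⟩)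
    exact ⟨υ, by rw [hυ.iSup_horizonValue_eq hcd, hp]⟩
  · have : τ (k + 1) = τ k := by
      funext j l'
      have : Encodable.encode (⟨j, l'⟩ : Σ i, List (Fin (M.numObs i))) ≠ k := fun he => hx ⟨_, he⟩
      simp only [τ]
      congr 1
      exact propext ⟨fun h => by omega, fun h => by omega⟩
    rw [this] at hspec
    exact absurd hspec (not_lt.2 hmin)

end DecPOMDP

/-! ### Independent identically distributed sequences -/

section Stream

variable {X : Type*} [MeasurableSpace X]

/-- The sequence with first element `x` and tail `ω`. -/
def streamCons (x : X) (ω : ℕ → X) : ℕ → X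
  | 0 => x
  | k + 1 => ω k

/-- The sequence without its first element. -/
def streamTail (ω : ℕ → X) : ℕ → X := fun k => ω (k + 1)

theorem measurable_streamCons : Measurable fun p : X × (ℕ → X) => streamCons p.1 p.2 := by
  refine measurable_pi_iff.2 fun k => ?_
  cases k with
  | zero => exact measurable_fst
  | succ k => exact (measurable_pi_apply k).comp measurable_snd

theorem measurable_streamTail : Measurable (streamTail : (ℕ → X) → ℕ → X) :=
  measurable_pi_iff.2 fun k => measurable_pi_apply (k + 1)

variable (μ : Measure X) [IsProbabilityMeasure μ]

/-- A sequence of independent identically distributed elements is a first element followed by an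
independent such sequence. -/
theorem map_streamCons : (μ.prod (Measure.infinitePi fun _ : ℕ => μ)).map
    (fun p => streamCons p.1 p.2) = Measure.infinitePi fun _ : ℕ => μ := by
  classical
  refine Measure.eq_infinitePi _ fun s t ht => ?_
  have hset : (fun p : X × (ℕ → X) => streamCons p.1 p.2) ⁻¹' (Set.pi s t)
      = (if 0 ∈ s then t 0 else Set.univ) ×ˢ
        (Set.pi ((s.erase 0).image Nat.pred : Finset ℕ) fun k => t (k + 1)) := by
    ext ⟨x, ω⟩
    simp only [Set.mem_preimage, Set.mem_pi, Finset.mem_coe, Set.mem_prod, Finset.mem_image,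
      Finset.mem_erase]
    constructor
    · intro h
      refine ⟨?_, ?_⟩
      · split_ifs with h0
        · exact h 0 h0
        · trivial
      · rintro _ ⟨k, ⟨hk0, hk⟩, rfl⟩
        obtain ⟨k, rfl⟩ := Nat.exists_eq_succ_of_ne_zero hk0
        exact h (k + 1) hk
    · rintro ⟨h1, h2⟩ k hk
      cases k with
      | zero => rw [if_pos hk] at h1; exact h1
      | succ k => exact h2 k ⟨k + 1, ⟨Nat.succ_ne_zero k, hk⟩, rfl⟩
  rw [Measure.map_apply measurable_streamCons (MeasurableSet.pi s.countable_toSet fun k _ => ht k),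
    hset, Measure.prod_prod, Measure.infinitePi_pi _ (fun k _ => ht (k + 1)),
    Finset.prod_image]
  · have : ∏ k ∈ s.erase 0, μ (t (k.pred + 1)) = ∏ k ∈ s.erase 0, μ (t k) := by
      refine Finset.prod_congr rfl fun k hk => ?_
      obtain ⟨k, rfl⟩ := Nat.exists_eq_succ_of_ne_zero (Finset.ne_of_mem_erase hk)
      rfl
    rw [this]
    split_ifs with h0
    · exact Finset.mul_prod_erase s (fun k => μ (t k)) h0
    · rw [measure_univ, one_mul, Finset.erase_eq_of_notMem h0]
  · intro a ha b hb hab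
    have ha := Finset.ne_of_mem_erase ha
    have hb := Finset.ne_of_mem_erase hb
    cases a <;> cases b <;> simp_all

theorem lintegral_infinitePi_cons {F : (ℕ → X) → ℝ≥0∞} (hF : Measurable F) :
    ∫⁻ ω, F ω ∂(Measure.infinitePi fun _ : ℕ => μ)
      = ∫⁻ x, ∫⁻ ω, F (streamCons x ω) ∂(Measure.infinitePi fun _ : ℕ => μ) ∂μ := by
  conv_lhs => rw [← map_streamCons μ]
  rw [lintegral_map hF measurable_streamCons]
  exact lintegral_prod _ (hF.comp measurable_streamCons).aemeasurable

end Stream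

/-! ### Races of exponential delays -/

theorem expMeasure_Ioi {r : ℝ} (hr : 0 < r) {t : ℝ} (ht : 0 ≤ t) :
    expMeasure r (Set.Ioi t) = ENNReal.ofReal (Real.exp (-(r * t))) := by
  have := isProbabilityMeasure_expMeasure hr
  rw [← Set.compl_Iic, prob_compl_eq_one_sub measurableSet_Iic, ← ofReal_cdf,
    cdf_expMeasure_eq hr, if_pos ht, ← ENNReal.ofReal_one,
    ← ENNReal.ofReal_sub _ (by simp [mul_nonneg hr.le ht])]
  congr 1
  ring

/-- If the rates add up to one, then the minimum of independent exponential delays has the standard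
exponential distribution, independently of which delay is the minimum. -/
theorem map_restrict_pi_expMeasure {ι : Type*} [Fintype ι] {r : ι → ℝ} (hr : ∀ i, 0 < r i)
    (hsum : ∑ i, r i = 1) (e : ι) :
    ((Measure.pi fun i => expMeasure (r i)).restrict {x | ∀ e', e' ≠ e → x e < x e'}).map
      (fun x => x e) = ENNReal.ofReal (r e) • expMeasure 1 := by
  classical
  have hprob : ∀ i, IsProbabilityMeasure (expMeasure (r i)) :=
    fun i => isProbabilityMeasure_expMeasure (hr i)
  have hW : MeasurableSet {x : ι → ℝ | ∀ e', e' ≠ e → x e < x e'} := by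
    have : {x : ι → ℝ | ∀ e', e' ≠ e → x e < x e'}
        = ⋂ e', ⋂ (_ : e' ≠ e), {x : ι → ℝ | x e < x e'} := by ext; simp
    rw [this]
    exact MeasurableSet.iInter fun e' => MeasurableSet.iInter fun _ =>
      measurableSet_lt (measurable_pi_apply e) (measurable_pi_apply e')
  ext B hB
  rw [Measure.map_apply (measurable_pi_apply e) hB,
    Measure.restrict_apply (measurable_pi_apply e hB)]
  let q := MeasurableEquiv.piEquivPiSubtypeProd (fun _ : ι => ℝ) (fun i => i = e)
  have hq := measurePreserving_piEquivPiSubtypeProd (fun i => expMeasure (r i)) (fun i => i = e)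
  let S : Set (({i // i = e} → ℝ) × ({i // ¬ i = e} → ℝ)) :=
    {p | p.1 ⟨e, rfl⟩ ∈ B ∧ ∀ i, p.1 ⟨e, rfl⟩ < p.2 i}
  have hS : MeasurableSet S := by
    have : S = {p | p.1 ⟨e, rfl⟩ ∈ B} ∩ ⋂ i, {p | p.1 ⟨e, rfl⟩ < p.2 i} := by
      ext; simp [S]
    rw [this]
    refine MeasurableSet.inter ?_ (MeasurableSet.iInter fun i => ?_)
    · exact ((measurable_pi_apply _).comp measurable_fst) hB
    · exact measurableSet_lt ((measurable_pi_apply _).comp measurable_fst)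
        ((measurable_pi_apply _).comp measurable_snd)
  have hpre : (fun x : ι → ℝ => x e) ⁻¹' B ∩ {x | ∀ e', e' ≠ e → x e < x e'} = q ⁻¹' S := by
    ext x
    simp [S, q, MeasurableEquiv.piEquivPiSubtypeProd, Equiv.piEquivPiSubtypeProd]
  rw [hpre, hq.measure_preimage hS.nullMeasurableSet, Measure.prod_apply hS]
  have hfib : ∀ y : {i // i = e} → ℝ, (Measure.pi fun i : {i // ¬ i = e} => expMeasure (r i))
      (Prod.mk y ⁻¹' S) = B.indicator (fun t => ∏ i : {i // ¬ i = e},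
        expMeasure (r i) (Set.Ioi t)) (y ⟨e, rfl⟩) := by
    intro y
    by_cases hy : y ⟨e, rfl⟩ ∈ B
    · rw [Set.indicator_of_mem hy, ← Measure.pi_pi]
      congr 1
      ext z
      simp [S, hy, Set.mem_pi]
    · rw [Set.indicator_of_notMem hy]
      have : Prod.mk y ⁻¹' S = ∅ := by ext z; simp [S, hy]
      rw [this, measure_empty]
  simp_rw [hfib]
  have hu := measurePreserving_piUnique (X := fun _ : {i // i = e} => ℝ)
    (fun i : {i // i = e} => expMeasure (r i))
  have hint : ∀ f : ℝ → ℝ≥0∞, ∫⁻ y, f (y ⟨e, rfl⟩)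
      ∂(Measure.pi fun i : {i // i = e} => expMeasure (r i)) = ∫⁻ t, f t ∂(expMeasure (r e)) := by
    intro f
    exact hu.lintegral_comp_emb (MeasurableEquiv.measurableEmbedding _) f
  have hint' := hint (B.indicator fun t => ∏ i : {i // ¬ i = e}, expMeasure (r i) (Set.Ioi t))
  refine Eq.trans ?_ (hint'.trans ?_)
  · congr!
  rw [lintegral_indicator hB, Measure.smul_apply, smul_eq_mul, expMeasure, expMeasure,
    gammaMeasure, gammaMeasure, withDensity_apply _ hB]
  have hf : ∀ r : ℝ, gammaPDF 1 r = exponentialPDF r := fun r => rfl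
  simp_rw [hf]
  have hmd : ∀ r : ℝ, Measurable (exponentialPDF r) := fun r => by
    unfold exponentialPDF
    exact (measurable_exponentialPDFReal r).ennreal_ofReal
  have hg : Measurable fun t => ∏ i : {i // ¬ i = e}, expMeasure (r i) (Set.Ioi t) :=
    Finset.measurable_prod _ fun i _ => Antitone.measurable fun t u htu =>
      measure_mono (Set.Ioi_subset_Ioi htu)
  change ∫⁻ t in B, (fun t => ∏ i : {i // ¬ i = e}, expMeasure (r i) (Set.Ioi t)) t ∂_ = _
  rw [setLIntegral_withDensity_eq_setLIntegral_mul _ (hmd _) hg hB, ← lintegral_const_mul _ (hmd _)]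
  refine lintegral_congr fun t => ?_
  rw [Pi.mul_apply]
  rcases lt_or_ge t 0 with ht | ht
  · rw [exponentialPDF_of_neg ht, exponentialPDF_of_neg ht, zero_mul, mul_zero]
  · have hsum' : ∑ i : {i // ¬ i = e}, r i = 1 - r e := by
      have := Fintype.sum_eq_add_sum_subtype_ne r e
      rw [hsum] at this
      rw [this]
      simp
    simp_rw [fun i : {i // ¬ i = e} => expMeasure_Ioi (hr i) ht]
    rw [exponentialPDF_of_nonneg ht, exponentialPDF_of_nonneg ht,
      ← ENNReal.ofReal_prod_of_nonneg fun i _ => (Real.exp_pos _).le, ← Real.exp_sum,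
      ← ENNReal.ofReal_mul (mul_nonneg (hr e).le (Real.exp_pos _).le),
      ← ENNReal.ofReal_mul (hr e).le, mul_assoc, ← Real.exp_add, Finset.sum_neg_distrib,
      ← Finset.sum_mul, hsum']
    congr 3
    ring_nf

/-- Independent delays with the standard exponential distribution. -/
noncomputable def delayStream : Measure (ℕ → ℝ) := Measure.infinitePi fun _ => expMeasure 1

instance : IsProbabilityMeasure (expMeasure 1) := isProbabilityMeasure_expMeasure one_pos

instance : IsProbabilityMeasure delayStream := by unfold delayStream; infer_instance

theorem lintegral_delayStream_cons {F : (ℕ → ℝ) → ℝ≥0∞} (hF : Measurable F) :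
    ∫⁻ D, F D ∂delayStream = ∫⁻ d, ∫⁻ D, F (streamCons d D) ∂delayStream ∂(expMeasure 1) :=
  lintegral_infinitePi_cons _ hF

theorem ae_pos_expMeasure : ∀ᵐ d ∂(expMeasure 1), 0 < d := by
  have h := ofReal_cdf (μ := expMeasure 1) 0
  rw [cdf_expMeasure_eq one_pos] at h
  have h0 : expMeasure 1 (Set.Iic 0) = 0 := by rw [← h]; simp
  rw [ae_iff]
  convert h0 using 2
  ext d; simp

theorem ae_pos_delayStream : ∀ᵐ D ∂delayStream, ∀ k, 0 < D k := by
  rw [ae_all_iff]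
  intro k
  have := measurePreserving_eval_infinitePi (fun _ : ℕ => expMeasure 1) k
  exact this.quasiMeasurePreserving.ae ae_pos_expMeasure

namespace DistIMC

variable {n : ℕ} (G : DistIMC n)

/-- If the rates add up to one, then a race selects the next delay transition with its rate as
probability, and the waiting time is an independent standard exponential one. -/
theorem lintegral_raceLaw {s : GState n} (hsum : ∑ e ∈ G.edges s, (e.2.1 : ℝ) = 1)
    {F : Label n × GState n × ℝ → ℝ≥0∞} (hF : Measurable F) :
    ∫⁻ x, F x ∂(G.raceLaw s) = ∑ e ∈ G.edges s, ENNReal.ofReal (e.2.1 : ℝ) *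
      ∫⁻ d, F (.delay e.1, Function.update s e.1 e.2.2, d) ∂(expMeasure 1) := by
  classical
  have hne : (G.edges s).Nonempty := by
    rw [Finset.nonempty_iff_ne_empty]
    intro h
    rw [h] at hsum
    simp at hsum
  rw [raceLaw, if_pos hne, lintegral_finsetSum_measure, ← Finset.sum_coe_sort (G.edges s)
    fun e => ENNReal.ofReal (e.2.1 : ℝ) *
      ∫⁻ d, F (.delay e.1, Function.update s e.1 e.2.2, d) ∂(expMeasure 1)]
  refine Finset.sum_congr rfl fun e _ => ?_
  have hm : Measurable fun d : ℝ => F (.delay e.1.1, Function.update s e.1.1 e.1.2.2, d) :=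
    hF.comp (measurable_const.prodMk (measurable_const.prodMk measurable_id))
  have h := map_restrict_pi_expMeasure (r := fun e : G.edges s => (e.1.2.1 : ℝ))
    (fun e => G.edges_pos e)
    (by rw [← hsum, ← Finset.sum_coe_sort (G.edges s) fun e => (e.2.1 : ℝ)]) e
  rw [lintegral_map hF (by fun_prop)]
  have h2 := congrArg (fun μ => ∫⁻ d, F (.delay e.1.1, Function.update s e.1.1 e.1.2.2, d) ∂μ) h
  simp only [lintegral_smul_measure, smul_eq_mul] at h2
  rw [lintegral_map hm (measurable_pi_apply e)] at h2
  exact h2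

end DistIMC

/-! ### Lists as trees -/

namespace BTree

/-- The elements of a list encoded by a tree. -/
def toList : BTree → List BTree
  | nil => []
  | cons a b => a :: b.toList

@[simp] theorem ofList_nil : ofList [] = nil := rfl

@[simp] theorem ofList_cons (a : BTree) (l : List BTree) : ofList (a :: l) = cons a (ofList l) := rfl

@[simp] theorem ofList_toList (x : BTree) : ofList x.toList = x := by
  induction x with
  | nil => rfl
  | cons a b _ ih => rw [toList, ofList_cons, ih]

@[simp] theorem toList_ofList (l : List BTree) : (ofList l).toList = l := by
  induction l with
  | nil => rfl
  | cons a l ih => rw [ofList_cons, toList, ih]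

/-- The length of a list encoded by a tree. -/
def len : BTree → ℕ
  | nil => 0
  | cons _ b => b.len + 1

@[simp] theorem len_ofList (l : List BTree) : (ofList l).len = l.length := by
  induction l with
  | nil => rfl
  | cons a l ih => rw [ofList_cons, len, ih, List.length_cons]

/-- The suffixes of a list, the list itself first. -/
def suffixes : BTree → List BTree
  | nil => [nil]
  | cons a b => cons a b :: b.suffixes

theorem self_mem_suffixes (x : BTree) : x ∈ x.suffixes := by
  cases x <;> simp [suffixes]

theorem nil_mem_suffixes (x : BTree) : nil ∈ x.suffixes := by
  induction x with
  | nil => simp [suffixes]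
  | cons a b _ ih => simp [suffixes, ih]

theorem mem_suffixes_of_cons_mem {a b x : BTree} (h : cons a b ∈ x.suffixes) :
    b ∈ x.suffixes := by
  induction x with
  | nil => simp [suffixes] at h
  | cons c d _ ih =>
    simp only [suffixes, List.mem_cons] at h ⊢
    rcases h with h | h
    · cases h
      exact Or.inr (self_mem_suffixes _)
    · exact Or.inr (ih h)

/-- The reverse of a list, followed by the list `acc`. -/
def revAppend (acc : BTree) : BTree → BTree
  | nil => acc
  | cons x a => revAppend (cons x acc) a

/-- All ways to split a list `a`, together with the corresponding suffix of a list `b`: the reversed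
prefix of `a` (followed by `acc`), the non-empty suffix of `a`, the suffix of `b`. -/
def splits (acc : BTree) : BTree → BTree → List (BTree × BTree × BTree)
  | nil, _ => []
  | cons x a, b => (acc, cons x a, b) :: splits (cons x acc) a b.tl

/-- Equality test for lists of bits. -/
def sameBits : BTree → BTree → Bool
  | nil, nil => true
  | nil, cons _ _ => false
  | cons _ _, nil => false
  | cons a x, cons b y => (decide (a = nil) == decide (b = nil)) && sameBits x y

theorem sameBits_ofNat (i j : ℕ) : sameBits (ofNat i) (ofNat j) = true ↔ i = j := by
  have key : ∀ l l' : List Bool,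
      sameBits (ofList (l.map ofBool)) (ofList (l'.map ofBool)) = true ↔ l = l' := by
    intro l
    induction l with
    | nil => intro l'; cases l' <;> simp [sameBits]
    | cons b l ih =>
      intro l'
      cases l' with
      | nil => simp [sameBits]
      | cons b' l' => cases b <;> cases b' <;> simp [sameBits, ofBool, ih]
  unfold ofNat
  rw [key]
  constructor
  · intro h
    have := congrArg (fun l : List Bool => l.foldr (fun b m => Nat.bit b m) 0) h
    have hb : ∀ m : ℕ, m.bits.foldr (fun b m => Nat.bit b m) 0 = m := by
      intro m
      induction m using Nat.binaryRec' with
      | zero => simp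
      | bit b m h ih => rw [Nat.bits_append_bit _ _ h, List.foldr_cons, ih]
    simpa [hb] using this
  · rintro rfl; rfl

theorem ofNat_injective : Function.Injective ofNat := by
  intro i j h
  rw [← sameBits_ofNat, h, sameBits_ofNat]

theorem ofNat_eq_nil {i : ℕ} : ofNat i = nil ↔ i = 0 := by
  have : ofNat 0 = nil := by simp [ofNat]
  rw [← this, ofNat_injective.eq_iff]

/-- Tags that distinguish the kinds of states and actions. -/
def tag : ℕ → BTree
  | 0 => nil
  | k + 1 => cons nil (tag k)

/-! ### Names of states and actions -/

/-- Environment state: the simulated process has just entered the state `s`. -/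
def stCheck (s : BTree) : BTree := cons (tag 0) s

/-- Environment state: the players are asked for their actions in the state `s`. -/
def stReady (s : BTree) : BTree := cons (tag 1) s

/-- Environment state: the actions `acc` of the first players, in reverse order, are known; `todo`
lists for the other players the actions that are still possible. -/
def stPoll (s acc todo : BTree) : BTree := cons (tag 2) (cons s (cons acc todo))

/-- Environment state: the simulated process moves from `s` to `s'` under the global action `a`. -/
def stObs (s a s' : BTree) : BTree := cons (tag 3) (cons s (cons a s'))

/-- Environment state: the simulated process is in the state `s`, the global observation is `o`,
and the script `z` is still to be executed in order to inform the players. -/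
def stTell (s o z : BTree) : BTree := cons (tag 4) (cons (cons s o) z)

/-- The action of all modules. -/
def lGo : BTree := nil

/-- The action by which a player rejects the action it is offered. The player is identified by the
list `b` of the action sets of the later players. -/
def lNext (b : BTree) : BTree := cons (tag 0) b

/-- The action by which the environment informs a player. The player is identified by the
list `b` of the observation sets of the later players. -/
def lTick (b : BTree) : BTree := cons (tag 1) b

/-- The script that announces the observation `x` to a player, followed by the script `z`. There is
one tick `v` per possible observation, and a pause, written `nil`, after the tick for `x`. -/
def tellOne (v x : BTree) : BTree → BTree → BTree
  | nil, z => z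
  | cons k K, z => cons v (if sameBits k x then cons nil (tellOne v x K z) else tellOne v x K z)

/-- The script that announces the global observation `o` to the players. -/
def script : BTree → BTree → BTree
  | nil, _ => nil
  | cons x o, b => tellOne (lTick b.tl) x b.hd (script o b.tl)

end BTree

open BTree DistIMC

/-! ### The modules -/

/-- Action transitions of a player with action set `A` and observation set `O`. The state `nil` is
left by an action of the player, which is represented by a suffix of `A.tl`. In the state
`cons r q`, the player first rejects actions while moving down the list `r`, and then receives ticks
while moving down the list `q`. -/
def playerTrans (A O u v : BTree) : List (BTree × BTree × BTree) :=
  (A.tl.suffixes.map fun r => (nil, lGo, cons r O)) ++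
  (A.tl.suffixes.flatMap fun r => if r = nil then [] else [(cons r O, u, cons r.tl O)]) ++
  (O.suffixes.flatMap fun q => if q = nil then [] else [(cons nil q, v, cons nil q.tl)]) ++
  [(cons nil nil, lGo, nil)]

/-- The rejection of the first action in the list `rem`, if there is another action. -/
def pollTrans (s acc rem rest : BTree) : List (BTree × BTree × BTree) :=
  if rem.tl = nil then [] else
    [(stPoll s acc (cons rem rest), lNext rest, stPoll s acc (cons rem.tl rest))]

/-- If no rejection occurs, the action is accepted after a delay. -/
def pollDelays (s acc rem rest : BTree) : List (BTree × ℚ≥0 × BTree) :=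
  if rem = nil then [] else
    [(stPoll s acc (cons rem rest), 1, stPoll s (cons rem.hd acc) rest)]

/-- The execution of a tick of a script, or the end of the script. -/
def tellTrans (s o z : BTree) : List (BTree × BTree × BTree) :=
  if z = nil then [(stTell s o nil, lGo, stCheck s)] else
    if z.hd = nil then [] else [(stTell s o z, z.hd, stTell s o z.tl)]

/-- The execution of a pause of a script. -/
def tellDelays (s o z : BTree) : List (BTree × ℚ≥0 × BTree) :=
  if z = nil then [] else if z.hd = nil then [(stTell s o z, 1, stTell s o z.tl)] else []

/-- The source and the target of a list of transitions. -/
def endpoints {α : Type*} (l : List (BTree × α × BTree)) : List BTree :=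
  l.flatMap fun e => [e.1, e.2.2]

/-- A module given by lists of transitions; its states are those that occur in the transitions. -/
def listIMC (s₀ : BTree) (acts : List BTree) (R : List (BTree × BTree × BTree))
    (D : List (BTree × ℚ≥0 × BTree)) (hR : ∀ e ∈ R, e.2.1 ∈ acts) (hD : ∀ e ∈ D, 0 < e.2.1) :
    IMC where
  states := (s₀ :: (endpoints R ++ endpoints D)).toFinset
  init := s₀
  init_mem := by simp
  acts := acts.toFinset
  trans := R.toFinset
  trans_mem e he := by
    have he := List.mem_toFinset.1 he
    simp only [List.toFinset_cons, Finset.mem_insert, List.mem_toFinset, List.mem_append, endpoints,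
      List.mem_flatMap]
    exact ⟨Or.inr (Or.inl ⟨e, he, by simp⟩), hR e he, Or.inr (Or.inl ⟨e, he, by simp⟩)⟩
  delays := D.toFinset
  delays_mem e he := by
    have he := List.mem_toFinset.1 he
    simp only [List.toFinset_cons, Finset.mem_insert, List.mem_toFinset, List.mem_append, endpoints,
      List.mem_flatMap]
    exact ⟨Or.inr (Or.inr ⟨e, he, by simp⟩), hD e he, Or.inr (Or.inr ⟨e, he, by simp⟩)⟩

/-- The tree of a module given by lists. -/
def listIMCTree (s₀ : BTree) (acts : List BTree) (R : List (BTree × BTree × BTree))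
    (D : List (BTree × ℚ≥0 × BTree)) : BTree :=
  .ofList [.ofList (s₀ :: (endpoints R ++ endpoints D)), s₀, .ofList acts,
    .ofList (R.map DistIMC.encTrans), .ofList (D.map DistIMC.encDelay)]

theorem encodesModule_listIMC {s₀ : BTree} {acts : List BTree}
    {R : List (BTree × BTree × BTree)} {D : List (BTree × ℚ≥0 × BTree)}
    {hR : ∀ e ∈ R, e.2.1 ∈ acts} {hD : ∀ e ∈ D, 0 < e.2.1} :
    DistIMC.EncodesModule (listIMCTree s₀ acts R D) (listIMC s₀ acts R D hR hD) :=
  ⟨_, acts, R, D, rfl, rfl, rfl, rfl, rfl⟩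

theorem mem_playerTrans {A O u v : BTree} {e : BTree × BTree × BTree} :
    e ∈ playerTrans A O u v ↔ (∃ r ∈ A.tl.suffixes, e = (nil, lGo, cons r O)) ∨
      (∃ x r, cons x r ∈ A.tl.suffixes ∧ e = (cons (cons x r) O, u, cons r O)) ∨
      (∃ y q, cons y q ∈ O.suffixes ∧ e = (cons nil (cons y q), v, cons nil q)) ∨
      e = (cons nil nil, lGo, nil) := by
  simp only [playerTrans, List.mem_append, List.mem_map, List.mem_flatMap, List.mem_singleton,
    or_assoc]
  refine or_congr ?_ (or_congr ?_ (or_congr ?_ Iff.rfl))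
  · exact exists_congr fun r => and_congr_right fun _ => eq_comm
  · constructor
    · rintro ⟨r, hr, h⟩
      cases r with
      | nil => simp at h
      | cons x r => exact ⟨x, r, hr, by simpa [tl] using h⟩
    · rintro ⟨x, r, hr, rfl⟩
      exact ⟨_, hr, by simp [tl]⟩
  · constructor
    · rintro ⟨r, hr, h⟩
      cases r with
      | nil => simp at h
      | cons x r => exact ⟨x, r, hr, by simpa [tl] using h⟩
    · rintro ⟨x, r, hr, rfl⟩
      exact ⟨_, hr, by simp [tl]⟩

namespace DecPOMDP

variable {n : ℕ} (M : DecPOMDP n)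

/-! ### Tuples as lists -/

/-- The entries of a tuple of trees from the index `k` on. -/
def dropT (x : Fin n → BTree) (k : ℕ) : BTree := .ofList (((List.finRange n).drop k).map x)

/-- The first `k` entries of a tuple of trees in reverse order. -/
def revT (x : Fin n → BTree) : ℕ → BTree
  | 0 => nil
  | k + 1 => if h : k < n then cons (x ⟨k, h⟩) (revT x k) else revT x k

theorem dropT_of_lt (x : Fin n → BTree) {k : ℕ} (h : k < n) :
    dropT x k = cons (x ⟨k, h⟩) (dropT x (k + 1)) := by
  unfold dropT
  rw [List.drop_eq_getElem_cons (by simpa using h)]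
  simp

theorem dropT_of_le (x : Fin n → BTree) {k : ℕ} (h : n ≤ k) : dropT x k = nil := by
  unfold dropT
  rw [List.drop_eq_nil_of_le (by simpa using h)]
  rfl

theorem len_dropT (x : Fin n → BTree) (k : ℕ) : (dropT x k).len = n - k := by
  simp [dropT]

theorem revT_succ (x : Fin n → BTree) {k : ℕ} (h : k < n) :
    revT x (k + 1) = cons (x ⟨k, h⟩) (revT x k) := by rw [revT, dif_pos h]

theorem revAppend_dropT (x : Fin n → BTree) : revAppend nil (dropT x 0) = revT x n := by
  have key : ∀ m k, m + k = n → revAppend (revT x k) (dropT x k) = revT x n := by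
    intro m
    induction m with
    | zero => intro k hk; rw [dropT_of_le x (by omega)]; simp only [revAppend]; congr 1; omega
    | succ m ih =>
      intro k hk
      rw [dropT_of_lt x (by omega : k < n), revAppend, ← revT_succ x (by omega : k < n)]
      exact ih (k + 1) (by omega)
  exact key n 0 rfl

/-- The splits of a tuple, with the corresponding suffixes of a second tuple. -/
theorem splits_dropT (x y : Fin n → BTree) : splits nil (dropT x 0) (dropT y 0)
    = (List.finRange n).map fun i : Fin n => (revT x i, dropT x i, dropT y i) := by
  have key : ∀ m k, m + k = n → splits (revT x k) (dropT x k) (dropT y k)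
      = ((List.finRange n).drop k).map fun i : Fin n => (revT x i, dropT x i, dropT y i) := by
    intro m
    induction m with
    | zero =>
      intro k hk
      rw [dropT_of_le x (by omega), List.drop_eq_nil_of_le (by simp; omega)]
      rfl
    | succ m ih =>
      intro k hk
      have hk' : k < n := by omega
      have h1 := ih (k + 1) (by omega)
      rw [revT_succ x hk'] at h1
      rw [dropT_of_lt x hk', splits, List.drop_eq_getElem_cons (by simpa using hk'), List.map_cons,
        ← h1, dropT_of_lt y hk']
      simp [tl, dropT_of_lt x hk', dropT_of_lt y hk']
  exact key n 0 rfl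

theorem dropT_injective : Function.Injective fun x : Fin n → BTree => dropT x 0 := by
  intro x y h
  have h := congrArg toList h
  simp only [dropT, toList_ofList, List.drop_zero] at h
  funext i
  exact List.map_inj_left.1 h i (List.mem_finRange i)

theorem revT_injective {x y : Fin n → BTree} (h : revT x n = revT y n) : x = y := by
  have key : ∀ k ≤ n, revT x k = revT y k → ∀ i : Fin n, (i : ℕ) < k → x i = y i := by
    intro k
    induction k with
    | zero => intro _ _ i hi; omega
    | succ k ih =>
      intro hk h i hi
      rw [revT_succ x hk, revT_succ y hk] at h
      injection h with h1 h2
      rcases Nat.lt_succ_iff_lt_or_eq.1 hi with hi | hi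
      · exact ih (by omega) h2 i hi
      · have : i = ⟨k, hk⟩ := Fin.ext hi
        rw [this]; exact h1
  funext i
  exact key n le_rfl h i i.2

theorem ofFin_injective {k : ℕ} : Function.Injective (ofFin : Fin k → BTree) := fun _ _ h =>
  Fin.ext (ofNat_injective h)

/-- The action sets of the players from the index `k` on. -/
def actSets (k : ℕ) : BTree := dropT (fun i => ofRange (M.numAct i)) k

/-- The observation sets of the players from the index `k` on. -/
def obsSets (k : ℕ) : BTree := dropT (fun i => ofRange (M.numObs i)) k

theorem ofTuple_eq {k : Fin n → ℕ} (f : ∀ i, Fin (k i)) :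
    ofTuple f = dropT (fun i => ofFin (f i)) 0 := rfl

theorem ofTuple_injective {k : Fin n → ℕ} :
    Function.Injective (ofTuple : (∀ i, Fin (k i)) → BTree) := by
  intro f g h
  have := dropT_injective h
  funext i
  exact ofFin_injective (congrFun this i)

/-- The action of all modules, the rejections and the ticks. -/
def allActs : List BTree :=
  lGo :: (List.finRange n).flatMap fun i : Fin n => [lNext (M.actSets (i + 1)), lTick (M.obsSets (i + 1))]

/-- The rows `(s, a, s')` of the table of transition probabilities. -/
def transRows : List (Fin M.numS × M.GAct × Fin M.numS) :=
  (List.finRange M.numS).flatMap fun s => (allTuples n M.numAct).flatMap fun a =>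
    (List.finRange M.numS).map fun s' => (s, a, s')

/-- The rows `(s, a, s', o)` of the table of observation probabilities. -/
def obsRows : List (Fin M.numS × M.GAct × Fin M.numS × M.GObs) :=
  (List.finRange M.numS).flatMap fun s => (allTuples n M.numAct).flatMap fun a =>
    (List.finRange M.numS).flatMap fun s' => (allTuples n M.numObs).map fun o => (s, a, s', o)

theorem mem_allTuples : ∀ (n : ℕ) (k : Fin n → ℕ) (f : ∀ i, Fin (k i)), f ∈ allTuples n k
  | 0, _, f => by
    simp only [allTuples, List.mem_singleton]
    funext i; exact i.elim0
  | n + 1, k, f => by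
    simp only [allTuples, List.mem_flatMap, List.mem_map, List.mem_finRange, true_and]
    exact ⟨f 0, fun i => f i.succ, mem_allTuples n _ _, Fin.cons_self_tail f⟩

theorem mem_transRows (r : Fin M.numS × M.GAct × Fin M.numS) : r ∈ M.transRows := by
  obtain ⟨s, a, s'⟩ := r
  simp [transRows, mem_allTuples]

theorem mem_obsRows (r : Fin M.numS × M.GAct × Fin M.numS × M.GObs) : r ∈ M.obsRows := by
  obtain ⟨s, a, s', o⟩ := r
  simp [obsRows, mem_allTuples]

/-- The script that announces the global observation `o`. -/
def obsScript (o : M.GObs) : BTree := script (ofTuple o) (M.obsSets 0)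

/-- The action transitions of the environment. -/
def envTrans : List (BTree × BTree × BTree) :=
  ((List.finRange M.numS).map fun s =>
    (stReady (ofFin s), lGo, stPoll (ofFin s) nil (M.actSets 0))) ++
  (M.transRows.flatMap fun r => (splits nil (ofTuple r.2.1) (M.actSets 0)).flatMap fun x =>
    x.2.2.hd.suffixes.flatMap fun rem => pollTrans (ofFin r.1) x.1 rem x.2.2.tl) ++
  (M.obsRows.flatMap fun r => (script (ofTuple r.2.2.2) (M.obsSets 0)).suffixes.flatMap fun z =>
    tellTrans (ofFin r.2.2.1) (ofTuple r.2.2.2) z)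

/-- The delay transitions of the environment. -/
def envDelays : List (BTree × ℚ≥0 × BTree) :=
  ((List.finRange M.numS).map fun s => (stCheck (ofFin s), 1, stReady (ofFin s))) ++
  (M.transRows.flatMap fun r => (splits nil (ofTuple r.2.1) (M.actSets 0)).flatMap fun x =>
    x.2.2.hd.suffixes.flatMap fun rem => pollDelays (ofFin r.1) x.1 rem x.2.2.tl) ++
  (M.transRows.flatMap fun r => if M.P r.1 r.2.1 r.2.2 = 0 then [] else
    [(stPoll (ofFin r.1) (revAppend nil (ofTuple r.2.1)) nil, M.P r.1 r.2.1 r.2.2,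
      stObs (ofFin r.1) (ofTuple r.2.1) (ofFin r.2.2))]) ++
  (M.obsRows.flatMap fun r => if M.O r.1 r.2.1 r.2.2.1 r.2.2.2 = 0 then [] else
    [(stObs (ofFin r.1) (ofTuple r.2.1) (ofFin r.2.2.1), M.O r.1 r.2.1 r.2.2.1 r.2.2.2,
      stTell (ofFin r.2.2.1) (ofTuple r.2.2.2) (script (ofTuple r.2.2.2) (M.obsSets 0)))]) ++
  (M.obsRows.flatMap fun r => (script (ofTuple r.2.2.2) (M.obsSets 0)).suffixes.flatMap fun z =>
    tellDelays (ofFin r.2.2.1) (ofTuple r.2.2.2) z)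

variable {M}

theorem mem_envTrans {e : BTree × BTree × BTree} : e ∈ M.envTrans ↔
    (∃ s : Fin M.numS, e = (stReady (ofFin s), lGo, stPoll (ofFin s) nil (M.actSets 0))) ∨
    (∃ (s : Fin M.numS) (a : M.GAct) (i : Fin n) (k k' r : BTree),
      cons k (cons k' r) ∈ (ofRange (M.numAct i)).suffixes ∧
      e = (stPoll (ofFin s) (revT (fun i => ofFin (a i)) i)
          (cons (cons k (cons k' r)) (M.actSets (i + 1))),
        lNext (M.actSets (i + 1)),
        stPoll (ofFin s) (revT (fun i => ofFin (a i)) i)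
          (cons (cons k' r) (M.actSets (i + 1))))) ∨
    (∃ (s : Fin M.numS) (o : M.GObs),
      e = (stTell (ofFin s) (ofTuple o) nil, lGo, stCheck (ofFin s))) ∨
    (∃ (s : Fin M.numS) (o : M.GObs) (v z : BTree), v ≠ nil ∧
      cons v z ∈ (M.obsScript o).suffixes ∧
      e = (stTell (ofFin s) (ofTuple o) (cons v z), v, stTell (ofFin s) (ofTuple o) z)) := by
  have h0 : 0 < M.numS := M.init.pos
  simp only [envTrans, List.mem_append, List.mem_map, List.mem_flatMap, or_assoc]
  refine or_congr ?_ ?_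
  · simp only [List.mem_finRange, true_and]
    exact exists_congr fun s => eq_comm
  refine or_congr ?_ ?_
  · constructor
    · rintro ⟨⟨s, a, s'⟩, -, x, hx, rem, hrem, he⟩
      rw [ofTuple_eq, actSets, splits_dropT] at hx
      obtain ⟨i, -, rfl⟩ := List.mem_map.1 hx
      simp only [dropT_of_lt _ i.2, hd, tl] at hrem he
      cases rem with
      | nil => simp [pollTrans, tl] at he
      | cons k rem =>
        cases rem with
        | nil => simp [pollTrans, tl] at he
        | cons k' r =>
          exact ⟨s, a, i, k, k', r, hrem, by simpa [pollTrans, tl, actSets] using he⟩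
    · rintro ⟨s, a, i, k, k', r, hr, rfl⟩
      refine ⟨(s, a, s), mem_transRows _ _, (revT (fun i => ofFin (a i)) i,
        dropT (fun i => ofFin (a i)) i, M.actSets i), ?_, cons k (cons k' r), ?_, ?_⟩
      · rw [ofTuple_eq, actSets, splits_dropT]
        exact List.mem_map.2 ⟨i, List.mem_finRange i, rfl⟩
      · simpa [actSets, dropT_of_lt _ i.2, hd] using hr
      · simp [pollTrans, tl, actSets, dropT_of_lt _ i.2]
  · constructor
    · rintro ⟨⟨s, a, s', o⟩, -, z, hz, he⟩
      cases z with
      | nil => exact Or.inl ⟨s', o, by simpa [tellTrans] using he⟩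
      | cons v z =>
        by_cases hv : v = nil
        · simp [tellTrans, hv, hd] at he
        · exact Or.inr ⟨s', o, v, z, hv, hz, by simpa [tellTrans, hv, hd, tl] using he⟩
    · have a0 : M.GAct := fun i => ⟨0, M.numAct_pos i⟩
      rintro (⟨s, o, rfl⟩ | ⟨s, o, v, z, hv, hz, rfl⟩)
      · exact ⟨(s, a0, s, o), mem_obsRows _ _, nil, nil_mem_suffixes _, by simp [tellTrans]⟩
      · exact ⟨(s, a0, s, o), mem_obsRows _ _, cons v z, hz, by simp [tellTrans, hv, hd, tl]⟩

theorem mem_envDelays {e : BTree × ℚ≥0 × BTree} : e ∈ M.envDelays ↔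
    (∃ s : Fin M.numS, e = (stCheck (ofFin s), 1, stReady (ofFin s))) ∨
    (∃ (s : Fin M.numS) (a : M.GAct) (i : Fin n) (k r : BTree),
      cons k r ∈ (ofRange (M.numAct i)).suffixes ∧
      e = (stPoll (ofFin s) (revT (fun i => ofFin (a i)) i) (cons (cons k r) (M.actSets (i + 1))),
        1, stPoll (ofFin s) (cons k (revT (fun i => ofFin (a i)) i)) (M.actSets (i + 1)))) ∨
    (∃ (s : Fin M.numS) (a : M.GAct) (s' : Fin M.numS), M.P s a s' ≠ 0 ∧
      e = (stPoll (ofFin s) (revT (fun i => ofFin (a i)) n) nil, M.P s a s',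
        stObs (ofFin s) (ofTuple a) (ofFin s'))) ∨
    (∃ (s : Fin M.numS) (a : M.GAct) (s' : Fin M.numS) (o : M.GObs), M.O s a s' o ≠ 0 ∧
      e = (stObs (ofFin s) (ofTuple a) (ofFin s'), M.O s a s' o,
        stTell (ofFin s') (ofTuple o) (M.obsScript o))) ∨
    (∃ (s : Fin M.numS) (o : M.GObs) (z : BTree), cons nil z ∈ (M.obsScript o).suffixes ∧
      e = (stTell (ofFin s) (ofTuple o) (cons nil z), 1, stTell (ofFin s) (ofTuple o) z)) := by
  simp only [envDelays, List.mem_append, List.mem_map, List.mem_flatMap, or_assoc]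
  refine or_congr ?_ (or_congr ?_ (or_congr ?_ (or_congr ?_ ?_)))
  · simp only [List.mem_finRange, true_and]
    exact exists_congr fun s => eq_comm
  · constructor
    · rintro ⟨⟨s, a, s'⟩, -, x, hx, rem, hrem, he⟩
      rw [ofTuple_eq, actSets, splits_dropT] at hx
      obtain ⟨i, -, rfl⟩ := List.mem_map.1 hx
      simp only [dropT_of_lt _ i.2, hd, tl] at hrem he
      cases rem with
      | nil => simp [pollDelays] at he
      | cons k r => exact ⟨s, a, i, k, r, hrem, by simpa [pollDelays, hd, actSets] using he⟩
    · rintro ⟨s, a, i, k, r, hr, rfl⟩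
      refine ⟨(s, a, s), mem_transRows _ _, (revT (fun i => ofFin (a i)) i,
        dropT (fun i => ofFin (a i)) i, M.actSets i), ?_, cons k r, ?_, ?_⟩
      · rw [ofTuple_eq, actSets, splits_dropT]
        exact List.mem_map.2 ⟨i, List.mem_finRange i, rfl⟩
      · simpa [actSets, dropT_of_lt _ i.2, hd] using hr
      · simp [pollDelays, hd, tl, actSets, dropT_of_lt _ i.2]
  · constructor
    · rintro ⟨⟨s, a, s'⟩, -, he⟩
      by_cases h : M.P s a s' = 0
      · simp [h] at he
      · refine ⟨s, a, s', h, ?_⟩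
        simpa [h, ofTuple_eq, revAppend_dropT] using he
    · rintro ⟨s, a, s', h, rfl⟩
      exact ⟨(s, a, s'), mem_transRows _ _, by simp [h, ofTuple_eq, revAppend_dropT]⟩
  · constructor
    · rintro ⟨⟨s, a, s', o⟩, -, he⟩
      by_cases h : M.O s a s' o = 0
      · simp [h] at he
      · exact ⟨s, a, s', o, h, by simpa [h, obsScript] using he⟩
    · rintro ⟨s, a, s', o, h, rfl⟩
      exact ⟨(s, a, s', o), mem_obsRows _ _, by simp [h, obsScript]⟩
  · constructor
    · rintro ⟨⟨s, a, s', o⟩, -, z, hz, he⟩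
      cases z with
      | nil => simp [tellDelays] at he
      | cons v z =>
        by_cases hv : v = nil
        · subst hv
          exact ⟨s', o, z, hz, by simpa [tellDelays, hd, tl] using he⟩
        · simp [tellDelays, hv, hd] at he
    · have a0 : M.GAct := fun i => ⟨0, M.numAct_pos i⟩
      rintro ⟨s, o, z, hz, rfl⟩
      exact ⟨(s, a0, s, o), mem_obsRows _ _, cons nil z, hz, by simp [tellDelays, hd, tl]⟩

end DecPOMDP

namespace BTree

theorem lGo_ne_lNext (b : BTree) : lGo ≠ lNext b := by simp [lGo, lNext]

theorem lGo_ne_lTick (b : BTree) : lGo ≠ lTick b := by simp [lGo, lTick]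

theorem lNext_ne_lTick (b c : BTree) : lNext b ≠ lTick c := by simp [lNext, lTick, tag]

theorem lNext_injective {b c : BTree} (h : lNext b = lNext c) : b = c := by
  simpa [lNext] using h

theorem lTick_injective {b c : BTree} (h : lTick b = lTick c) : b = c := by
  simpa [lTick] using h

/-- A script for one player consists of ticks for this player and pauses. -/
theorem eq_of_cons_mem_suffixes_tellOne {v x K z w y : BTree}
    (h : cons w y ∈ (tellOne v x K z).suffixes) : w = nil ∨ w = v ∨ cons w y ∈ z.suffixes := by
  induction K with
  | nil => exact Or.inr (Or.inr h)
  | cons k K _ ih =>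
    rw [tellOne] at h
    split_ifs at h
    · simp only [suffixes, List.mem_cons, cons.injEq] at h
      rcases h with ⟨rfl, -⟩ | ⟨rfl, -⟩ | h
      · exact Or.inr (Or.inl rfl)
      · exact Or.inl rfl
      · exact ih h
    · simp only [suffixes, List.mem_cons, cons.injEq] at h
      rcases h with ⟨rfl, -⟩ | h
      · exact Or.inr (Or.inl rfl)
      · exact ih h

end BTree

namespace DecPOMDP

variable {n : ℕ} (M : DecPOMDP n)

/-- The part of the script for the global observation `o` that informs the players from the
index `k` on. -/
def scriptFrom (o : M.GObs) (k : ℕ) : BTree :=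
  script (dropT (fun i => ofFin (o i)) k) (M.obsSets k)

variable {M}

theorem scriptFrom_zero (o : M.GObs) : M.scriptFrom o 0 = M.obsScript o := rfl

theorem scriptFrom_of_le (o : M.GObs) {k : ℕ} (h : n ≤ k) : M.scriptFrom o k = nil := by
  rw [scriptFrom, dropT_of_le _ h, script]

theorem scriptFrom_of_lt (o : M.GObs) {k : ℕ} (h : k < n) :
    M.scriptFrom o k = tellOne (lTick (M.obsSets (k + 1))) (ofFin (o ⟨k, h⟩))
      (ofRange (M.numObs ⟨k, h⟩)) (M.scriptFrom o (k + 1)) := by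
  rw [scriptFrom, dropT_of_lt _ h, script, obsSets, dropT_of_lt _ h]
  rfl

theorem eq_of_cons_mem_suffixes_obsScript {o : M.GObs} {v z : BTree}
    (h : cons v z ∈ (M.obsScript o).suffixes) :
    v = nil ∨ ∃ i : Fin n, v = lTick (M.obsSets (i + 1)) := by
  have key : ∀ m k, m + k = n → cons v z ∈ (M.scriptFrom o k).suffixes →
      v = nil ∨ ∃ i : Fin n, v = lTick (M.obsSets (i + 1)) := by
    intro m
    induction m with
    | zero =>
      intro k hk h
      rw [scriptFrom_of_le o (by omega)] at h
      simp [suffixes] at h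
    | succ m ih =>
      intro k hk h
      rw [scriptFrom_of_lt o (by omega : k < n)] at h
      rcases eq_of_cons_mem_suffixes_tellOne h with h | h | h
      · exact Or.inl h
      · exact Or.inr ⟨⟨k, by omega⟩, h⟩
      · exact ih (k + 1) (by omega) h
  exact key n 0 rfl h

/-! ### The simulating distributed IMC -/

variable (M)

/-- The module of player `i`. -/
def playerModule (i : Fin n) : IMC :=
  listIMC nil [lNext (M.actSets (i + 1)), lTick (M.obsSets (i + 1)), lGo]
    (playerTrans (ofRange (M.numAct i)) (ofRange (M.numObs i)) (lNext (M.actSets (i + 1)))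
      (lTick (M.obsSets (i + 1)))) []
    (by
      intro e he
      rcases mem_playerTrans.1 he with ⟨r, -, rfl⟩ | ⟨x, r, -, rfl⟩ | ⟨y, q, -, rfl⟩ | rfl <;> simp)
    (by simp)

theorem label_mem_allActs {e : BTree × BTree × BTree} (he : e ∈ M.envTrans) :
    e.2.1 ∈ M.allActs := by
  simp only [allActs, List.mem_cons, List.mem_flatMap, List.mem_finRange, true_and,
    List.not_mem_nil, or_false]
  rcases mem_envTrans.1 he with ⟨s, rfl⟩ | ⟨s, a, i, k, k', r, hr, rfl⟩ | ⟨s, o, rfl⟩ |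
    ⟨s, o, v, z, hv, hz, rfl⟩
  · exact Or.inl rfl
  · exact Or.inr ⟨i, Or.inl rfl⟩
  · exact Or.inl rfl
  · rcases eq_of_cons_mem_suffixes_obsScript hz with h | ⟨i, h⟩
    · exact absurd h hv
    · exact Or.inr ⟨i, Or.inr h⟩

theorem rate_pos {e : BTree × ℚ≥0 × BTree} (he : e ∈ M.envDelays) : 0 < e.2.1 := by
  rcases mem_envDelays.1 he with ⟨s, rfl⟩ | ⟨s, a, i, k, r, hr, rfl⟩ | ⟨s, a, s', h, rfl⟩ |
    ⟨s, a, s', o, h, rfl⟩ | ⟨s, o, z, hz, rfl⟩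
  · exact one_pos
  · exact one_pos
  · exact pos_iff_ne_zero.2 h
  · exact pos_iff_ne_zero.2 h
  · exact one_pos

/-- The module of the environment. -/
def envModule : IMC :=
  listIMC (stCheck (ofFin M.init)) M.allActs M.envTrans M.envDelays
    (fun _ => M.label_mem_allActs) (fun _ => M.rate_pos)

/-- A rank that decreases along the action transitions of the environment. -/
noncomputable def envRank (x : BTree) : ℕ∞ :=
  if x.hd = tag 1 then ⊤ else if x.hd = tag 0 then 0 else (x.size : ℕ∞)

theorem envRank_lt {e : BTree × BTree × BTree} (he : e ∈ M.envTrans) :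
    envRank e.2.2 < envRank e.1 := by
  rcases mem_envTrans.1 he with ⟨s, rfl⟩ | ⟨s, a, i, k, k', r, hr, rfl⟩ | ⟨s, o, rfl⟩ |
    ⟨s, o, v, z, hv, hz, rfl⟩
  · simp [envRank, stPoll, stReady, hd, tag]
  · simp only [envRank, stPoll, hd, tag, reduceCtorEq, cons.injEq, and_false, if_false]
    norm_cast
    simp only [size]
    omega
  · simp [envRank, stTell, stCheck, hd, tag, size]
  · simp only [envRank, stTell, hd, tag, reduceCtorEq, cons.injEq, and_false, if_false]
    norm_cast
    simp only [size]
    omega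

/-- The environment takes part in all actions, so it is enough that it has no cycle of action
transitions. -/
theorem envTrans_acyclic {s a s' : BTree} (h : (s, a, s') ∈ M.envTrans) :
    ¬ Relation.ReflTransGen (fun u v => ∃ b, (u, b, v) ∈ M.envTrans) s' s := by
  intro hr
  have hle : envRank s ≤ envRank s' := by
    clear h
    induction hr with
    | refl => exact le_rfl
    | tail _ h ih =>
      obtain ⟨b, hb⟩ := h
      exact (M.envRank_lt hb).le.trans ih
  exact absurd (M.envRank_lt h) (not_lt.2 hle)

/-- The modules of the distributed IMC: the environment is player `0`. -/
def modules : Fin (n + 1) → IMC := Fin.cons M.envModule M.playerModule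

theorem acts_subset (j : Fin (n + 1)) {a : BTree} (h : a ∈ (M.modules j).acts) :
    a ∈ M.envModule.acts := by
  refine Fin.cases (fun h => h) (fun i h => ?_) j h
  simp only [modules, Fin.cons_succ, playerModule, listIMC, List.mem_toFinset] at h
  simp only [envModule, listIMC, List.mem_toFinset, allActs, List.mem_cons, List.mem_flatMap,
    List.mem_finRange, true_and, List.not_mem_nil, or_false] at h ⊢
  rcases h with h | h | h
  · exact Or.inr ⟨i, Or.inl h⟩
  · exact Or.inr ⟨i, Or.inr h⟩
  · exact Or.inl h

/-- The distributed IMC that simulates a DEC-POMDP. -/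
def toDistIMC : DistIMC (n + 1) where
  mod := M.modules
  acyclic := by
    rintro a ⟨j, hj⟩
    refine ⟨0, M.acts_subset j hj, fun s s' h => ?_⟩
    simp only [modules, Fin.cons_zero, envModule, listIMC, List.mem_toFinset] at h ⊢
    exact M.envTrans_acyclic h

@[simp] theorem toDistIMC_mod_zero : M.toDistIMC.mod 0 = M.envModule := rfl

@[simp] theorem toDistIMC_mod_succ (i : Fin n) : M.toDistIMC.mod i.succ = M.playerModule i := rfl

/-- The global state in which the environment is in the state `e`, and player `i` has the list `r i`
of rejections and the list `q i` of ticks before it. -/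
def gState (e : BTree) (r q : Fin n → BTree) : DistIMC.GState (n + 1) :=
  Fin.cons e fun i => cons (r i) (q i)

/-- The global state in which a round starts with the simulated process in the state `s`. -/
def startState (s : Fin M.numS) : DistIMC.GState (n + 1) :=
  Fin.cons (stCheck (ofFin s)) fun _ => nil

/-- The target set of the distributed IMC. -/
def targets (T : Finset (Fin M.numS)) : Finset (DistIMC.GState (n + 1)) := T.image M.startState

theorem startState_injective : Function.Injective M.startState := by
  intro s s' h
  have := congrFun h 0
  simp only [startState, Fin.cons_zero, stCheck, cons.injEq, true_and] at this
  exact ofFin_injective this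

theorem startState_mem_targets {T : Finset (Fin M.numS)} {s : Fin M.numS} :
    M.startState s ∈ M.targets T ↔ s ∈ T := by
  simp [targets, M.startState_injective.eq_iff]

theorem targets_subset (T : Finset (Fin M.numS)) :
    ∀ x ∈ M.targets T, x ∈ M.toDistIMC.globalStates := by
  intro x hx
  obtain ⟨s, -, rfl⟩ := Finset.mem_image.1 hx
  intro j
  refine Fin.cases ?_ (fun i => ?_) j
  · have h : (stCheck (ofFin s), (1 : ℚ≥0), stReady (ofFin s)) ∈ M.envModule.delays := by
      simp only [envModule, listIMC, List.mem_toFinset]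
      exact mem_envDelays.2 (Or.inl ⟨s, rfl⟩)
    exact (M.envModule.delays_mem _ h).1
  · exact (M.playerModule i).init_mem

/-! ### The scheduler is irrelevant -/

theorem Enabled_subsingleton (c : DistIMC.GChoice (n + 1)) :
    (M.toDistIMC.Enabled c).Subsingleton := by
  rintro a ⟨⟨j, hj⟩, ha⟩ b ⟨⟨k, hk⟩, hb⟩
  have ha := ha 0 (M.acts_subset j hj)
  have hb := hb 0 (M.acts_subset k hk)
  cases h : c 0 with
  | bot => rw [h] at ha; exact ha.elim
  | trans e => rw [h] at ha hb; exact ha.symm.trans hb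

theorem eq_dirac_of_ae {α : Type*} [MeasurableSpace α] {μ : Measure α} [IsProbabilityMeasure μ]
    {a : α} (h : ∀ᵐ x ∂μ, x = a) : μ = Measure.dirac a := by
  have h1 : μ.map id = μ.map fun _ => a := Measure.map_congr h
  rwa [Measure.map_id, Measure.map_const, measure_univ, one_smul] at h1

variable {M}

theorem scheduler_apply_of_mem (δ : M.toDistIMC.Scheduler) (h : List (DistIMC.Rec (n + 1)))
    {c : DistIMC.GChoice (n + 1)} {a : BTree} (ha : a ∈ M.toDistIMC.Enabled c) :
    δ.kernel (h, c) = Measure.dirac (some a) := by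
  refine eq_dirac_of_ae ?_
  filter_upwards [δ.enabled h c] with o ho
  cases o with
  | none => rw [ho] at ha; exact ha.elim
  | some b => rw [M.Enabled_subsingleton c ho ha]

theorem scheduler_apply_of_empty (δ : M.toDistIMC.Scheduler) (h : List (DistIMC.Rec (n + 1)))
    {c : DistIMC.GChoice (n + 1)} (hc : M.toDistIMC.Enabled c = ∅) :
    δ.kernel (h, c) = Measure.dirac none := by
  refine eq_dirac_of_ae ?_
  filter_upwards [δ.enabled h c] with o ho
  cases o with
  | none => rfl
  | some b =>
    have ho : b ∈ M.toDistIMC.Enabled c := ho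
    rw [hc] at ho; exact ho.elim

/-- The environment takes part in all actions and offers at most one, so that schedulers never have
a choice. -/
theorem scheduler_kernel_eq (δ δ' : M.toDistIMC.Scheduler) : δ.kernel = δ'.kernel := by
  ext1 x
  obtain ⟨h, c⟩ := x
  rcases (M.toDistIMC.Enabled c).eq_empty_or_nonempty with hc | ⟨a, ha⟩
  · rw [scheduler_apply_of_empty δ h hc, scheduler_apply_of_empty δ' h hc]
  · rw [scheduler_apply_of_mem δ h ha, scheduler_apply_of_mem δ' h ha]

theorem scheduler_eq (δ δ' : M.toDistIMC.Scheduler) : δ = δ' := by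
  have h := scheduler_kernel_eq δ δ'
  cases δ; cases δ'
  simp only at h
  subst h
  rfl

end DecPOMDP

/-! ### Single steps of a distributed IMC -/

namespace DistIMC

variable {n : ℕ} (G : DistIMC n)

theorem lastState_snoc (h : List (Rec n)) (r : Rec n) : G.lastState (h ++ [r]) = r.2.2.1 := by
  simp [lastState]

theorem lastTime_snoc (h : List (Rec n)) (r : Rec n) : lastTime (h ++ [r]) = r.2.2.2 := by
  simp [lastTime]

theorem localHist_snoc_of_mem {j : Fin n} (h : List (Rec n)) {r : Rec n} (hj : j ∈ G.Sync r.2.1) :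
    G.localHist j (h ++ [r]) = G.localHist j h ++ [(r.1 j, r.2.1, r.2.2.1 j, r.2.2.2)] := by
  simp [localHist, List.filter_append, hj]

theorem localHist_snoc_of_notMem {j : Fin n} (h : List (Rec n)) {r : Rec n}
    (hj : j ∉ G.Sync r.2.1) : G.localHist j (h ++ [r]) = G.localHist j h := by
  simp [localHist, List.filter_append, hj]

theorem localLast_snoc (j : Fin n) (h : List (LRec n)) (r : LRec n) :
    G.localLast j (h ++ [r]) = r.2.2.1 := by
  simp [localLast]

open Classical in
theorem choiceLaw_of_chooses (σ : G.Profile) {j : Fin n} {h : List (Rec n)} (hj : G.Chooses j h) :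
    G.choiceLaw σ j h = (σ j).kernel (G.localHist j h) := by
  unfold choiceLaw
  rw [Kernel.piecewise_apply]
  exact if_pos hj

open Classical in
theorem choiceLaw_of_not_chooses (σ : G.Profile) {j : Fin n} {h : List (Rec n)}
    (hj : ¬ G.Chooses j h) : G.choiceLaw σ j h = Measure.dirac (prevChoice j h) := by
  unfold choiceLaw
  rw [Kernel.piecewise_apply]
  exact (if_neg hj).trans (Kernel.deterministic_apply _ _)

theorem chooses_snoc {j : Fin n} (h : List (Rec n)) (r : Rec n) :
    G.Chooses j (h ++ [r]) ↔ j ∈ G.Sync r.2.1 := by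
  simp [Chooses]

theorem prevChoice_snoc (j : Fin n) (h : List (Rec n)) (r : Rec n) :
    prevChoice j (h ++ [r]) = r.1 j := by
  simp [prevChoice]

theorem lintegral_stepKernel (σ : G.Profile) (δ : G.Scheduler) (h : List (Rec n))
    {F : Rec n → ℝ≥0∞} (hF : Measurable F) :
    ∫⁻ r, F r ∂(G.stepKernel σ δ h) = ∫⁻ c, ∫⁻ o, ∫⁻ y, F (c, y) ∂(G.moveKernel ((h, c), o))
      ∂(δ.kernel (h, c)) ∂(G.choiceKernel σ h) := by
  unfold stepKernel
  rw [Kernel.lintegral_map _ (by fun_prop) _ hF, Kernel.lintegral_compProd _ _ _ (by fun_prop)]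
  refine lintegral_congr fun c => ?_
  rw [Kernel.lintegral_compProd _ _ _ (by fun_prop)]

theorem lintegral_delayKernel (h : List (Rec n)) {F : Label n × GState n × ℝ → ℝ≥0∞}
    (hF : Measurable F) :
    ∫⁻ y, F y ∂(G.delayKernel h)
      = ∫⁻ y, F (y.1, y.2.1, lastTime h + y.2.2) ∂(G.raceLaw (G.lastState h)) := by
  unfold delayKernel
  rw [Kernel.lintegral_map _ (by fun_prop) _ hF, Kernel.prod_apply, Kernel.deterministic_apply,
    Measure.prod_dirac, lintegral_map (by fun_prop) (by fun_prop)]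
  rfl

theorem pi_dirac_eq (c : GChoice n) :
    (Measure.pi fun j => Measure.dirac (c j)) = Measure.dirac c := by
  classical
  refine Measure.pi_eq fun s _ => ?_
  simp only [Measure.dirac_apply' _ MeasurableSet.of_discrete, Set.indicator_apply, Pi.one_apply,
    Finset.prod_ite_zero, Finset.prod_const_one, Set.mem_pi, Set.mem_univ, Finset.mem_univ,
    forall_const]

theorem choiceKernel_eq_dirac (σ : G.Profile) {h : List (Rec n)} {c : GChoice n}
    (hc : ∀ j, G.choiceLaw σ j h = Measure.dirac (c j)) :
    G.choiceKernel σ h = Measure.dirac c := by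
  change (Measure.pi fun j => G.choiceLaw σ j h) = _
  simp_rw [hc]
  exact pi_dirac_eq c

theorem lintegral_stepKernel_of_enabled (σ : G.Profile) {δ : G.Scheduler} {h : List (Rec n)}
    {c : GChoice n} (hc : ∀ j, G.choiceLaw σ j h = Measure.dirac (c j)) {a : BTree}
    (hδ : δ.kernel (h, c) = Measure.dirac (some a)) {F : Rec n → ℝ≥0∞} (hF : Measurable F) :
    ∫⁻ r, F r ∂(G.stepKernel σ δ h) = F (c, G.actStep h c a) := by
  rw [G.lintegral_stepKernel σ δ h hF, G.choiceKernel_eq_dirac σ hc, lintegral_dirac, hδ,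
    lintegral_dirac]
  exact lintegral_dirac' _ (hF.comp measurable_prodMk_left)

theorem lintegral_stepKernel_of_disabled (σ : G.Profile) {δ : G.Scheduler} {h : List (Rec n)}
    (hδ : ∀ᵐ c ∂(G.choiceKernel σ h), δ.kernel (h, c) = Measure.dirac none)
    {F : Rec n → ℝ≥0∞} (hF : Measurable F) :
    ∫⁻ r, F r ∂(G.stepKernel σ δ h) = ∫⁻ c, ∫⁻ y, F (c, y.1, y.2.1, lastTime h + y.2.2)
      ∂(G.raceLaw (G.lastState h)) ∂(G.choiceKernel σ h) := by
  rw [G.lintegral_stepKernel σ δ h hF]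
  refine lintegral_congr_ae ?_
  filter_upwards [hδ] with c hc
  rw [hc, lintegral_dirac]
  exact G.lintegral_delayKernel h (hF.comp measurable_prodMk_left)

end DistIMC

/-! ### Inequalities with a variable direction -/

/-- The inequality `x ≤ y` if `b` is true, and `y ≤ x` otherwise. The analysis of a round applies in
one direction to the finite-horizon values and in the other to their limit. -/
def Ineq (b : Bool) (x y : ℝ≥0∞) : Prop := if b then x ≤ y else y ≤ x

namespace Ineq

variable {b : Bool} {x y z : ℝ≥0∞}

theorem refl (b : Bool) (x : ℝ≥0∞) : Ineq b x x := by cases b <;> simp [Ineq]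

theorem of_eq (h : x = y) : Ineq b x y := h ▸ refl b x

theorem trans (h : Ineq b x y) (h' : Ineq b y z) : Ineq b x z := by
  cases b
  · exact le_trans (h' : z ≤ y) h
  · exact le_trans (h : x ≤ y) h'

theorem mul_left (c : ℝ≥0∞) (h : Ineq b x y) : Ineq b (c * x) (c * y) := by
  cases b
  · exact mul_le_mul_right (h : y ≤ x) c
  · exact mul_le_mul_right (h : x ≤ y) c

theorem sum {ι : Type*} {s : Finset ι} {f g : ι → ℝ≥0∞} (h : ∀ i ∈ s, Ineq b (f i) (g i)) :
    Ineq b (∑ i ∈ s, f i) (∑ i ∈ s, g i) := by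
  cases b
  · exact Finset.sum_le_sum (f := g) (g := f) h
  · exact Finset.sum_le_sum (f := f) (g := g) h

theorem lintegral {α : Type*} [MeasurableSpace α] {μ : Measure α} {f g : α → ℝ≥0∞}
    (h : ∀ a, Ineq b (f a) (g a)) : Ineq b (∫⁻ a, f a ∂μ) (∫⁻ a, g a ∂μ) := by
  cases b
  · exact lintegral_mono (f := g) (g := f) h
  · exact lintegral_mono (f := f) (g := g) h

end Ineq

/-! ### Events -/

namespace DistIMC

/-- A configuration of the simulation: the local histories of the `n` players other than the
environment, the time, and the delays that are still to come. -/
abbrev Cfg (n : ℕ) : Type := (Fin n → List (LRec (n + 1))) × ℝ × (ℕ → ℝ)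

/-- The part of a configuration that concerns one player. -/
abbrev LocalCfg (n : ℕ) : Type := List (LRec (n + 1)) × ℝ × (ℕ → ℝ)

/-- An event of a simulation: a delay (`none`), or a record of the local history of a player,
without the time. -/
abbrev Event (n : ℕ) : Type := Option (Fin n × Choice × Label (n + 1) × BTree)

/-- An event as it is seen by one player. -/
abbrev LocalEvent (n : ℕ) : Type := Option (Choice × Label (n + 1) × BTree)

variable {n : ℕ}

/-- The effect of an event. A delay uses up the first of the delays to come. -/
def globalStep (x : Cfg n) : Event n → Cfg n
  | none => (x.1, x.2.1 + x.2.2 0, streamTail x.2.2)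
  | some (i, c, a, s) => (Function.update x.1 i (x.1 i ++ [(c, a, s, x.2.1)]), x.2)

/-- The effect of an event for one player. -/
def localStep (x : LocalCfg n) : LocalEvent n → LocalCfg n
  | none => (x.1, x.2.1 + x.2.2 0, streamTail x.2.2)
  | some (c, a, s) => (x.1 ++ [(c, a, s, x.2.1)], x.2)

/-- The effect of a sequence of events. -/
def run (es : List (Event n)) (x : Cfg n) : Cfg n := es.foldl globalStep x

/-- The effect of a sequence of events for one player. -/
def localRun (es : List (LocalEvent n)) (x : LocalCfg n) : LocalCfg n := es.foldl localStep x

/-- The events that player `i` is aware of; delays are visible through the time. -/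
def project (i : Fin n) (es : List (Event n)) : List (LocalEvent n) :=
  es.filterMap fun e => match e with
    | none => some none
    | some (j, r) => if j = i then some (some r) else none

theorem measurable_globalStep (e : Event n) : Measurable fun x : Cfg n => globalStep x e := by
  cases e with
  | none =>
    exact measurable_fst.prodMk (((measurable_fst.comp measurable_snd).add
      ((measurable_pi_apply 0).comp (measurable_snd.comp measurable_snd))).prodMk
      (measurable_streamTail.comp (measurable_snd.comp measurable_snd)))
  | some e =>
    obtain ⟨i, c, a, s⟩ := e
    refine Measurable.prodMk (measurable_pi_iff.2 fun j => ?_) measurable_snd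
    by_cases hj : j = i
    · subst hj
      simp only [Function.update_self]
      exact Measurable.list_snoc ((measurable_pi_apply j).comp measurable_fst)
        (measurable_const.prodMk (measurable_const.prodMk (measurable_const.prodMk
          (measurable_fst.comp measurable_snd))))
    · simp only [Function.update_of_ne hj]
      exact (measurable_pi_apply j).comp measurable_fst

theorem measurable_run (es : List (Event n)) : Measurable (run es) := by
  induction es with
  | nil => exact measurable_id
  | cons e es ih => exact ih.comp (measurable_globalStep e)

theorem run_cons (e : Event n) (es : List (Event n)) (x : Cfg n) :
    run (e :: es) x = run es (globalStep x e) := rfl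

theorem run_append (es es' : List (Event n)) (x : Cfg n) :
    run (es ++ es') x = run es' (run es x) := List.foldl_append

theorem localRun_append (es es' : List (LocalEvent n)) (x : LocalCfg n) :
    localRun (es ++ es') x = localRun es' (localRun es x) := List.foldl_append

theorem run_eq (i : Fin n) (es : List (Event n)) (x : Cfg n) :
    ((run es x).1 i, (run es x).2) = localRun (project i es) (x.1 i, x.2) := by
  induction es generalizing x with
  | nil => rfl
  | cons e es ih =>
    rw [run_cons, ih]
    cases e with
    | none => simp [project, localRun, localStep, globalStep]
    | some e =>
      obtain ⟨j, c, a, s⟩ := e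
      by_cases hj : j = i
      · subst hj; simp [project, localRun, localStep, globalStep]
      · simp [project, globalStep, hj, Function.update_of_ne (Ne.symm hj)]

/-- The records of one step in which all players take part. -/
def allEvents (c : Fin n → Choice) (a : Label (n + 1)) (s : Fin n → BTree) : List (Event n) :=
  (List.finRange n).map fun i => some (i, c i, a, s i)

theorem run_allEvents (c : Fin n → Choice) (a : Label (n + 1)) (s : Fin n → BTree) (x : Cfg n) :
    run (allEvents c a s) x = (fun i => x.1 i ++ [(c i, a, s i, x.2.1)], x.2) := by
  have key : ∀ (L : List (Fin n)), L.Nodup → ∀ x : Cfg n,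
      run (L.map fun i => (some (i, c i, a, s i) : Event n)) x
        = (fun i => if i ∈ L then x.1 i ++ [(c i, a, s i, x.2.1)] else x.1 i, x.2) := by
    intro L hL
    induction L with
    | nil => intro x; rfl
    | cons j L ih =>
      intro x
      obtain ⟨hj, hL⟩ := List.nodup_cons.1 hL
      rw [List.map_cons, run_cons, ih hL]
      refine Prod.ext (funext fun i => ?_) rfl
      by_cases hi : i = j
      · subst hi; simp [hj, globalStep]
      · simp [hi, globalStep]
  rw [allEvents, key _ (List.nodup_finRange n)]
  simp

theorem project_allEvents (i : Fin n) (c : Fin n → Choice) (a : Label (n + 1))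
    (s : Fin n → BTree) : project i (allEvents c a s) = [some (c i, a, s i)] := by
  have key : ∀ (L : List (Fin n)), L.Nodup →
      project i (L.map fun i => (some (i, c i, a, s i) : Event n))
        = if i ∈ L then [some (c i, a, s i)] else [] := by
    intro L hL
    induction L with
    | nil => rfl
    | cons j L ih =>
      obtain ⟨hj, hL⟩ := List.nodup_cons.1 hL
      have h1 : ∀ e (es : List (Event n)), project i (e :: es) = project i [e] ++ project i es := by
        intro e es
        simp [project, ← List.filterMap_append]
      rw [List.map_cons, h1, ih hL]
      by_cases hi : i = j
      · subst hi; simp [hj, project]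
      · simp [hi, project, Ne.symm hi]
  rw [allEvents, key _ (List.nodup_finRange n)]
  simp

end DistIMC

/-! ### Forced choices -/

namespace DecPOMDP

variable {n : ℕ} (M : DecPOMDP n)

/-- The choice of player `i` in the state `cons r q`. -/
def playerChoice (i : Fin n) : BTree → BTree → Choice
  | cons x r, q => .trans (cons (cons x r) q, lNext (M.actSets (i + 1)), cons r q)
  | nil, cons y q => .trans (cons nil (cons y q), lTick (M.obsSets (i + 1)), cons nil q)
  | nil, nil => .trans (cons nil nil, lGo, nil)

/-- The lists that the players have before them during a round. -/
structure Legal (r q : Fin n → BTree) : Prop where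
  mem_left : ∀ i, r i ∈ (ofRange (M.numAct i)).tl.suffixes
  mem_right : ∀ i, q i ∈ (ofRange (M.numObs i)).suffixes
  full : ∀ i, r i ≠ nil → q i = ofRange (M.numObs i)

variable {M}

theorem mem_trans_playerModule {i : Fin n} {e : BTree × BTree × BTree} :
    e ∈ (M.playerModule i).trans ↔ e ∈ playerTrans (ofRange (M.numAct i)) (ofRange (M.numObs i))
      (lNext (M.actSets (i + 1))) (lTick (M.obsSets (i + 1))) := List.mem_toFinset

theorem mem_trans_envModule {e : BTree × BTree × BTree} :
    e ∈ M.envModule.trans ↔ e ∈ M.envTrans := List.mem_toFinset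

/-- Outside the state `nil`, a player has exactly one transition to choose from. -/
theorem eq_playerChoice {r q : Fin n → BTree} (h : M.Legal r q) (i : Fin n) {d : Choice}
    (hd : (M.playerModule i).Available (cons (r i) (q i)) d) :
    d = M.playerChoice i (r i) (q i) := by
  have h1 := h.mem_left i
  have h2 := h.mem_right i
  have h3 := h.full i
  generalize r i = r at *
  generalize q i = q at *
  cases d with
  | bot =>
    exfalso
    have hd : ∀ e ∈ (M.playerModule i).trans, e.1 ≠ cons r q := hd
    simp only [mem_trans_playerModule, mem_playerTrans] at hd
    cases r with
    | cons x r =>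
      obtain rfl := h3 (by simp)
      exact hd _ (Or.inr (Or.inl ⟨x, r, h1, rfl⟩)) rfl
    | nil =>
      cases q with
      | cons y q => exact hd _ (Or.inr (Or.inr (Or.inl ⟨y, q, h2, rfl⟩))) rfl
      | nil => exact hd _ (Or.inr (Or.inr (Or.inr rfl))) rfl
  | trans e =>
    obtain ⟨he, hs⟩ : e ∈ (M.playerModule i).trans ∧ e.1 = cons r q := hd
    rw [mem_trans_playerModule, mem_playerTrans] at he
    rcases he with ⟨r', -, rfl⟩ | ⟨x, r', -, rfl⟩ | ⟨y, q', -, rfl⟩ | rfl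
    · simp at hs
    · obtain ⟨rfl, rfl⟩ := by simpa using hs
      rfl
    · obtain ⟨rfl, rfl⟩ := by simpa using hs
      rfl
    · obtain ⟨rfl, rfl⟩ := by simpa using hs
      rfl

/-- The environment offers at most one action in every state. -/
theorem envTrans_deterministic {e e' : BTree × BTree × BTree} (he : e ∈ M.envTrans)
    (he' : e' ∈ M.envTrans) (h : e.1 = e'.1) : e = e' := by
  rcases mem_envTrans.1 he with ⟨s, rfl⟩ | ⟨s, a, i, k, k', r, hr, rfl⟩ | ⟨s, o, rfl⟩ |
    ⟨s, o, v, z, hv, hz, rfl⟩ <;>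
  rcases mem_envTrans.1 he' with ⟨s', rfl⟩ | ⟨s', a', i', l, l', r', hr', rfl⟩ | ⟨s', o', rfl⟩ |
    ⟨s', o', v', z', hv', hz', rfl⟩ <;>
  simp only [stReady, stPoll, stTell, tag, cons.injEq, reduceCtorEq, true_and, and_true,
    false_and, and_false] at h
  · rw [h]
  · obtain ⟨h1, h2, ⟨h3, h4, h5⟩, h6⟩ := h
    rw [h1, h2, h3, h4, h5, h6]
  · rw [h.1, h.2]
  · obtain ⟨⟨h1, h2⟩, h3, h4⟩ := h
    rw [h1, h2, h3, h4]

variable (M)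

open Classical in
/-- The choice of the environment in the state `e`. -/
noncomputable def envChoice (e : BTree) : Choice :=
  if h : ∃ x ∈ M.envTrans, x.1 = e then .trans h.choose else .bot

variable {M}

theorem envChoice_of_mem {x : BTree × BTree × BTree} (hx : x ∈ M.envTrans) :
    M.envChoice x.1 = .trans x := by
  have h : ∃ y ∈ M.envTrans, y.1 = x.1 := ⟨x, hx, rfl⟩
  rw [envChoice, dif_pos h,
    envTrans_deterministic h.choose_spec.1 hx h.choose_spec.2]

/-- The environment has no choice in any of its states. -/
theorem eq_envChoice {e : BTree} {d : Choice} (hd : M.envModule.Available e d) :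
    d = M.envChoice e := by
  cases d with
  | bot =>
    have hd : ∀ x ∈ M.envModule.trans, x.1 ≠ e := hd
    rw [envChoice, dif_neg]
    rintro ⟨x, hx, rfl⟩
    exact hd x (mem_trans_envModule.2 hx) rfl
  | trans x =>
    obtain ⟨hx, rfl⟩ := hd
    exact (envChoice_of_mem (mem_trans_envModule.1 hx)).symm

variable (M)

/-- The choices of all players in the global state `gState e r q`. -/
noncomputable def choices (e : BTree) (r q : Fin n → BTree) : DistIMC.GChoice (n + 1) :=
  Fin.cons (M.envChoice e) fun i => M.playerChoice i (r i) (q i)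

variable {M}

/-- During a round, all choices are forced. -/
theorem eq_choices {e : BTree} {r q : Fin n → BTree} (h : M.Legal r q) (j : Fin (n + 1))
    {d : Choice} (hd : (M.toDistIMC.mod j).Available (gState e r q j) d) :
    d = M.choices e r q j := by
  revert hd
  refine Fin.cases (fun hd => ?_) (fun i hd => ?_) j
  · exact eq_envChoice hd
  · exact eq_playerChoice h i hd

theorem sync_lGo : DistIMC.Sync M.toDistIMC (.act lGo) = Set.univ := by
  refine Set.eq_univ_of_forall fun j => ?_
  change lGo ∈ (M.toDistIMC.mod j).acts
  refine Fin.cases ?_ (fun i => ?_) j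
  · simp [envModule, listIMC, allActs]
  · simp [playerModule, listIMC]

theorem actSets_injective {i j : Fin n} (h : M.actSets (i + 1) = M.actSets (j + 1)) : i = j := by
  have h := congrArg len h
  simp only [actSets, len_dropT] at h
  exact Fin.ext (by omega)

theorem obsSets_injective {i j : Fin n} (h : M.obsSets (i + 1) = M.obsSets (j + 1)) : i = j := by
  have h := congrArg len h
  simp only [obsSets, len_dropT] at h
  exact Fin.ext (by omega)

theorem mem_acts_playerModule {i : Fin n} {a : BTree} : a ∈ (M.playerModule i).acts ↔
    a = lNext (M.actSets (i + 1)) ∨ a = lTick (M.obsSets (i + 1)) ∨ a = lGo := by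
  simp [playerModule, listIMC]

theorem lNext_mem_acts {i j : Fin n} :
    lNext (M.actSets (i + 1)) ∈ (M.playerModule j).acts ↔ j = i := by
  rw [mem_acts_playerModule]
  constructor
  · rintro (h | h | h)
    · exact (actSets_injective (lNext_injective h)).symm
    · exact absurd h (lNext_ne_lTick _ _)
    · exact absurd h.symm (lGo_ne_lNext _)
  · rintro rfl; exact Or.inl rfl

theorem lTick_mem_acts {i j : Fin n} :
    lTick (M.obsSets (i + 1)) ∈ (M.playerModule j).acts ↔ j = i := by
  rw [mem_acts_playerModule]
  constructor
  · rintro (h | h | h)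
    · exact absurd h.symm (lNext_ne_lTick _ _)
    · exact (obsSets_injective (lTick_injective h)).symm
    · exact absurd h.symm (lGo_ne_lTick _)
  · rintro rfl; exact Or.inr (Or.inl rfl)

end DecPOMDP

/-! ### Simulated steps -/

namespace DistIMC

variable {n : ℕ} (G : DistIMC (n + 1))

/-- After the history `h`, the global state is `x`, the players choose `c` with certainty, the time
is `t`, and the local histories of the players other than player `0` are `l`. -/
structure At (σ : G.Profile) (h : List (Rec (n + 1))) (x : GState (n + 1)) (c : GChoice (n + 1))
    (t : ℝ) (l : Fin n → List (LRec (n + 1))) : Prop where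
  state : G.lastState h = x
  time : lastTime h = t
  hist : ∀ i, G.localHist (Fin.succ i) h = l i
  choice : ∀ j, G.choiceLaw σ j h = Measure.dirac (c j)

variable {G}

/-- The position after the step `(c, a, x', t')`, if the choice in the new state is forced for the
participants of the step. -/
theorem At.snoc {σ : G.Profile} {h : List (Rec (n + 1))} {x : GState (n + 1)}
    {c : GChoice (n + 1)} {t : ℝ} {l : Fin n → List (LRec (n + 1))} (hat : G.At σ h x c t l)
    {a : Label (n + 1)} {x' : GState (n + 1)} {t' : ℝ} {c' : GChoice (n + 1)}
    {l' : Fin n → List (LRec (n + 1))}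
    (hc : ∀ j ∈ G.Sync a, ∀ d, (G.mod j).Available (x' j) d → d = c' j)
    (hc' : ∀ j ∉ G.Sync a, c' j = c j)
    (hl : ∀ i : Fin n, i.succ ∈ G.Sync a → l' i = l i ++ [(c i.succ, a, x' i.succ, t')])
    (hl' : ∀ i : Fin n, i.succ ∉ G.Sync a → l' i = l i) :
    G.At σ (h ++ [(c, a, x', t')]) x' c' t' l' where
  state := G.lastState_snoc _ _
  time := lastTime_snoc _ _
  hist i := by
    by_cases hi : i.succ ∈ G.Sync a
    · rw [G.localHist_snoc_of_mem h (r := (c, a, x', t')) hi, hat.hist, hl i hi]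
    · rw [G.localHist_snoc_of_notMem h (r := (c, a, x', t')) hi, hat.hist, hl' i hi]
  choice j := by
    by_cases hj : j ∈ G.Sync a
    · have hch : G.Chooses j (h ++ [(c, a, x', t')]) := (G.chooses_snoc _ _).2 hj
      rw [G.choiceLaw_of_chooses σ hch]
      refine DecPOMDP.eq_dirac_of_ae ?_
      filter_upwards [(σ j).available (G.localHist j (h ++ [(c, a, x', t')]))] with d hd
      rw [G.localHist_snoc_of_mem h (r := (c, a, x', t')) hj, localLast_snoc] at hd
      exact hc j hj d hd
    · have hch : ¬ G.Chooses j (h ++ [(c, a, x', t')]) := fun h' => hj ((G.chooses_snoc _ _).1 h')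
      rw [G.choiceLaw_of_not_chooses σ hch, prevChoice_snoc, hc' j hj]

end DistIMC

namespace DecPOMDP

variable {n : ℕ} (M : DecPOMDP n)

/-- The step `r` after the history `h` leaves a target state after a non-zero time. -/
def Hit (T : Finset (Fin M.numS)) (h : List (DistIMC.Rec (n + 1))) (r : DistIMC.Rec (n + 1)) : Prop :=
  M.toDistIMC.lastState h ∈ M.targets T ∧ (lastTime h < r.2.2.2 ∨ r.2.1 = .halt)

theorem measurableSet_hit (T : Finset (Fin M.numS)) :
    MeasurableSet {p : List (DistIMC.Rec (n + 1)) × DistIMC.Rec (n + 1) | M.Hit T p.1 p.2} := by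
  refine MeasurableSet.inter ?_ (MeasurableSet.union ?_ ?_)
  · exact (M.toDistIMC.measurable_lastState.comp measurable_fst)
      (MeasurableSet.of_discrete (s := {x | x ∈ M.targets T}))
  · exact measurableSet_lt (measurable_lastTime.comp measurable_fst)
      (measurable_snd.comp (measurable_snd.comp (measurable_snd.comp measurable_snd)))
  · exact (measurable_fst.comp (measurable_snd.comp measurable_snd))
      (MeasurableSet.of_discrete (s := {Label.halt}))

/-- A play reaches the target set if and only if one of its steps is a hit. -/
theorem reach_eq (T : Finset (Fin M.numS)) :
    M.toDistIMC.reach (M.targets T) = {ρ | ∃ k, M.Hit T (firstRecords ρ k) (ρ k)} := by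
  ext ρ
  refine exists_congr fun k => ?_
  have h1 : M.toDistIMC.stateAt ρ k = M.toDistIMC.lastState (firstRecords ρ k) := by
    cases k with
    | zero => rfl
    | succ k => rw [firstRecords_succ, lastState_snoc]; rfl
  have h2 : timeAt ρ k = lastTime (firstRecords ρ k) := by
    cases k with
    | zero => rfl
    | succ k => rw [firstRecords_succ, lastTime_snoc]; rfl
  rw [h1, h2]
  rfl

variable {M}

/-- The function `f` on histories is bounded (from above or from below) by the expectation of `g`
after one step, where a hit ends the play with payoff `1`. -/
structure StepBound (b : Bool) (σ : M.toDistIMC.Profile) (δ : M.toDistIMC.Scheduler)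
    (T : Finset (Fin M.numS)) (f g : List (DistIMC.Rec (n + 1)) → ℝ≥0∞) : Prop where
  measurable : Measurable g
  le : ∀ h, Ineq b (f h) (valueStep (M.toDistIMC.stepKernel σ δ) (M.Hit T) g h)

theorem StepBound.measurable_snoc {b : Bool} {σ : M.toDistIMC.Profile} {δ : M.toDistIMC.Scheduler}
    {T : Finset (Fin M.numS)} {f g : List (DistIMC.Rec (n + 1)) → ℝ≥0∞}
    (hf : StepBound b σ δ T f g) (h : List (DistIMC.Rec (n + 1))) :
    Measurable fun r => g (h ++ [r]) :=
  hf.measurable.comp (measurable_list_snoc.comp measurable_prodMk_left)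

/-- In the global state `x`, with the choices `c`, the function `f` is bounded by the expectation of
`Φ` over the delays to come. -/
def Val (b : Bool) (σ : M.toDistIMC.Profile) (f : List (DistIMC.Rec (n + 1)) → ℝ≥0∞)
    (x : GState (n + 1)) (c : GChoice (n + 1)) (Φ : Cfg n → ℝ≥0∞) : Prop :=
  Measurable Φ ∧ ∀ h l t, M.toDistIMC.At σ h x c t l →
    Ineq b (f h) (∫⁻ D, Φ (l, t, D) ∂delayStream)

theorem Val.congr_arg {b : Bool} {σ : M.toDistIMC.Profile} {f : List (DistIMC.Rec (n + 1)) → ℝ≥0∞}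
    {x : GState (n + 1)} {c : GChoice (n + 1)} {Φ Ψ : Cfg n → ℝ≥0∞} (h : Val b σ f x c Φ)
    (hΦ : ∀ cfg, Φ cfg = Ψ cfg) : Val b σ f x c Ψ := by
  rwa [← funext hΦ]

section Rules

variable {b : Bool} {σ : M.toDistIMC.Profile} {δ : M.toDistIMC.Scheduler}
  {T : Finset (Fin M.numS)} {f g : List (DistIMC.Rec (n + 1)) → ℝ≥0∞}

/-- Outside the target set, a step pays nothing. -/
theorem valueStep_of_notMem {h : List (DistIMC.Rec (n + 1))}
    (hx : M.toDistIMC.lastState h ∉ M.targets T) :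
    valueStep (M.toDistIMC.stepKernel σ δ) (M.Hit T) g h
      = ∫⁻ r, g (h ++ [r]) ∂(M.toDistIMC.stepKernel σ δ h) := by
  refine lintegral_congr fun r => ?_
  rw [if_neg fun hh => hx hh.1]

/-- The rule for a step on the enabled action `a` outside the target set: the participants move to
the targets of their choices, and a record is appended to their local histories. -/
theorem Val.act (hf : StepBound b σ δ T f f) {x x' : GState (n + 1)} {c c' : GChoice (n + 1)}
    {a : BTree} {Φ Φ' : Cfg n → ℝ≥0∞} (hx : x ∉ M.targets T) (ha : a ∈ M.toDistIMC.Enabled c)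
    (hx1 : ∀ j, a ∈ (M.toDistIMC.mod j).acts → x' j = (c j).target (x j))
    (hx2 : ∀ j, a ∉ (M.toDistIMC.mod j).acts → x' j = x j)
    (hc1 : ∀ j, a ∈ (M.toDistIMC.mod j).acts → ∀ d, (M.toDistIMC.mod j).Available (x' j) d →
      d = c' j)
    (hc2 : ∀ j, a ∉ (M.toDistIMC.mod j).acts → c' j = c j)
    (hm : Measurable Φ') {u : (Fin n → List (LRec (n + 1))) → ℝ → Fin n → List (LRec (n + 1))}
    (hu1 : ∀ l t i, a ∈ (M.toDistIMC.mod (Fin.succ i)).acts →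
      u l t i = l i ++ [(c i.succ, .act a, x' i.succ, t)])
    (hu2 : ∀ l t i, a ∉ (M.toDistIMC.mod (Fin.succ i)).acts → u l t i = l i)
    (hΦ : ∀ l t D, Φ' (l, t, D) = Φ (u l t, t, D)) (h : Val b σ f x' c' Φ) :
    Val b σ f x c Φ' := by
  refine ⟨hm, fun h0 l t hat => ?_⟩
  have hstep := hf.le h0
  rw [valueStep_of_notMem (by rw [hat.state]; exact hx),
    M.toDistIMC.lintegral_stepKernel_of_enabled σ hat.choice
      (scheduler_apply_of_mem δ h0 ha) (hf.measurable_snoc h0)] at hstep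
  have hs : M.toDistIMC.actStep h0 c a = (.act a, x', t) := by
    unfold actStep
    rw [hat.time, hat.state]
    refine Prod.ext rfl (Prod.ext (funext fun j => ?_) rfl)
    by_cases hj : a ∈ (M.toDistIMC.mod j).acts
    · simp only [if_pos hj, hx1 j hj]
    · simp only [if_neg hj, hx2 j hj]
  rw [hs] at hstep
  refine hstep.trans ?_
  simp_rw [hΦ]
  exact h.2 _ _ _ (hat.snoc (fun j hj => hc1 j hj) (fun j hj => hc2 j hj)
    (fun i hi => hu1 l t i hi) (fun i hi => hu2 l t i hi))

/-- The delay transitions of the environment out of the state `e`. -/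
def delaysFrom (M : DecPOMDP n) (e : BTree) : Finset (BTree × ℚ≥0 × BTree) :=
  M.envDelays.toFinset.filter fun x => x.1 = e

/-- Only the environment has delay transitions. -/
theorem edges_eq (M : DecPOMDP n) (x : GState (n + 1)) :
    M.toDistIMC.edges x
      = (M.delaysFrom (x 0)).image fun e => ((0 : Fin (n + 1)), e.2.1, e.2.2) := by
  ext y
  simp only [edges, Finset.mem_biUnion, Finset.mem_univ, true_and, Finset.mem_image]
  constructor
  · rintro ⟨j, e, he, rfl⟩
    revert he
    refine Fin.cases (fun he => ?_) (fun i he => ?_) j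
    · exact ⟨e, he, rfl⟩
    · simp [playerModule, listIMC] at he
  · rintro ⟨e, he, rfl⟩
    exact ⟨0, e, he, rfl⟩

theorem sum_edges (M : DecPOMDP n) {β : Type*} [AddCommMonoid β] (x : GState (n + 1))
    (F : Fin (n + 1) × ℚ≥0 × BTree → β) :
    ∑ e ∈ M.toDistIMC.edges x, F e = ∑ e ∈ M.delaysFrom (x 0), F (0, e.2.1, e.2.2) := by
  rw [edges_eq, Finset.sum_image]
  rintro ⟨e1, e2, e3⟩ he ⟨e1', e2', e3'⟩ he' h
  simp only [delaysFrom, Finset.coe_filter, Set.mem_ofPred_eq] at he he'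
  simp only [Prod.mk.injEq, true_and] at h
  rw [he.2, he'.2, h.1, h.2]

/-- The value of a delay, as an expectation over the first delay to come. -/
theorem lintegral_delay {Φ : Cfg n → ℝ≥0∞} (hΦ : Measurable Φ)
    (l : Fin n → List (LRec (n + 1))) (t : ℝ) :
    ∫⁻ D, Φ (globalStep (l, t, D) none) ∂delayStream
      = ∫⁻ d, ∫⁻ D, Φ (l, t + d, D) ∂delayStream ∂(expMeasure 1) :=
  lintegral_delayStream_cons (F := fun D => Φ (globalStep (l, t, D) none))
    (hΦ.comp ((measurable_globalStep none).comp
      (measurable_const.prodMk (measurable_const.prodMk measurable_id))))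

/-- The rule for a delay outside the target set. All delay transitions belong to the environment, so
no other player learns of the step, and the waiting time is the first of the delays to come. -/
theorem Val.delay (hf : StepBound b σ δ T f f) {x : GState (n + 1)} {c : GChoice (n + 1)}
    {Φ : BTree → Cfg n → ℝ≥0∞} (hx : x ∉ M.targets T) (hc : M.toDistIMC.Enabled c = ∅)
    (hsum : ∑ e ∈ M.delaysFrom (x 0), (e.2.1 : ℝ) = 1)
    (h : ∀ e ∈ M.delaysFrom (x 0),
      Val b σ f (Function.update x 0 e.2.2) (Fin.cons (M.envChoice e.2.2) (Fin.tail c)) (Φ e.2.2)) :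
    Val b σ f x c fun cfg => ∑ e ∈ M.delaysFrom (x 0), ENNReal.ofReal (e.2.1 : ℝ) *
      Φ e.2.2 (globalStep cfg none) := by
  have hm : ∀ e ∈ M.delaysFrom (x 0), Measurable fun cfg => Φ e.2.2 (globalStep cfg none) :=
    fun e he => (h e he).1.comp (measurable_globalStep none)
  refine ⟨Finset.measurable_sum _ fun e he => (hm e he).const_mul _, fun h0 l t hat => ?_⟩
  have hstep := hf.le h0
  rw [valueStep_of_notMem (by rw [hat.state]; exact hx),
    M.toDistIMC.lintegral_stepKernel_of_disabled σ
      (by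
        rw [M.toDistIMC.choiceKernel_eq_dirac σ hat.choice, ae_dirac_eq, Filter.eventually_pure]
        exact scheduler_apply_of_empty δ h0 hc) (hf.measurable_snoc h0),
    M.toDistIMC.choiceKernel_eq_dirac σ hat.choice, lintegral_dirac, hat.state, hat.time,
    M.toDistIMC.lintegral_raceLaw (by rw [M.sum_edges x fun e => (e.2.1 : ℝ)]; exact hsum)
      (F := fun y => f (h0 ++ [(c, y.1, y.2.1, t + y.2.2)]))
      ((hf.measurable_snoc h0).comp (by fun_prop)), M.sum_edges] at hstep
  refine hstep.trans ?_
  have hme : ∀ e ∈ M.delaysFrom (x 0),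
      Measurable fun D : ℕ → ℝ => Φ e.2.2 (globalStep (l, t, D) none) := fun e he =>
    (hm e he).comp (measurable_const.prodMk (measurable_const.prodMk measurable_id))
  have hswap := lintegral_finsetSum' (μ := delayStream)
    (f := fun (e : BTree × ℚ≥0 × BTree) (D : ℕ → ℝ) =>
      ENNReal.ofReal (e.2.1 : ℝ) * Φ e.2.2 (globalStep (l, t, D) none))
    (M.delaysFrom (x 0)) fun e he => ((hme e he).const_mul _).aemeasurable
  refine Ineq.trans ?_ (Ineq.of_eq hswap.symm)
  refine Ineq.sum fun e he => ?_
  rw [lintegral_const_mul _ (hme e he), lintegral_delay (h e he).1]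
  refine (Ineq.lintegral fun d => ?_).mul_left _
  refine (h e he).2 _ _ _ (hat.snoc ?_ ?_ ?_ ?_)
  · intro j hj d hd
    obtain rfl : j = 0 := hj
    simp only [Function.update_self] at hd
    exact eq_envChoice hd
  · intro j hj
    revert hj
    refine Fin.cases (fun hj => absurd rfl hj) (fun i _ => rfl) j
  · intro i hi
    exact absurd hi (Fin.succ_ne_zero i)
  · intro i _; rfl

end Rules

end DecPOMDP

/-! ### Delays of the environment -/

namespace DecPOMDP

variable {n : ℕ} {M : DecPOMDP n}

theorem mem_delaysFrom {e : BTree} {x : BTree × ℚ≥0 × BTree} :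
    x ∈ M.delaysFrom e ↔ x ∈ M.envDelays ∧ x.1 = e := by
  simp [delaysFrom]

theorem delaysFrom_stCheck (s : Fin M.numS) :
    M.delaysFrom (stCheck (ofFin s)) = {(stCheck (ofFin s), 1, stReady (ofFin s))} := by
  ext x
  rw [mem_delaysFrom, Finset.mem_singleton]
  constructor
  · rintro ⟨hx, h⟩
    rcases mem_envDelays.1 hx with ⟨s, rfl⟩ | ⟨s, a, i, k, r, hr, rfl⟩ | ⟨s, a, s', hP, rfl⟩ |
      ⟨s, a, s', o, hO, rfl⟩ | ⟨s, o, z, hz, rfl⟩ <;>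
    simp only [stCheck, stPoll, stObs, stTell, tag, cons.injEq, reduceCtorEq, true_and,
      false_and] at h
    rw [h]
  · rintro rfl
    exact ⟨mem_envDelays.2 (Or.inl ⟨s, rfl⟩), rfl⟩

theorem delaysFrom_stPoll_cons (s : Fin M.numS) (a : M.GAct) (i : Fin n) {k r : BTree}
    (hr : cons k r ∈ (ofRange (M.numAct i)).suffixes) :
    M.delaysFrom (stPoll (ofFin s) (revT (fun i => ofFin (a i)) i)
        (cons (cons k r) (M.actSets (i + 1))))
      = {(stPoll (ofFin s) (revT (fun i => ofFin (a i)) i) (cons (cons k r) (M.actSets (i + 1))), 1,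
          stPoll (ofFin s) (cons k (revT (fun i => ofFin (a i)) i)) (M.actSets (i + 1)))} := by
  ext x
  rw [mem_delaysFrom, Finset.mem_singleton]
  constructor
  · rintro ⟨hx, h⟩
    rcases mem_envDelays.1 hx with ⟨s, rfl⟩ | ⟨s, a, i, k, r, hr, rfl⟩ | ⟨s, a, s', hP, rfl⟩ |
      ⟨s, a, s', o, hO, rfl⟩ | ⟨s, o, z, hz, rfl⟩ <;>
    simp only [stCheck, stPoll, stObs, stTell, tag, cons.injEq, reduceCtorEq, true_and, false_and,
      and_false] at h
    obtain ⟨h1, h2, ⟨h3, h4⟩, h5⟩ := h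
    rw [h1, h2, h3, h4, h5]
  · rintro rfl
    exact ⟨mem_envDelays.2 (Or.inr (Or.inl ⟨s, a, i, k, r, hr, rfl⟩)), rfl⟩

theorem delaysFrom_stPoll_nil (s : Fin M.numS) (a : M.GAct) :
    M.delaysFrom (stPoll (ofFin s) (revT (fun i => ofFin (a i)) n) nil)
      = (Finset.univ.filter fun s' => M.P s a s' ≠ 0).image fun s' =>
        (stPoll (ofFin s) (revT (fun i => ofFin (a i)) n) nil, M.P s a s',
          stObs (ofFin s) (ofTuple a) (ofFin s')) := by
  ext x
  simp only [mem_delaysFrom, Finset.mem_image, Finset.mem_filter, Finset.mem_univ, true_and]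
  constructor
  · rintro ⟨hx, h⟩
    rcases mem_envDelays.1 hx with ⟨s, rfl⟩ | ⟨s, a, i, k, r, hr, rfl⟩ | ⟨s, a, s', hP, rfl⟩ |
      ⟨s, a, s', o, hO, rfl⟩ | ⟨s, o, z, hz, rfl⟩ <;>
    simp only [stCheck, stPoll, stObs, stTell, tag, cons.injEq, reduceCtorEq, true_and, false_and,
      and_false, and_true] at h
    obtain ⟨h1, h2⟩ := h
    obtain rfl := ofFin_injective h1
    obtain rfl : a = _ := funext fun i => ofFin_injective (congrFun (revT_injective h2) i)
    exact ⟨s', hP, rfl⟩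
  · rintro ⟨s', hP, rfl⟩
    exact ⟨mem_envDelays.2 (Or.inr (Or.inr (Or.inl ⟨s, a, s', hP, rfl⟩))), rfl⟩

theorem delaysFrom_stObs (s : Fin M.numS) (a : M.GAct) (s' : Fin M.numS) :
    M.delaysFrom (stObs (ofFin s) (ofTuple a) (ofFin s'))
      = (Finset.univ.filter fun o => M.O s a s' o ≠ 0).image fun o =>
        (stObs (ofFin s) (ofTuple a) (ofFin s'), M.O s a s' o,
          stTell (ofFin s') (ofTuple o) (M.obsScript o)) := by
  ext x
  simp only [mem_delaysFrom, Finset.mem_image, Finset.mem_filter, Finset.mem_univ, true_and]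
  constructor
  · rintro ⟨hx, h⟩
    rcases mem_envDelays.1 hx with ⟨s, rfl⟩ | ⟨s, a, i, k, r, hr, rfl⟩ | ⟨s, a, s', hP, rfl⟩ |
      ⟨s, a, s', o, hO, rfl⟩ | ⟨s, o, z, hz, rfl⟩ <;>
    simp only [stCheck, stPoll, stObs, stTell, tag, cons.injEq, reduceCtorEq, true_and, false_and,
      and_false] at h
    obtain ⟨h1, h2, h3⟩ := h
    obtain rfl := ofFin_injective h1
    obtain rfl := ofTuple_injective h2
    obtain rfl := ofFin_injective h3
    exact ⟨o, hO, rfl⟩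
  · rintro ⟨o, hO, rfl⟩
    exact ⟨mem_envDelays.2 (Or.inr (Or.inr (Or.inr (Or.inl ⟨s, a, s', o, hO, rfl⟩)))), rfl⟩

theorem delaysFrom_stTell (s : Fin M.numS) (o : M.GObs) {z : BTree}
    (hz : cons nil z ∈ (M.obsScript o).suffixes) :
    M.delaysFrom (stTell (ofFin s) (ofTuple o) (cons nil z))
      = {(stTell (ofFin s) (ofTuple o) (cons nil z), 1, stTell (ofFin s) (ofTuple o) z)} := by
  ext x
  rw [mem_delaysFrom, Finset.mem_singleton]
  constructor
  · rintro ⟨hx, h⟩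
    rcases mem_envDelays.1 hx with ⟨s, rfl⟩ | ⟨s, a, i, k, r, hr, rfl⟩ | ⟨s, a, s', hP, rfl⟩ |
      ⟨s, a, s', o, hO, rfl⟩ | ⟨s, o, z, hz, rfl⟩ <;>
    simp only [stCheck, stPoll, stObs, stTell, tag, cons.injEq, reduceCtorEq, true_and, false_and,
      and_false] at h
    obtain ⟨⟨h1, h2⟩, h3⟩ := h
    rw [h1, h2, h3]
  · rintro rfl
    exact ⟨mem_envDelays.2 (Or.inr (Or.inr (Or.inr (Or.inr ⟨s, o, z, hz, rfl⟩)))), rfl⟩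

/-! ### Rules for the states of a round -/

theorem gState_notMem_targets {T : Finset (Fin M.numS)} {e : BTree} (he : e.hd ≠ tag 0)
    (r q : Fin n → BTree) : gState e r q ∉ M.targets T := by
  intro h
  obtain ⟨s, -, hs⟩ := Finset.mem_image.1 h
  have := congrFun hs 0
  simp only [startState, gState, Fin.cons_zero] at this
  rw [← this] at he
  exact he rfl

theorem choices_zero (e : BTree) (r q : Fin n → BTree) : M.choices e r q 0 = M.envChoice e := rfl

theorem choices_succ (e : BTree) (r q : Fin n → BTree) (i : Fin n) :
    M.choices e r q i.succ = M.playerChoice i (r i) (q i) := rfl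

section Rules

variable {b : Bool} {σ : M.toDistIMC.Profile} {δ : M.toDistIMC.Scheduler}
  {T : Finset (Fin M.numS)} {f : List (DistIMC.Rec (n + 1)) → ℝ≥0∞}

/-- A step on an action in which only the environment and player `i` take part. -/
theorem Val.single (hf : StepBound b σ δ T f f) {e a e' : BTree} (he : e.hd ≠ tag 0)
    (htr : (e, a, e') ∈ M.envTrans) {i : Fin n} (ha : ∀ j, a ∈ (M.playerModule j).acts ↔ j = i)
    {r q : Fin n → BTree} {r' q' : BTree}
    (hi : M.playerChoice i (r i) (q i) = .trans (cons (r i) (q i), a, cons r' q'))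
    (hL : M.Legal (Function.update r i r') (Function.update q i q')) {Φ : Cfg n → ℝ≥0∞}
    (h : Val b σ f (gState e' (Function.update r i r') (Function.update q i q'))
      (M.choices e' (Function.update r i r') (Function.update q i q')) Φ) :
    Val b σ f (gState e r q) (M.choices e r q) fun cfg =>
      Φ (globalStep cfg (some (i, M.playerChoice i (r i) (q i), .act a, cons r' q'))) := by
  have henv : M.envChoice e = .trans (e, a, e') := envChoice_of_mem htr
  have ha0 : a ∈ M.envModule.acts := (M.envModule.trans_mem _ (mem_trans_envModule.2 htr)).2.1
  refine Val.act hf (a := a) (gState_notMem_targets he r q) ⟨⟨0, ha0⟩, ?_⟩ ?_ ?_ ?_ ?_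
    (h.1.comp (measurable_globalStep _))
    (u := fun l t => Function.update l i
      (l i ++ [(M.playerChoice i (r i) (q i), .act a, cons r' q', t)])) ?_ ?_ ?_ h
  · intro j
    refine Fin.cases (fun _ => ?_) (fun k hk => ?_) j
    · rw [choices_zero, henv]; rfl
    · obtain rfl := (ha k).1 hk
      rw [choices_succ, hi]; rfl
  · intro j
    refine Fin.cases (fun _ => ?_) (fun k hk => ?_) j
    · rw [choices_zero, henv]; rfl
    · obtain rfl := (ha k).1 hk
      rw [choices_succ, hi]
      simp [gState, Choice.target]
  · intro j
    refine Fin.cases (fun h0 => absurd ha0 h0) (fun k hk => ?_) j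
    have hk : k ≠ i := fun hki => hk ((ha k).2 hki)
    simp [gState, hk]
  · intro j _ d hd
    exact eq_choices hL j hd
  · intro j
    refine Fin.cases (fun h0 => absurd ha0 h0) (fun k hk => ?_) j
    have hk : k ≠ i := fun hki => hk ((ha k).2 hki)
    simp [choices_succ, hk]
  · intro l t k hk
    obtain rfl := (ha k).1 hk
    simp [choices_succ, gState]
  · intro l t k hk
    have hk : k ≠ i := fun hki => hk ((ha k).2 hki)
    simp [hk]
  · intro l t D; rfl

/-- A delay of the environment with random target. -/
theorem Val.branch (hf : StepBound b σ δ T f f) {ι : Type*} [Fintype ι] {e : BTree} {w : ι → ℚ≥0}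
    {e' : ι → BTree} (he : e.hd ≠ tag 0) {r q : Fin n → BTree}
    (hdis : ∀ a e', (e, a, e') ∈ M.envTrans →
      ∃ i, a ∈ (M.playerModule i).acts ∧ ¬ (M.playerChoice i (r i) (q i)).HasLabel a)
    (hinj : Function.Injective e') (hw : ∑ i, w i = 1)
    (hd : M.delaysFrom e = (Finset.univ.filter fun i => w i ≠ 0).image fun i => (e, w i, e' i))
    {Φ : ι → Cfg n → ℝ≥0∞}
    (h : ∀ i, Val b σ f (gState (e' i) r q) (M.choices (e' i) r q) (Φ i)) :
    Val b σ f (gState e r q) (M.choices e r q) fun cfg =>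
      ∑ i, ((w i : NNReal) : ℝ≥0∞) * Φ i (globalStep cfg none) := by
  classical
  have hsum : ∀ {β : Type} [AddCommMonoid β] (F : BTree × ℚ≥0 × BTree → β),
      (∀ i, w i = 0 → F (e, w i, e' i) = 0) →
      ∑ x ∈ M.delaysFrom e, F x = ∑ i, F (e, w i, e' i) := by
    intro β _ F hF
    rw [hd, Finset.sum_image fun i _ j _ hij => hinj (by simpa using (Prod.ext_iff.1
      (Prod.ext_iff.1 hij).2).2), Finset.sum_filter]
    refine Finset.sum_congr rfl fun i _ => ?_
    by_cases hi : w i = 0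
    · rw [if_neg (not_not.2 hi), hF i hi]
    · rw [if_pos hi]
  have key := Val.delay hf (x := gState e r q) (c := M.choices e r q)
    (Φ := Function.extend e' Φ fun _ => 0) (gState_notMem_targets he r q) ?_ ?_ ?_
  · convert key using 2 with cfg
    change _ = ∑ x ∈ M.delaysFrom e, _
    rw [hsum fun x : BTree × ℚ≥0 × BTree => ENNReal.ofReal (x.2.1 : ℝ) *
      Function.extend e' Φ (fun _ => 0) x.2.2 (globalStep cfg none)]
    · refine Finset.sum_congr rfl fun i _ => ?_
      rw [hinj.extend_apply]
      congr 1
      exact (ENNReal.ofReal_coe_nnreal (p := (w i : NNReal))).symm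
    · intro i hi
      simp [hi]
  · refine Set.eq_empty_of_forall_notMem fun a ha => ?_
    obtain ⟨⟨j, hj⟩, ha⟩ := ha
    have h0 := ha 0 (M.acts_subset j hj)
    rw [choices_zero] at h0
    cases hc : M.envChoice e with
    | bot => rw [hc] at h0; exact h0
    | trans x =>
      rw [hc] at h0
      have hx : x ∈ M.envTrans ∧ x.1 = e := by
        unfold envChoice at hc
        split_ifs at hc with hex
        injection hc with hc
        rw [← hc]
        exact hex.choose_spec
      obtain ⟨x1, x2, x3⟩ := x
      obtain rfl : x2 = a := h0
      obtain rfl : x1 = e := hx.2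
      obtain ⟨i, hi, hne⟩ := hdis _ _ hx.1
      exact hne (ha i.succ hi)
  · change ∑ x ∈ M.delaysFrom e, (x.2.1 : ℝ) = 1
    rw [hsum (fun x => (x.2.1 : ℝ)) fun i hi => by simp [hi]]
    exact_mod_cast hw
  · intro x hx
    change x ∈ M.delaysFrom e at hx
    rw [hd] at hx
    obtain ⟨i, -, rfl⟩ := Finset.mem_image.1 hx
    dsimp only
    rw [hinj.extend_apply]
    convert h i using 1
    · funext j
      refine Fin.cases ?_ (fun k => ?_) j <;> simp [gState]
    · rfl

/-- A delay of the environment with fixed target. -/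
theorem Val.pause (hf : StepBound b σ δ T f f) {e e' : BTree} (he : e.hd ≠ tag 0)
    {r q : Fin n → BTree}
    (hdis : ∀ a e', (e, a, e') ∈ M.envTrans →
      ∃ i, a ∈ (M.playerModule i).acts ∧ ¬ (M.playerChoice i (r i) (q i)).HasLabel a)
    (hd : M.delaysFrom e = {(e, 1, e')}) {Φ : Cfg n → ℝ≥0∞}
    (h : Val b σ f (gState e' r q) (M.choices e' r q) Φ) :
    Val b σ f (gState e r q) (M.choices e r q) fun cfg => Φ (globalStep cfg none) := by
  have := Val.branch hf (ι := Unit) (w := fun _ => 1) (e' := fun _ => e') he hdis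
    (fun _ _ _ => rfl) (by simp) (by rw [hd]; rfl) (Φ := fun _ => Φ) fun _ => h
  simpa using this

end Rules

end DecPOMDP

namespace DecPOMDP

variable {n : ℕ} (M : DecPOMDP n)

/-! ### Events of a round -/

/-- The rejections by player `i` while it moves down the list `r`. -/
def pollEvents (i : Fin n) : BTree → List (Event n)
  | nil => []
  | cons x r => some (i, M.playerChoice i (cons x r) (ofRange (M.numObs i)),
      .act (lNext (M.actSets (i + 1))), cons r (ofRange (M.numObs i))) :: pollEvents i r

/-- The ticks received by player `i` while it moves down the list `K`, and the pause after the tick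
for the observation `x`. -/
def tellEvents (i : Fin n) (x : BTree) : BTree → List (Event n)
  | nil => []
  | cons k K => some (i, M.playerChoice i nil (cons k K),
      .act (lTick (M.obsSets (i + 1))), cons nil K) ::
        if sameBits k x then none :: tellEvents i x K else tellEvents i x K

/-- The list of rejections that stands for the action with index `j`. -/
def rejections (i : Fin n) (j : ℕ) : BTree :=
  dropT (ofFin : Fin (M.numAct i) → BTree) (M.numAct i - j)

/-- The choice of player `i` that stands for the action `a`. -/
def choiceOf (i : Fin n) (a : Fin (M.numAct i)) : Choice :=
  .trans (nil, lGo, cons (M.rejections i a) (ofRange (M.numObs i)))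

/-- The lists of rejections of the players from the index `k` on. -/
def restPoll (a : M.GAct) (k : ℕ) (i : Fin n) : BTree :=
  if (i : ℕ) < k then nil else M.rejections i (a i)

/-- The lists of ticks of the players from the index `k` on. -/
def restTell (k : ℕ) (i : Fin n) : BTree := if (i : ℕ) < k then nil else ofRange (M.numObs i)

/-- The events by which the environment learns the actions of the players from the index `k` on. -/
def pollFrom (a : M.GAct) (k : ℕ) : List (Event n) :=
  ((List.finRange n).drop k).flatMap fun i => M.pollEvents i (M.rejections i (a i)) ++ [none]

/-- The events by which the players from the index `k` on are informed. -/
def tellFrom (o : M.GObs) (k : ℕ) : List (Event n) :=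
  ((List.finRange n).drop k).flatMap fun i =>
    M.tellEvents i (ofFin (o i)) (ofRange (M.numObs i))

/-- The events of a round with global action `a` and global observation `o`. -/
def roundEvents (a : M.GAct) (o : M.GObs) : List (Event n) :=
  [none] ++ (allEvents (fun i => M.choiceOf i (a i)) (.act lGo)
    (fun i => cons (M.rejections i (a i)) (ofRange (M.numObs i))) ++ (M.pollFrom a 0 ++ ([none] ++
    ([none] ++ (M.tellFrom o 0 ++ allEvents (fun i => M.playerChoice i nil nil) (.act lGo)
      fun _ => nil)))))

variable {M}

theorem pollFrom_of_lt (a : M.GAct) {k : ℕ} (h : k < n) : M.pollFrom a k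
    = M.pollEvents ⟨k, h⟩ (M.rejections ⟨k, h⟩ (a ⟨k, h⟩)) ++ [none] ++ M.pollFrom a (k + 1) := by
  unfold pollFrom
  have hk : (List.finRange n)[k]'(by simpa using h) = ⟨k, h⟩ := by simp
  rw [List.drop_eq_getElem_cons (by simpa using h), List.flatMap_cons, hk]

theorem pollFrom_of_le (a : M.GAct) {k : ℕ} (h : n ≤ k) : M.pollFrom a k = [] := by
  unfold pollFrom
  rw [List.drop_eq_nil_of_le (by simpa using h)]
  rfl

theorem tellFrom_of_lt (o : M.GObs) {k : ℕ} (h : k < n) : M.tellFrom o k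
    = M.tellEvents ⟨k, h⟩ (ofFin (o ⟨k, h⟩)) (ofRange (M.numObs ⟨k, h⟩)) ++ M.tellFrom o (k + 1) := by
  unfold tellFrom
  have hk : (List.finRange n)[k]'(by simpa using h) = ⟨k, h⟩ := by simp
  rw [List.drop_eq_getElem_cons (by simpa using h), List.flatMap_cons, hk]

theorem tellFrom_of_le (o : M.GObs) {k : ℕ} (h : n ≤ k) : M.tellFrom o k = [] := by
  unfold tellFrom
  rw [List.drop_eq_nil_of_le (by simpa using h)]
  rfl

theorem ofRange_eq (k : ℕ) : ofRange k = dropT (ofFin : Fin k → BTree) 0 := rfl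

theorem dropT_mem_suffixes {m : ℕ} (x : Fin m → BTree) {k l : ℕ} (h : k ≤ l) :
    dropT x l ∈ (dropT x k).suffixes := by
  induction l, h using Nat.le_induction with
  | base => exact self_mem_suffixes _
  | succ l _ ih =>
    by_cases hl : l < m
    · rw [dropT_of_lt x hl] at ih
      exact mem_suffixes_of_cons_mem ih
    · rw [dropT_of_le x (by omega : m ≤ l + 1)]
      exact nil_mem_suffixes _

theorem tl_dropT {m : ℕ} (x : Fin m → BTree) (k : ℕ) : (dropT x k).tl = dropT x (k + 1) := by
  by_cases h : k < m
  · rw [dropT_of_lt x h]; rfl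
  · rw [dropT_of_le x (by omega), dropT_of_le x (by omega)]; rfl

theorem mem_suffixes_dropT {m : ℕ} {x : Fin m → BTree} {y : BTree} {k : ℕ}
    (h : y ∈ (dropT x k).suffixes) : ∃ l, k ≤ l ∧ (l ≤ m ∨ l = k) ∧ y = dropT x l := by
  have key : ∀ j k, j + k = m → y ∈ (dropT x k).suffixes →
      ∃ l, k ≤ l ∧ (l ≤ m ∨ l = k) ∧ y = dropT x l := by
    intro j
    induction j with
    | zero =>
      intro k hk h
      rw [dropT_of_le x (by omega)] at h
      exact ⟨k, le_rfl, Or.inr rfl, by rw [dropT_of_le x (by omega)]; simpa [suffixes] using h⟩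
    | succ j ih =>
      intro k hk h
      rw [dropT_of_lt x (by omega : k < m)] at h
      rcases List.mem_cons.1 h with rfl | h
      · exact ⟨k, le_rfl, Or.inr rfl, (dropT_of_lt x (by omega : k < m)).symm⟩
      · obtain ⟨l, hl, hl', rfl⟩ := ih (k + 1) (by omega) h
        exact ⟨l, by omega, by omega, rfl⟩
  by_cases hk : k ≤ m
  · exact key (m - k) k (by omega) h
  · rw [dropT_of_le x (by omega)] at h
    exact ⟨k, le_rfl, Or.inr rfl, by rw [dropT_of_le x (by omega)]; simpa [suffixes] using h⟩

theorem rejections_mem {i : Fin n} {j : ℕ} (hj : j < M.numAct i) :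
    M.rejections i j ∈ (ofRange (M.numAct i)).tl.suffixes := by
  rw [ofRange_eq, tl_dropT]
  exact dropT_mem_suffixes _ (by omega)

theorem rejections_zero (i : Fin n) : M.rejections i 0 = nil := dropT_of_le _ (by simp)

theorem rejections_succ {i : Fin n} {j : ℕ} (hj : j < M.numAct i) :
    ∃ x, M.rejections i (j + 1) = cons x (M.rejections i j) := by
  unfold rejections
  rw [dropT_of_lt _ (by omega : M.numAct i - (j + 1) < M.numAct i),
    show M.numAct i - (j + 1) + 1 = M.numAct i - j by omega]
  exact ⟨_, rfl⟩

theorem len_rejections {i : Fin n} {j : ℕ} (hj : j < M.numAct i) :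
    (M.rejections i j).len = j := by
  rw [rejections, len_dropT]; omega

theorem choiceOf_injective (i : Fin n) : Function.Injective (M.choiceOf i) := by
  intro a a' h
  simp only [choiceOf, Choice.trans.injEq, Prod.mk.injEq, cons.injEq, true_and, and_true] at h
  have h := congrArg len h
  rw [len_rejections a.2, len_rejections a'.2] at h
  exact Fin.ext h

/-- In the state `nil`, the available choices stand for the actions of the DEC-POMDP. -/
theorem available_nil {i : Fin n} {d : Choice} :
    (M.playerModule i).Available nil d ↔ ∃ a, d = M.choiceOf i a := by
  cases d with
  | bot =>
    refine ⟨fun h => ?_, fun ⟨a, h⟩ => by simp [choiceOf] at h⟩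
    have h : ∀ e ∈ (M.playerModule i).trans, e.1 ≠ nil := h
    exact absurd rfl (h _ (mem_trans_playerModule.2 (mem_playerTrans.2 (Or.inl
      ⟨_, self_mem_suffixes _, rfl⟩))))
  | trans e =>
    change (e ∈ (M.playerModule i).trans ∧ e.1 = nil) ↔ _
    rw [mem_trans_playerModule, mem_playerTrans]
    constructor
    · rintro ⟨⟨r, hr, rfl⟩ | ⟨x, r, -, rfl⟩ | ⟨x, r, -, rfl⟩ | rfl, h⟩
      · rw [ofRange_eq, tl_dropT] at hr
        obtain ⟨l, hl, hl', rfl⟩ := mem_suffixes_dropT hr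
        have := M.numAct_pos i
        refine ⟨⟨M.numAct i - l, by omega⟩, ?_⟩
        rw [choiceOf, rejections]
        dsimp only
        rw [show M.numAct i - (M.numAct i - l) = l by omega]
      all_goals simp at h
    · rintro ⟨a, h⟩
      rw [choiceOf, Choice.trans.injEq] at h
      subst h
      exact ⟨Or.inl ⟨_, rejections_mem a.2, rfl⟩, rfl⟩

theorem legal_restPoll (a : M.GAct) (k : ℕ) :
    M.Legal (M.restPoll a k) fun i => ofRange (M.numObs i) where
  mem_left i := by
    unfold restPoll
    split_ifs
    · exact nil_mem_suffixes _
    · exact rejections_mem (a i).2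
  mem_right i := self_mem_suffixes _
  full _ _ := rfl

theorem legal_nil {q : Fin n → BTree} (h : ∀ i, q i ∈ (ofRange (M.numObs i)).suffixes) :
    M.Legal (fun _ => nil) q where
  mem_left _ := nil_mem_suffixes _
  mem_right := h
  full _ hi := absurd rfl hi

theorem suffix_of_tellOne {v x K z S : BTree} (h : tellOne v x K z ∈ S.suffixes) :
    z ∈ S.suffixes := by
  induction K with
  | nil => exact h
  | cons k K _ ih =>
    rw [tellOne] at h
    split_ifs at h
    · exact ih (mem_suffixes_of_cons_mem (mem_suffixes_of_cons_mem h))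
    · exact ih (mem_suffixes_of_cons_mem h)

/-! ### The phases of a round -/

section Rules

variable {b : Bool} {σ : M.toDistIMC.Profile} {δ : M.toDistIMC.Scheduler}
  {T : Finset (Fin M.numS)} {f : List (DistIMC.Rec (n + 1)) → ℝ≥0∞}

theorem stPoll_hd (s acc todo : BTree) : (stPoll s acc todo).hd ≠ tag 0 := by
  simp [stPoll, hd, tag]

theorem stObs_hd (s a s' : BTree) : (stObs s a s').hd ≠ tag 0 := by simp [stObs, hd, tag]

theorem stTell_hd (s o z : BTree) : (stTell s o z).hd ≠ tag 0 := by simp [stTell, hd, tag]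

/-- The environment learns the action of player `i`, of which `k` rejections have been seen and `j`
are to come. -/
theorem Val.poll (hf : StepBound b σ δ T f f) (s : Fin M.numS) (a : M.GAct) (i : Fin n)
    {Φ : Cfg n → ℝ≥0∞} : ∀ (j k : ℕ) (r : Fin n → BTree), k + j = a i →
    M.Legal r (fun i => ofRange (M.numObs i)) → r i = M.rejections i j →
    Val b σ f
      (gState (stPoll (ofFin s) (revT (fun i => ofFin (a i)) (i + 1)) (M.actSets (i + 1)))
        (Function.update r i nil) fun i => ofRange (M.numObs i))
      (M.choices (stPoll (ofFin s) (revT (fun i => ofFin (a i)) (i + 1)) (M.actSets (i + 1)))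
        (Function.update r i nil) fun i => ofRange (M.numObs i)) Φ →
    Val b σ f
      (gState (stPoll (ofFin s) (revT (fun i => ofFin (a i)) i)
        (cons (dropT (ofFin : Fin (M.numAct i) → BTree) k) (M.actSets (i + 1)))) r
        fun i => ofRange (M.numObs i))
      (M.choices (stPoll (ofFin s) (revT (fun i => ofFin (a i)) i)
        (cons (dropT (ofFin : Fin (M.numAct i) → BTree) k) (M.actSets (i + 1)))) r
        fun i => ofRange (M.numObs i))
      fun cfg => Φ (run (M.pollEvents i (r i) ++ [none]) cfg)
  | 0, k, r, hk, hL, hr, h => by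
    rw [rejections_zero] at hr
    obtain rfl : k = a i := hk
    have hs : dropT (ofFin : Fin (M.numAct i) → BTree) (a i)
        = cons (ofFin (a i)) (dropT ofFin (a i + 1)) := dropT_of_lt _ (a i).2
    have hmem : cons (ofFin (a i)) (dropT (ofFin : Fin (M.numAct i) → BTree) (a i + 1))
        ∈ (ofRange (M.numAct i)).suffixes := hs ▸ dropT_mem_suffixes _ (Nat.zero_le _)
    rw [← hr, Function.update_eq_self, revT_succ _ i.2] at h
    rw [hs, hr]
    refine Val.pause hf (stPoll_hd _ _ _) ?_ (delaysFrom_stPoll_cons s a i hmem) h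
    intro l e' hl
    refine ⟨i, ?_⟩
    have hlab : l = lNext (M.actSets (i + 1)) := by
      rcases mem_envTrans.1 hl with ⟨s, he⟩ | ⟨s, a, i, k, k', r, hr, he⟩ | ⟨s, o, he⟩ |
        ⟨s, o, v, z, hv, hz, he⟩ <;>
      simp only [stReady, stPoll, stTell, tag, Prod.mk.injEq, cons.injEq, reduceCtorEq, true_and,
        false_and, and_false] at he
      rw [he.2.1, he.1.2.2.2]
    subst hlab
    refine ⟨lNext_mem_acts.2 rfl, ?_⟩
    rw [hr]
    cases ofRange (M.numObs i) with
    | nil => exact lGo_ne_lNext _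
    | cons y q => exact (lNext_ne_lTick _ _).symm
  | j + 1, k, r, hk, hL, hr, h => by
    have hj : j < M.numAct i := by have := (a i).2; omega
    have hk1 : k + 1 < M.numAct i := by have := (a i).2; omega
    obtain ⟨x, hx⟩ := M.rejections_succ (i := i) hj
    have hs : dropT (ofFin : Fin (M.numAct i) → BTree) k
        = cons (ofFin (⟨k, by omega⟩ : Fin (M.numAct i)))
          (cons (ofFin (⟨k + 1, hk1⟩ : Fin (M.numAct i))) (dropT (ofFin : Fin (M.numAct i) → BTree) (k + 1 + 1))) := by
      rw [dropT_of_lt _ (by omega : k < M.numAct i), dropT_of_lt _ hk1]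
    have hs' : dropT (ofFin : Fin (M.numAct i) → BTree) (k + 1)
        = cons (ofFin (⟨k + 1, hk1⟩ : Fin (M.numAct i))) (dropT (ofFin : Fin (M.numAct i) → BTree) (k + 1 + 1)) :=
      dropT_of_lt _ hk1
    have hmem := dropT_mem_suffixes (ofFin : Fin (M.numAct i) → BTree) (Nat.zero_le k)
    rw [hs] at hmem
    have hL' : M.Legal (Function.update r i (M.rejections i j)) fun i => ofRange (M.numObs i) := by
      refine ⟨fun i' => ?_, hL.mem_right, fun _ _ => rfl⟩
      by_cases hi : i' = i
      · subst hi; rw [Function.update_self]; exact rejections_mem hj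
      · rw [Function.update_of_ne hi]; exact hL.mem_left i'
    have ih := Val.poll hf s a i (Φ := Φ) j (k + 1) (Function.update r i (M.rejections i j))
      (by omega) hL' (Function.update_self ..) (by rwa [Function.update_idem])
    have := Val.single hf (stPoll_hd _ _ _)
      (mem_envTrans.2 (Or.inr (Or.inl ⟨s, a, i, _, _, _, hmem, rfl⟩))) (i := i)
      (fun _ => lNext_mem_acts) (r := r) (q := fun i => ofRange (M.numObs i))
      (r' := M.rejections i j) (q' := ofRange (M.numObs i)) (by rw [hr, hx]; rfl)
      (by rwa [Function.update_eq_self]) (by rw [Function.update_eq_self, ← hs']; exact ih)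
    rw [← hs] at this
    refine this.congr_arg ?_
    intro cfg
    rw [Function.update_self, hr, hx]
    rfl

end Rules

end DecPOMDP

namespace DecPOMDP

variable {n : ℕ} {M : DecPOMDP n}

section Rules

variable {b : Bool} {σ : M.toDistIMC.Profile} {δ : M.toDistIMC.Scheduler}
  {T : Finset (Fin M.numS)} {f : List (DistIMC.Rec (n + 1)) → ℝ≥0∞}

theorem update_restPoll (a : M.GAct) {k : ℕ} (h : k < n) :
    Function.update (M.restPoll a k) ⟨k, h⟩ nil = M.restPoll a (k + 1) := by
  funext i
  by_cases hi : i = ⟨k, h⟩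
  · subst hi; simp [restPoll]
  · have : (i : ℕ) ≠ k := fun h' => hi (Fin.ext h')
    rw [Function.update_of_ne hi]
    unfold restPoll
    congr 1
    exact propext (by omega)

theorem update_restTell {k : ℕ} (h : k < n) :
    Function.update (M.restTell k) ⟨k, h⟩ nil = M.restTell (k + 1) := by
  funext i
  by_cases hi : i = ⟨k, h⟩
  · subst hi; simp [restTell]
  · have : (i : ℕ) ≠ k := fun h' => hi (Fin.ext h')
    rw [Function.update_of_ne hi]
    unfold restTell
    congr 1
    exact propext (by omega)

/-- The environment learns the actions of the players from the index `k` on. -/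
theorem Val.pollFrom (hf : StepBound b σ δ T f f) (s : Fin M.numS) (a : M.GAct)
    {Φ : Cfg n → ℝ≥0∞}
    (h : Val b σ f
      (gState (stPoll (ofFin s) (revT (fun i => ofFin (a i)) n) nil) (fun _ => nil)
        fun i => ofRange (M.numObs i))
      (M.choices (stPoll (ofFin s) (revT (fun i => ofFin (a i)) n) nil) (fun _ => nil)
        fun i => ofRange (M.numObs i)) Φ) :
    ∀ m k, m + k = n → Val b σ f
      (gState (stPoll (ofFin s) (revT (fun i => ofFin (a i)) k) (M.actSets k)) (M.restPoll a k)
        fun i => ofRange (M.numObs i))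
      (M.choices (stPoll (ofFin s) (revT (fun i => ofFin (a i)) k) (M.actSets k)) (M.restPoll a k)
        fun i => ofRange (M.numObs i))
      fun cfg => Φ (run (M.pollFrom a k) cfg)
  | 0, k, hk => by
    obtain rfl : k = n := by omega
    have h1 : M.restPoll a k = fun _ => nil := by
      funext i; simp [restPoll]
    rw [pollFrom_of_le a le_rfl, h1, actSets, dropT_of_le _ le_rfl]
    exact h
  | m + 1, k, hk => by
    have hk' : k < n := by omega
    have ih := Val.pollFrom hf s a h m (k + 1) (by omega)
    rw [← update_restPoll a hk'] at ih
    have h1 : M.restPoll a k ⟨k, hk'⟩ = M.rejections ⟨k, hk'⟩ (a ⟨k, hk'⟩) := by simp [restPoll]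
    have := Val.poll hf s a ⟨k, hk'⟩ (a ⟨k, hk'⟩) 0 (M.restPoll a k) (by omega)
      (legal_restPoll a k) h1 ih
    rw [actSets, dropT_of_lt _ hk', pollFrom_of_lt a hk']
    refine this.congr_arg fun cfg => ?_
    rw [h1, run_append _ (M.pollFrom a (k + 1))]

/-- Player `i` receives the ticks that announce its observation. -/
theorem Val.tell (hf : StepBound b σ δ T f f) (s : Fin M.numS) (o : M.GObs) (i : Fin n)
    {Φ : Cfg n → ℝ≥0∞} {x z : BTree} : ∀ (K : BTree) (q : Fin n → BTree),
    (∀ i, q i ∈ (ofRange (M.numObs i)).suffixes) → q i = K →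
    tellOne (lTick (M.obsSets (i + 1))) x K z ∈ (M.obsScript o).suffixes →
    Val b σ f (gState (stTell (ofFin s) (ofTuple o) z) (fun _ => nil) (Function.update q i nil))
      (M.choices (stTell (ofFin s) (ofTuple o) z) (fun _ => nil) (Function.update q i nil)) Φ →
    Val b σ f
      (gState (stTell (ofFin s) (ofTuple o) (tellOne (lTick (M.obsSets (i + 1))) x K z))
        (fun _ => nil) q)
      (M.choices (stTell (ofFin s) (ofTuple o) (tellOne (lTick (M.obsSets (i + 1))) x K z))
        (fun _ => nil) q)
      fun cfg => Φ (run (M.tellEvents i x K) cfg)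
  | nil, q, hq, hK, hz, h => by
    rw [Function.update_eq_self_iff.2 hK.symm] at h
    exact h
  | cons k K, q, hq, hK, hz, h => by
    have hq' : ∀ i', Function.update q i K i' ∈ (ofRange (M.numObs i')).suffixes := by
      intro i'
      by_cases hi : i' = i
      · subst hi
        have := hq i'
        rw [hK] at this
        rw [Function.update_self]
        exact mem_suffixes_of_cons_mem this
      · rw [Function.update_of_ne hi]; exact hq i'
    have hv : lTick (M.obsSets (i + 1)) ≠ nil := by simp [lTick]
    -- The tick leads to the script `w`, which starts with a pause or not.
    have step : ∀ w Ψ, cons (lTick (M.obsSets (i + 1))) w ∈ (M.obsScript o).suffixes →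
        Val b σ f (gState (stTell (ofFin s) (ofTuple o) w) (fun _ => nil) (Function.update q i K))
          (M.choices (stTell (ofFin s) (ofTuple o) w) (fun _ => nil) (Function.update q i K)) Ψ →
        Val b σ f (gState (stTell (ofFin s) (ofTuple o) (cons (lTick (M.obsSets (i + 1))) w))
            (fun _ => nil) q)
          (M.choices (stTell (ofFin s) (ofTuple o) (cons (lTick (M.obsSets (i + 1))) w))
            (fun _ => nil) q)
          fun cfg => Ψ (globalStep cfg (some (i, M.playerChoice i nil (cons k K),
            .act (lTick (M.obsSets (i + 1))), cons nil K))) := by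
      intro w Ψ hw hΨ
      have := Val.single hf (stTell_hd _ _ _)
        (mem_envTrans.2 (Or.inr (Or.inr (Or.inr ⟨s, o, _, w, hv, hw, rfl⟩)))) (i := i)
        (fun _ => lTick_mem_acts) (r := fun _ => nil) (q := q) (r' := nil) (q' := K)
        (by rw [hK]; rfl) (by rw [Function.update_eq_self]; exact legal_nil hq') (Φ := Ψ)
        (by rw [Function.update_eq_self]; exact hΨ)
      rw [hK] at this
      exact this
    have ih := Val.tell hf s o i (Φ := Φ) (x := x) (z := z) K (Function.update q i K) hq'
      (Function.update_self ..)
    rw [Function.update_idem] at ih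
    rw [tellOne] at hz ⊢
    by_cases hx : sameBits k x = true
    · rw [if_pos hx] at hz ⊢
      have hz1 := mem_suffixes_of_cons_mem hz
      have h1 := Val.pause hf (stTell_hd _ _ _) ?_ (delaysFrom_stTell s o hz1)
        (ih (mem_suffixes_of_cons_mem hz1) h)
      · refine (step _ _ hz h1).congr_arg fun cfg => ?_
        rw [tellEvents, if_pos hx]
        rfl
      · intro l e' hl
        exfalso
        rcases mem_envTrans.1 hl with ⟨s, he⟩ | ⟨s, a, i, k, k', r, hr, he⟩ | ⟨s, o, he⟩ |
          ⟨s, o, v, z, hv, hz, he⟩ <;>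
        simp only [stReady, stPoll, stTell, tag, Prod.mk.injEq, cons.injEq, reduceCtorEq, true_and,
          false_and, and_false] at he
        exact hv he.1.2.1.symm
    · rw [if_neg hx] at hz ⊢
      refine (step _ _ hz (ih (mem_suffixes_of_cons_mem hz) h)).congr_arg fun cfg => ?_
      rw [tellEvents, if_neg hx]
      rfl

/-- The players from the index `k` on are informed of their observations. -/
theorem Val.tellFrom (hf : StepBound b σ δ T f f) (s : Fin M.numS) (o : M.GObs)
    {Φ : Cfg n → ℝ≥0∞}
    (h : Val b σ f (gState (stTell (ofFin s) (ofTuple o) nil) (fun _ => nil) fun _ => nil)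
      (M.choices (stTell (ofFin s) (ofTuple o) nil) (fun _ => nil) fun _ => nil) Φ) :
    ∀ m k, m + k = n → M.scriptFrom o k ∈ (M.obsScript o).suffixes → Val b σ f
      (gState (stTell (ofFin s) (ofTuple o) (M.scriptFrom o k)) (fun _ => nil) (M.restTell k))
      (M.choices (stTell (ofFin s) (ofTuple o) (M.scriptFrom o k)) (fun _ => nil) (M.restTell k))
      fun cfg => Φ (run (M.tellFrom o k) cfg)
  | 0, k, hk, hs => by
    obtain rfl : k = n := by omega
    have h1 : M.restTell k = fun _ => nil := by
      funext i; simp [restTell]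
    rw [tellFrom_of_le o le_rfl, h1, scriptFrom_of_le o le_rfl]
    exact h
  | m + 1, k, hk, hs => by
    have hk' : k < n := by omega
    rw [scriptFrom_of_lt o hk'] at hs ⊢
    have ih := Val.tellFrom hf s o h m (k + 1) (by omega) (suffix_of_tellOne hs)
    rw [← update_restTell hk'] at ih
    have := Val.tell hf s o ⟨k, hk'⟩ (ofRange (M.numObs ⟨k, hk'⟩)) (M.restTell k) ?_
      (by simp [restTell]) hs ih
    · rw [tellFrom_of_lt o hk']
      refine this.congr_arg fun cfg => ?_
      rw [run_append]
    · intro i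
      unfold restTell
      split_ifs
      · exact nil_mem_suffixes _
      · exact self_mem_suffixes _

/-- After the history `h`, a round starts with the simulated process in the state `s`, at time `t`
and with the local histories `l`. -/
structure RoundStart (h : List (DistIMC.Rec (n + 1))) (s : Fin M.numS) (t : ℝ)
    (l : Fin n → List (LRec (n + 1))) : Prop where
  state : M.toDistIMC.lastState h = M.startState s
  time : lastTime h = t
  hist : ∀ i : Fin n, M.toDistIMC.localHist i.succ h = l i
  chooses : ∀ j, M.toDistIMC.Chooses j h

/-- The last step of a round, after which all players choose anew. -/
theorem Val.finish (hf : StepBound b σ δ T f f) (s : Fin M.numS) (o : M.GObs)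
    {F : (Fin n → List (LRec (n + 1))) → ℝ → ℝ≥0∞} (hF : Measurable (Function.uncurry F))
    (h : ∀ h l t, RoundStart h s t l → Ineq b (f h) (F l t)) :
    Val b σ f (gState (stTell (ofFin s) (ofTuple o) nil) (fun _ => nil) fun _ => nil)
      (M.choices (stTell (ofFin s) (ofTuple o) nil) (fun _ => nil) fun _ => nil)
      fun cfg => F (run (allEvents (fun i => M.playerChoice i nil nil) (.act lGo) fun _ => nil)
        cfg).1 cfg.2.1 := by
  have hm : Measurable fun cfg : Cfg n =>
      F (run (allEvents (fun i => M.playerChoice i nil nil) (.act lGo) fun _ => nil) cfg).1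
        cfg.2.1 :=
    hF.comp ((measurable_fst.comp (measurable_run _)).prodMk (measurable_fst.comp measurable_snd))
  have htr : (stTell (ofFin s) (ofTuple o) nil, lGo, stCheck (ofFin s)) ∈ M.envTrans :=
    mem_envTrans.2 (Or.inr (Or.inr (Or.inl ⟨s, o, rfl⟩)))
  have henv := envChoice_of_mem htr
  refine ⟨hm, fun h0 l t hat => ?_⟩
  have hen : lGo ∈ M.toDistIMC.Enabled (M.choices (stTell (ofFin s) (ofTuple o) nil)
      (fun _ => nil) fun _ => nil) := by
    refine ⟨⟨0, (M.envModule.trans_mem _ (mem_trans_envModule.2 htr)).2.1⟩, fun j _ => ?_⟩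
    refine Fin.cases ?_ (fun i => ?_) j
    · rw [choices_zero, henv]; rfl
    · rfl
  have hstep := hf.le h0
  rw [valueStep_of_notMem (by rw [hat.state]; exact gState_notMem_targets (stTell_hd _ _ _) _ _),
    M.toDistIMC.lintegral_stepKernel_of_enabled σ hat.choice
      (scheduler_apply_of_mem δ h0 hen) (hf.measurable_snoc h0)] at hstep
  have hsync : ∀ j, j ∈ M.toDistIMC.Sync (.act lGo) := fun j => sync_lGo ▸ Set.mem_univ j
  have hs : M.toDistIMC.actStep h0 (M.choices (stTell (ofFin s) (ofTuple o) nil)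
      (fun _ => nil) fun _ => nil) lGo = (.act lGo, M.startState s, t) := by
    unfold actStep
    rw [hat.time, hat.state]
    refine Prod.ext rfl (Prod.ext (funext fun j => ?_) rfl)
    dsimp only
    rw [if_pos (show lGo ∈ (M.toDistIMC.mod j).acts from hsync j)]
    refine Fin.cases ?_ (fun i => ?_) j
    · rw [choices_zero, henv]; rfl
    · rfl
  rw [hs] at hstep
  refine hstep.trans ?_
  simp only [run_allEvents]
  rw [lintegral_const, measure_univ, mul_one]
  refine h _ _ _ ⟨lastState_snoc _ _ _, lastTime_snoc _ _, fun i => ?_, fun j =>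
    (chooses_snoc _ _ _).2 (hsync j)⟩
  rw [localHist_snoc_of_mem _ _ (hsync i.succ), hat.hist]
  rfl

/-- The simulation of a step of the DEC-POMDP, after the players have chosen their actions. -/
theorem Val.transition (hf : StepBound b σ δ T f f) (s : Fin M.numS) (a : M.GAct)
    {F : Fin M.numS → (Fin n → List (LRec (n + 1))) → ℝ → ℝ≥0∞}
    (hF : ∀ s, Measurable (Function.uncurry (F s)))
    (h : ∀ h s l t, RoundStart h s t l → Ineq b (f h) (F s l t)) :
    Val b σ f
      (gState (stPoll (ofFin s) (revT (fun i => ofFin (a i)) n) nil) (fun _ => nil)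
        fun i => ofRange (M.numObs i))
      (M.choices (stPoll (ofFin s) (revT (fun i => ofFin (a i)) n) nil) (fun _ => nil)
        fun i => ofRange (M.numObs i))
      fun cfg => envAverage s a fun s' o =>
        let cfg' := run ([none] ++ ([none] ++ (M.tellFrom o 0 ++
          allEvents (fun i => M.playerChoice i nil nil) (.act lGo) fun _ => nil))) cfg
        F s' cfg'.1 cfg'.2.1 := by
  let es : M.GObs → List (Event n) := fun o => M.tellFrom o 0 ++
    allEvents (fun i => M.playerChoice i nil nil) (.act lGo) fun _ => nil
  refine (Val.branch hf (ι := Fin M.numS) (w := M.P s a)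
    (e' := fun s' => stObs (ofFin s) (ofTuple a) (ofFin s')) (stPoll_hd _ _ _) ?_ ?_ (M.P_sum s a)
    (delaysFrom_stPoll_nil s a) fun s' => Val.branch hf (ι := M.GObs) (w := M.O s a s')
      (e' := fun o => stTell (ofFin s') (ofTuple o) (M.obsScript o)) (stObs_hd _ _ _) ?_ ?_
      (M.O_sum s a s') (delaysFrom_stObs s a s')
      (Φ := fun o cfg => F s' (run (es o) cfg).1 (run (es o) cfg).2.1) fun o => ?_).congr_arg ?_
  · intro l e' hl
    exfalso
    rcases mem_envTrans.1 hl with ⟨s, he⟩ | ⟨s, a, i, k, k', r, hr, he⟩ | ⟨s, o, he⟩ |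
      ⟨s, o, v, z, hv, hz, he⟩ <;>
    simp [stReady, stPoll, stTell, tag] at he
  · intro s₁ s₂ h12
    simp only [stObs, cons.injEq, true_and] at h12
    exact ofFin_injective h12
  · intro l e' hl
    exfalso
    rcases mem_envTrans.1 hl with ⟨s, he⟩ | ⟨s, a, i, k, k', r, hr, he⟩ | ⟨s, o, he⟩ |
      ⟨s, o, v, z, hv, hz, he⟩ <;>
    simp [stReady, stPoll, stTell, stObs, tag] at he
  · intro o₁ o₂ h12
    simp only [stTell, cons.injEq, true_and] at h12
    exact ofTuple_injective h12.1
  · have := Val.tellFrom hf s' o (Val.finish hf s' o (hF s') (h · s')) n 0 rfl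
      (by rw [scriptFrom_zero]; exact self_mem_suffixes _)
    have hq : M.restTell 0 = fun i => ofRange (M.numObs i) := by funext i; simp [restTell]
    rw [scriptFrom_zero, hq] at this
    refine this.congr_arg fun cfg => ?_
    rw [run_append, run_allEvents]
  · intro cfg
    rfl

end Rules

end DecPOMDP

namespace DecPOMDP

variable {n : ℕ} {M : DecPOMDP n}

/-! ### The start of a round -/

/-- The probability that player `i` chooses the transition that stands for the action `a`, after the
local history `l`. -/
noncomputable def actProb (σ : M.toDistIMC.Profile) (i : Fin n) (l : List (LRec (n + 1)))
    (a : Fin (M.numAct i)) : ℝ≥0∞ := (σ i.succ).kernel l {M.choiceOf i a}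

/-- The choices at the start of a round; the environment waits. -/
def startChoices (a : M.GAct) : GChoice (n + 1) := Fin.cons .bot fun i => M.choiceOf i (a i)

theorem localLast_localHist (G : DistIMC n) {j : Fin n} {h : List (DistIMC.Rec n)}
    (hj : G.Chooses j h) : G.localLast j (G.localHist j h) = G.lastState h j := by
  rcases List.eq_nil_or_concat h with rfl | ⟨h, r, rfl⟩
  · rfl
  · rw [List.concat_eq_append] at hj ⊢
    rw [G.localHist_snoc_of_mem _ ((G.chooses_snoc _ _).1 hj), localLast_snoc, lastState_snoc]

theorem ae_available_choiceLaw {G : DistIMC n} (σ : G.Profile) {j : Fin n}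
    {h : List (DistIMC.Rec n)} (hj : G.Chooses j h) :
    ∀ᵐ d ∂(G.choiceLaw σ j h), (G.mod j).Available (G.lastState h j) d := by
  rw [G.choiceLaw_of_chooses σ hj, ← localLast_localHist G hj]
  exact (σ j).available _

theorem startChoices_injective : Function.Injective (M.startChoices) := by
  intro a a' h
  funext i
  have := congrFun h i.succ
  simp only [startChoices, Fin.cons_succ] at this
  exact M.choiceOf_injective i this

theorem envChoice_stCheck (s : Fin M.numS) : M.envChoice (stCheck (ofFin s)) = .bot := by
  unfold envChoice
  rw [dif_neg]
  rintro ⟨x, hx, h⟩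
  rcases mem_envTrans.1 hx with ⟨s, rfl⟩ | ⟨s, a, i, k, k', r, hr, rfl⟩ | ⟨s, o, rfl⟩ |
    ⟨s, o, v, z, hv, hz, rfl⟩ <;>
  simp [stReady, stPoll, stTell, stCheck, tag] at h

variable {b : Bool} {σ : M.toDistIMC.Profile} {δ : M.toDistIMC.Scheduler}
  {T : Finset (Fin M.numS)} {f g : List (DistIMC.Rec (n + 1)) → ℝ≥0∞}

theorem RoundStart.ae_available {h : List (DistIMC.Rec (n + 1))} {s : Fin M.numS} {t : ℝ}
    {l : Fin n → List (LRec (n + 1))} (hr : RoundStart h s t l) (j : Fin (n + 1)) :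
    ∀ᵐ d ∂(M.toDistIMC.choiceLaw σ j h), (M.toDistIMC.mod j).Available (M.startState s j) d := by
  rw [← hr.state]
  exact ae_available_choiceLaw σ (hr.chooses j)

/-- At the start of a round the choices are independent, and they amount to the choice of a global
action. -/
theorem RoundStart.lintegral_choiceKernel {h : List (DistIMC.Rec (n + 1))} {s : Fin M.numS} {t : ℝ}
    {l : Fin n → List (LRec (n + 1))} (hr : RoundStart h s t l)
    (F : GChoice (n + 1) → ℝ≥0∞) :
    ∫⁻ c, F c ∂(M.toDistIMC.choiceKernel σ h)
      = ∑ a : M.GAct, (∏ i, actProb σ i (l i) (a i)) * F (M.startChoices a) := by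
  classical
  have hsingle : ∀ c : GChoice (n + 1), M.toDistIMC.choiceKernel σ h {c}
      = ∏ j, M.toDistIMC.choiceLaw σ j h {c j} := fun c => Measure.pi_singleton _ c
  have h0 : M.toDistIMC.choiceLaw σ 0 h = Measure.dirac .bot := by
    refine eq_dirac_of_ae ?_
    filter_upwards [hr.ae_available (σ := σ) 0] with d hd
    rw [← envChoice_stCheck s]
    exact eq_envChoice hd
  have hval : ∀ a, M.toDistIMC.choiceKernel σ h {M.startChoices a}
      = ∏ i, actProb σ i (l i) (a i) := by
    intro a
    rw [hsingle, Fin.prod_univ_succ, h0]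
    simp only [startChoices, Fin.cons_zero, Fin.cons_succ, actProb]
    rw [Measure.dirac_apply_of_mem (Set.mem_singleton _), one_mul]
    refine Finset.prod_congr rfl fun i _ => ?_
    rw [M.toDistIMC.choiceLaw_of_chooses σ (hr.chooses i.succ), hr.hist]
  have hzero : ∀ c, c ∉ Finset.univ.image M.startChoices →
      M.toDistIMC.choiceKernel σ h {c} = 0 := by
    intro c hc
    rw [hsingle]
    by_contra hne
    rw [Finset.prod_eq_zero_iff] at hne
    have hav : ∀ j, (M.toDistIMC.mod j).Available (M.startState s j) (c j) := by
      intro j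
      by_contra hj
      refine hne ⟨j, Finset.mem_univ j, ?_⟩
      refine measure_mono_null ?_ (hr.ae_available (σ := σ) j)
      rintro d rfl
      exact hj
    have hex : ∀ i : Fin n, ∃ a, c i.succ = M.choiceOf i a := fun i => available_nil.1 (hav i.succ)
    choose a ha using hex
    refine hc (Finset.mem_image.2 ⟨a, Finset.mem_univ _, funext fun j => ?_⟩)
    refine Fin.cases ?_ (fun i => (ha i).symm) j
    exact (envChoice_stCheck s).symm.trans (eq_envChoice (hav 0)).symm
  rw [lintegral_countable', tsum_eq_sum (s := Finset.univ.image M.startChoices)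
    fun c hc => by rw [hzero c hc, mul_zero],
    Finset.sum_image fun a _ a' _ haa => M.startChoices_injective haa]
  exact Finset.sum_congr rfl fun a _ => by rw [hval, mul_comm]

/-- The first step of a round is a delay of the environment. It makes the state at the start of the
round last for a non-zero time, so that it counts as visited. -/
theorem RoundStart.lintegral_stepKernel {h : List (DistIMC.Rec (n + 1))} {s : Fin M.numS} {t : ℝ}
    {l : Fin n → List (LRec (n + 1))} (hr : RoundStart h s t l)
    {F : DistIMC.Rec (n + 1) → ℝ≥0∞} (hF : Measurable F) :
    ∫⁻ r, F r ∂(M.toDistIMC.stepKernel σ δ h)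
      = ∑ a : M.GAct, (∏ i, actProb σ i (l i) (a i)) * ∫⁻ d, F (M.startChoices a, .delay 0,
        Function.update (M.startState s) 0 (stReady (ofFin s)), t + d) ∂(expMeasure 1) := by
  have hdel : M.delaysFrom (M.startState s 0)
      = {(stCheck (ofFin s), 1, stReady (ofFin s))} := delaysFrom_stCheck s
  have hdis : ∀ᵐ c ∂(M.toDistIMC.choiceKernel σ h), δ.kernel (h, c) = Measure.dirac none := by
    rw [ae_iff]
    rw [← lintegral_indicator_one .of_discrete, hr.lintegral_choiceKernel]
    refine Finset.sum_eq_zero fun a _ => ?_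
    rw [Set.indicator_of_notMem, mul_zero]
    simp only [Set.mem_ofPred_eq, not_not]
    refine scheduler_apply_of_empty δ h (Set.eq_empty_of_forall_notMem ?_)
    rintro x ⟨⟨j, hj⟩, hx⟩
    exact hx 0 (M.acts_subset j hj)
  rw [M.toDistIMC.lintegral_stepKernel_of_disabled σ hdis hF, hr.lintegral_choiceKernel]
  refine Finset.sum_congr rfl fun a _ => ?_
  rw [hr.state, hr.time, M.toDistIMC.lintegral_raceLaw
    (by rw [M.sum_edges _ fun e => (e.2.1 : ℝ), hdel]; simp)
    (F := fun y => F (M.startChoices a, y.1, y.2.1, t + y.2.2)) (hF.comp (by fun_prop)),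
    M.sum_edges, hdel, Finset.sum_singleton]
  simp

/-- The players other than the environment keep the choices made at the start of the round during
its first delay. -/
theorem RoundStart.at_ready {h : List (DistIMC.Rec (n + 1))} {s : Fin M.numS} {t : ℝ}
    {l : Fin n → List (LRec (n + 1))} (hr : RoundStart h s t l) (a : M.GAct) (t' : ℝ) :
    M.toDistIMC.At σ (h ++ [(M.startChoices a, .delay 0,
        Function.update (M.startState s) 0 (stReady (ofFin s)), t')])
      (Function.update (M.startState s) 0 (stReady (ofFin s)))
      (Fin.cons (M.envChoice (stReady (ofFin s))) fun i => M.choiceOf i (a i)) t' l := by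
  generalize hx : Function.update (M.startState s) 0 (stReady (ofFin s)) = x
  have hx0 : x 0 = stReady (ofFin s) := by rw [← hx, Function.update_self]
  refine ⟨M.toDistIMC.lastState_snoc _ _, lastTime_snoc _ _, fun i => ?_, fun j => ?_⟩
  · rw [M.toDistIMC.localHist_snoc_of_notMem h
      (r := (M.startChoices a, .delay 0, x, t')) (j := i.succ)
      (fun h' => Fin.succ_ne_zero i (Set.mem_singleton_iff.1 h')), hr.hist]
  · revert j
    refine Fin.cases ?_ fun i => ?_
    · have hch : M.toDistIMC.Chooses 0 (h ++ [(M.startChoices a, .delay 0, x, t')]) :=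
        (M.toDistIMC.chooses_snoc _ _).2 rfl
      have hav := ae_available_choiceLaw σ hch
      rw [lastState_snoc] at hav
      refine eq_dirac_of_ae ?_
      filter_upwards [hav] with c hc
      change M.envModule.Available (x 0) c at hc
      rw [hx0] at hc
      exact eq_envChoice hc
    · have hch : ¬ M.toDistIMC.Chooses i.succ (h ++ [(M.startChoices a, .delay 0, x, t')]) :=
        fun h' => Fin.succ_ne_zero i (Set.mem_singleton_iff.1 ((M.toDistIMC.chooses_snoc _ _).1 h'))
      rw [M.toDistIMC.choiceLaw_of_not_chooses σ hch, prevChoice_snoc]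
      rfl

/-- The step in which the choices made at the start of the round are executed. -/
theorem Val.ready (hg : StepBound b σ δ T g g) (s : Fin M.numS) (a : M.GAct) {Φ : Cfg n → ℝ≥0∞}
    (h : Val b σ g
      (gState (stPoll (ofFin s) nil (M.actSets 0)) (M.restPoll a 0) fun i => ofRange (M.numObs i))
      (M.choices (stPoll (ofFin s) nil (M.actSets 0)) (M.restPoll a 0)
        fun i => ofRange (M.numObs i)) Φ) :
    Val b σ g (Function.update (M.startState s) 0 (stReady (ofFin s)))
      (Fin.cons (M.envChoice (stReady (ofFin s))) fun i => M.choiceOf i (a i))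
      fun cfg => Φ (run (allEvents (fun i => M.choiceOf i (a i)) (.act lGo)
        fun i => cons (M.rejections i (a i)) (ofRange (M.numObs i))) cfg) := by
  have hsync : ∀ j, lGo ∈ (M.toDistIMC.mod j).acts := fun j =>
    show j ∈ M.toDistIMC.Sync (.act lGo) from sync_lGo ▸ Set.mem_univ j
  have htr : (stReady (ofFin s), lGo, stPoll (ofFin s) nil (M.actSets 0)) ∈ M.envTrans :=
    mem_envTrans.2 (Or.inl ⟨s, rfl⟩)
  have henv := envChoice_of_mem htr
  refine Val.act hg (a := lGo) ?_ ⟨⟨0, hsync 0⟩, fun j _ => ?_⟩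
    (fun j _ => ?_) (fun j hj => absurd (hsync j) hj)
    (fun j _ d hd => eq_choices (legal_restPoll a 0) j hd) (fun j hj => absurd (hsync j) hj)
    (h.1.comp (measurable_run _))
    (u := fun l t i => l i ++ [(M.choiceOf i (a i), .act lGo,
      cons (M.rejections i (a i)) (ofRange (M.numObs i)), t)])
    (fun l t i _ => ?_) (fun l t i hi => absurd (hsync _) hi) (fun l t D => ?_) h
  · intro hx
    obtain ⟨s', -, hs⟩ := Finset.mem_image.1 hx
    have := congrFun hs 0
    simp [startState, stCheck, stReady, tag] at this
  · refine Fin.cases ?_ (fun i => ?_) j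
    · rw [Fin.cons_zero, henv]; rfl
    · rfl
  · refine Fin.cases ?_ (fun i => ?_) j
    · rw [Fin.cons_zero, henv]; rfl
    · simp [gState, restPoll, choiceOf, Choice.target]
  · simp [gState, restPoll]
  · rw [run_allEvents]

/-- The value of a round in terms of the values at the starts of the following rounds. -/
theorem RoundStart.bound (hf : StepBound b σ δ T f g) (hg : StepBound b σ δ T g g)
    {F : Fin M.numS → (Fin n → List (LRec (n + 1))) → ℝ → ℝ≥0∞}
    (hF : ∀ s, Measurable (Function.uncurry (F s)))
    (hgF : ∀ h s l t, RoundStart h s t l → Ineq b (g h) (F s l t))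
    {h : List (DistIMC.Rec (n + 1))} {s : Fin M.numS} {t : ℝ} {l : Fin n → List (LRec (n + 1))}
    (hr : RoundStart h s t l) :
    Ineq b (f h) (if s ∈ T then 1 else ∑ a : M.GAct, (∏ i, actProb σ i (l i) (a i)) *
      ∫⁻ D, envAverage s a (fun s' o => F s' (run (M.roundEvents a o) (l, t, D)).1
        (run (M.roundEvents a o) (l, t, D)).2.1) ∂delayStream) := by
  classical
  have hone : ∑ a : M.GAct, ∏ i, actProb σ i (l i) (a i) = 1 := by
    have := hr.lintegral_choiceKernel (σ := σ) fun _ => 1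
    simpa using this.symm
  have hstep := hf.le h
  have hm : Measurable fun r => (if M.Hit T h r then 1 else g (h ++ [r])) :=
    (measurable_goodIntegrand (M.measurableSet_hit T) hf.measurable).comp measurable_prodMk_left
  split_ifs with hs
  · refine hstep.trans (Ineq.of_eq ?_)
    unfold valueStep
    have hae : ∀ a, ∫⁻ d, (if M.Hit T h (M.startChoices a, .delay 0,
        Function.update (M.startState s) 0 (stReady (ofFin s)), t + d) then 1 else
          g (h ++ [(M.startChoices a, .delay 0,
            Function.update (M.startState s) 0 (stReady (ofFin s)), t + d)])) ∂(expMeasure 1)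
        = 1 := by
      intro a
      have : ∫⁻ _, 1 ∂(expMeasure 1) = (1 : ℝ≥0∞) := by simp
      refine Eq.trans (lintegral_congr_ae ?_) this
      filter_upwards [ae_pos_expMeasure] with d hd
      have hit : M.Hit T h (M.startChoices a, .delay 0,
          Function.update (M.startState s) 0 (stReady (ofFin s)), t + d) := by
        refine ⟨?_, Or.inl ?_⟩
        · rw [hr.state]; exact (M.startState_mem_targets).2 hs
        · rw [hr.time]; exact lt_add_of_pos_right t hd
      rw [if_pos hit]
    refine Eq.trans ?_ hone
    convert hr.lintegral_stepKernel (σ := σ) (δ := δ) hm using 1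
    refine Finset.sum_congr rfl fun a _ => ?_
    rw [hae, mul_one]
  · rw [valueStep_of_notMem (by rw [hr.state]; exact fun h' => hs (M.startState_mem_targets.1 h')),
      hr.lintegral_stepKernel (hf.measurable_snoc h)] at hstep
    refine hstep.trans (Ineq.sum fun a _ => Ineq.mul_left _ ?_)
    have hval := Val.ready hg s a (Val.pollFrom hg s a (Val.transition hg s a hF hgF) n 0 rfl)
    refine (Ineq.lintegral fun d => hval.2 _ l (t + d)
      (hr.at_ready a (t + d))).trans ?_
    refine Ineq.of_eq ((lintegral_delay hval.1 l t).symm.trans (lintegral_congr fun D => ?_))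
    simp only [roundEvents, run_append]
    rfl

end DecPOMDP

namespace DecPOMDP

variable {n : ℕ} {M : DecPOMDP n}

/-! ### Reach probabilities of the distributed IMC -/

/-- The probability that the simulated process visits `T` within the first `k` rounds, when the
rounds start in the state `s` at time `t` with the local histories `l`. -/
noncomputable def roundValue (σ : M.toDistIMC.Profile) (T : Finset (Fin M.numS)) :
    ℕ → Fin M.numS → (Fin n → List (LRec (n + 1))) → ℝ → ℝ≥0∞
  | 0 => fun _ _ _ => 0
  | k + 1 => fun s l t => if s ∈ T then 1 else ∑ a : M.GAct, (∏ i, actProb σ i (l i) (a i)) *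
      ∫⁻ D, envAverage s a (fun s' o => roundValue σ T k s' (run (M.roundEvents a o) (l, t, D)).1
        (run (M.roundEvents a o) (l, t, D)).2.1) ∂delayStream

theorem roundValue_succ (σ : M.toDistIMC.Profile) (T : Finset (Fin M.numS)) (k : ℕ)
    (s : Fin M.numS) (l : Fin n → List (LRec (n + 1))) (t : ℝ) :
    roundValue σ T (k + 1) s l t = if s ∈ T then 1 else
      ∑ a : M.GAct, (∏ i, actProb σ i (l i) (a i)) *
        ∫⁻ D, envAverage s a (fun s' o => roundValue σ T k s' (run (M.roundEvents a o) (l, t, D)).1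
          (run (M.roundEvents a o) (l, t, D)).2.1) ∂delayStream := rfl

theorem measurable_actProb (σ : M.toDistIMC.Profile) (i : Fin n) (a : Fin (M.numAct i)) :
    Measurable fun l => actProb σ i l a :=
  (σ i.succ).kernel.measurable_coe .of_discrete

theorem measurable_envAverage {α : Type*} [MeasurableSpace α] (s : Fin M.numS) (a : M.GAct)
    {F : Fin M.numS → M.GObs → α → ℝ≥0∞} (hF : ∀ s' o, Measurable (F s' o)) :
    Measurable fun x => envAverage s a fun s' o => F s' o x := by
  unfold envAverage
  exact Finset.measurable_sum _ fun s' _ => (Finset.measurable_sum _ fun o _ =>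
    (hF s' o).const_mul _).const_mul _

theorem measurable_roundValue (σ : M.toDistIMC.Profile) (T : Finset (Fin M.numS)) (k : ℕ)
    (s : Fin M.numS) : Measurable (Function.uncurry (roundValue σ T k s)) := by
  induction k generalizing s with
  | zero => exact measurable_const
  | succ k ih =>
    simp only [Function.uncurry_def, roundValue_succ]
    split_ifs
    · exact measurable_const
    refine Finset.measurable_sum _ fun a _ => Measurable.mul ?_ ?_
    · exact Finset.measurable_prod _ fun i _ => (measurable_actProb σ i (a i)).comp
        ((measurable_pi_apply i).comp measurable_fst)
    · refine Measurable.lintegral_prod_right' (f := fun y : ((Fin n → List (LRec (n + 1))) × ℝ) ×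
        (ℕ → ℝ) => envAverage s a fun s' o =>
          roundValue σ T k s' (run (M.roundEvents a o) (y.1.1, y.1.2, y.2)).1
            (run (M.roundEvents a o) (y.1.1, y.1.2, y.2)).2.1) ?_
      refine measurable_envAverage s a fun s' o => ?_
      have hrun : Measurable fun y : ((Fin n → List (LRec (n + 1))) × ℝ) × (ℕ → ℝ) =>
          run (M.roundEvents a o) (y.1.1, y.1.2, y.2) :=
        (measurable_run _).comp (by fun_prop)
      exact (ih s').comp (hrun.fst.prodMk hrun.snd.fst)

theorem roundStart_nil : RoundStart (M := M) [] M.init 0 fun _ => [] where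
  state := by
    funext j
    refine Fin.cases ?_ (fun i => ?_) j <;> rfl
  time := rfl
  hist _ := rfl
  chooses _ := trivial

/-- Reach probabilities of the distributed IMC are limits of the values of rounds. -/
theorem toDistIMC_playLaw_reach (σ : M.toDistIMC.Profile) (δ : M.toDistIMC.Scheduler)
    (T : Finset (Fin M.numS)) :
    M.toDistIMC.playLaw σ δ (M.toDistIMC.reach (M.targets T))
      = ⨆ k, roundValue σ T k M.init (fun _ => []) 0 := by
  have hm := M.measurableSet_hit T
  rw [reach_eq, DistIMC.playLaw, sequenceLaw_exists_good hm]
  refine le_antisymm (iSup_mono fun m => ?_) (iSup_le fun k => ?_)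
  · suffices h : ∀ m h s l t, RoundStart h s t l →
        valueIter (M.toDistIMC.stepKernel σ δ) (M.Hit T) m h ≤ roundValue σ T m s l t from
      h m _ _ _ _ roundStart_nil
    intro m
    induction m with
    | zero => intro h s l t _; exact zero_le
    | succ m ih =>
      intro h s l t hr
      exact hr.bound (b := true) (T := T) (σ := σ) (δ := δ)
        (f := valueIter (M.toDistIMC.stepKernel σ δ) (M.Hit T) (m + 1))
        (g := valueIter (M.toDistIMC.stepKernel σ δ) (M.Hit T) m)
        ⟨measurable_valueIter hm m, fun _ => le_rfl⟩
        ⟨measurable_valueIter hm m, fun _ => valueIter_le_succ m _⟩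
        (measurable_roundValue σ T m) (fun h s l t hr => ih h s l t hr)
  · suffices h : ∀ k h s l t, RoundStart h s t l →
        roundValue σ T k s l t ≤ value (M.toDistIMC.stepKernel σ δ) (M.Hit T) h from
      h k _ _ _ _ roundStart_nil
    have hb : StepBound false σ δ T (value (M.toDistIMC.stepKernel σ δ) (M.Hit T))
        (value (M.toDistIMC.stepKernel σ δ) (M.Hit T)) :=
      ⟨Measurable.iSup fun m => measurable_valueIter hm m, fun h => (valueStep_value hm h).le⟩
    intro k
    induction k with
    | zero => intro h s l t _; exact zero_le
    | succ k ih =>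
      intro h s l t hr
      exact hr.bound (b := false) hb hb (measurable_roundValue σ T k)
        (fun h s l t hr => ih h s l t hr)

end DecPOMDP

namespace DecPOMDP

variable {n : ℕ} (M : DecPOMDP n)

/-! ### Rounds as seen by one player -/

/-- The rejections of player `i`, as seen by this player. -/
def localPoll (i : Fin n) : BTree → List (LocalEvent n)
  | nil => []
  | cons x r => some (M.playerChoice i (cons x r) (ofRange (M.numObs i)),
      .act (lNext (M.actSets (i + 1))), cons r (ofRange (M.numObs i))) :: localPoll i r

/-- The ticks for player `i` and the pause between them, as seen by this player. -/
def localTell (i : Fin n) (x : BTree) : BTree → List (LocalEvent n)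
  | nil => []
  | cons k K => some (M.playerChoice i nil (cons k K),
      .act (lTick (M.obsSets (i + 1))), cons nil K) ::
        if sameBits k x then none :: localTell i x K else localTell i x K

/-- The choice of the action `x` at the start of a round, as seen by player `i`. -/
def startEvent (i : Fin n) (x : Fin (M.numAct i)) : LocalEvent n :=
  some (M.choiceOf i x, .act lGo, cons (M.rejections i x) (ofRange (M.numObs i)))

/-- The end of a round, as seen by player `i`. -/
def endEvent (i : Fin n) : LocalEvent n := some (M.playerChoice i nil nil, .act lGo, nil)

/-- The part of a round in which actions are chosen, as seen by player `i`, who chooses `x`. -/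
def localActs (i : Fin n) (x : Fin (M.numAct i)) : List (LocalEvent n) :=
  (List.finRange n).flatMap fun j =>
    (if j = i then M.localPoll i (M.rejections i x) else []) ++ [none]

/-- The part of a round in which observations are announced, as seen by player `i`, who
observes `y`. -/
def localObs (i : Fin n) (y : Fin (M.numObs i)) : List (LocalEvent n) :=
  (List.finRange n).flatMap fun j =>
    if j = i then M.localTell i (ofFin y) (ofRange (M.numObs i)) else [none]

/-- A round as seen by player `i`, who chooses `x` and observes `y`. -/
def localRound (i : Fin n) (x : Fin (M.numAct i)) (y : Fin (M.numObs i)) : List (LocalEvent n) :=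
  [none] ++ ([M.startEvent i x] ++ (M.localActs i x ++ ([none] ++ ([none] ++
    (M.localObs i y ++ [M.endEvent i])))))

variable {M}

theorem project_append (i : Fin n) (es es' : List (Event n)) :
    project i (es ++ es') = project i es ++ project i es' := List.filterMap_append

theorem project_flatMap (i : Fin n) {α : Type*} (L : List α) (g : α → List (Event n)) :
    project i (L.flatMap g) = L.flatMap fun x => project i (g x) := by
  induction L with
  | nil => rfl
  | cons x L ih => rw [List.flatMap_cons, List.flatMap_cons, project_append, ih]

theorem project_some_self (i : Fin n) (r : Choice × Label (n + 1) × BTree) (es : List (Event n)) :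
    project i (some (i, r) :: es) = some r :: project i es := by
  simp [project]

theorem project_some_of_ne {i j : Fin n} (h : j ≠ i) (r : Choice × Label (n + 1) × BTree)
    (es : List (Event n)) : project i (some (j, r) :: es) = project i es := by
  simp [project, h]

theorem project_none (i : Fin n) (es : List (Event n)) :
    project i (none :: es) = none :: project i es := by
  simp [project]

theorem project_pollEvents_self (i : Fin n) (r : BTree) :
    project i (M.pollEvents i r) = M.localPoll i r := by
  induction r with
  | nil => rfl
  | cons x r _ ih => rw [pollEvents, project_some_self, ih, localPoll]

theorem project_pollEvents_of_ne {i j : Fin n} (h : j ≠ i) (r : BTree) :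
    project i (M.pollEvents j r) = [] := by
  induction r with
  | nil => rfl
  | cons x r _ ih => rw [pollEvents, project_some_of_ne h, ih]

theorem project_tellEvents_self (i : Fin n) (x K : BTree) :
    project i (M.tellEvents i x K) = M.localTell i x K := by
  induction K with
  | nil => rfl
  | cons k K _ ih =>
    rw [tellEvents, project_some_self, localTell]
    split_ifs
    · rw [project_none, ih]
    · rw [ih]

/-- The announcement of an observation contains exactly one pause. -/
theorem project_tellEvents_of_ne {i j : Fin n} (h : j ≠ i) (y : Fin (M.numObs j)) :
    project i (M.tellEvents j (ofFin y) (ofRange (M.numObs j))) = [none] := by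
  have key : ∀ m k, m + k = M.numObs j → project i (M.tellEvents j (ofFin y)
      (dropT (ofFin : Fin (M.numObs j) → BTree) k)) = if k ≤ y then [none] else [] := by
    intro m
    induction m with
    | zero =>
      intro k hk
      rw [dropT_of_le _ (by omega), if_neg (by have := y.2; omega)]
      rfl
    | succ m ih =>
      intro k hk
      rw [dropT_of_lt _ (by omega : k < M.numObs j), tellEvents, project_some_of_ne h]
      have hb : sameBits (ofFin (⟨k, by omega⟩ : Fin (M.numObs j))) (ofFin y) = true ↔ k = y :=
        sameBits_ofNat _ _
      by_cases hky : k = y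
      · rw [if_pos (hb.2 hky), project_none, ih (k + 1) (by omega),
          if_neg (by omega), if_pos (by omega)]
      · rw [if_neg fun h' => hky (hb.1 h'), ih (k + 1) (by omega)]
        congr 1
        exact propext (by omega)
  rw [ofRange_eq, key _ 0 rfl, if_pos (Nat.zero_le _)]

theorem project_roundEvents (i : Fin n) (a : M.GAct) (o : M.GObs) :
    project i (M.roundEvents a o) = M.localRound i (a i) (o i) := by
  have h1 : project i (M.pollFrom a 0) = M.localActs i (a i) := by
    rw [pollFrom, project_flatMap]
    unfold localActs
    congr 1
    funext j
    rw [project_append]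
    congr 1
    split_ifs with hj
    · subst hj; exact project_pollEvents_self _ _
    · exact project_pollEvents_of_ne hj _
  have h2 : project i (M.tellFrom o 0) = M.localObs i (o i) := by
    rw [tellFrom, project_flatMap]
    unfold localObs
    congr 1
    funext j
    split_ifs with hj
    · subst hj; exact project_tellEvents_self _ _ _
    · exact project_tellEvents_of_ne hj _
  simp only [roundEvents, localRound, project_append, h1, h2, project_allEvents]
  rfl

/-- What player `i` sees of a round depends only on its own action and observation and on the
delays. -/
theorem localRun_roundEvents (i : Fin n) (a : M.GAct) (o : M.GObs) (x : Cfg n) :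
    ((run (M.roundEvents a o) x).1 i, (run (M.roundEvents a o) x).2)
      = localRun (M.localRound i (a i) (o i)) (x.1 i, x.2) := by
  rw [run_eq, project_roundEvents]

theorem localLast_localRound (i : Fin n) (x : Fin (M.numAct i)) (y : Fin (M.numObs i))
    (z : LocalCfg n) :
    M.toDistIMC.localLast i.succ (localRun (M.localRound i x y) z).1 = nil := by
  simp only [localRound, localRun_append]
  generalize localRun (M.localObs i y) _ = w
  exact M.toDistIMC.localLast_snoc _ _ _

/-! ### Strategies of the distributed IMC as mixtures -/

/-- The randomness of one round: the delays, and a seed for the choice of every player. -/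
abbrev Seed (n : ℕ) : Type := (ℕ → ℝ) × (Fin n → unitInterval)

/-- The law of the randomness of one round. -/
noncomputable def seedLaw (n : ℕ) : Measure (Seed n) :=
  delayStream.prod (Measure.pi fun _ => volume)

instance : IsProbabilityMeasure (seedLaw n) := by unfold seedLaw; infer_instance

/-- The law of the randomness of all rounds. -/
noncomputable def seedsLaw (n : ℕ) : Measure (ℕ → Seed n) := Measure.infinitePi fun _ => seedLaw n

instance : IsProbabilityMeasure (seedsLaw n) := by unfold seedsLaw; infer_instance

section Mixture

/-- Functions that turn seeds into choices with the probabilities of the strategy profile. -/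
structure Responds (σ : M.toDistIMC.Profile)
    (act : ∀ i, List (LRec (n + 1)) → unitInterval → Fin (M.numAct i)) : Prop where
  measurable : ∀ i, Measurable (Function.uncurry (act i))
  law : ∀ i l a, M.toDistIMC.localLast i.succ l = nil →
    volume {u | act i l u = a} = actProb σ i l a

/-- A Markov kernel can be realized by a function of a uniformly distributed seed. -/
theorem exists_responds (σ : M.toDistIMC.Profile) : ∃ act, Responds σ act := by
  have key : ∀ i : Fin n, ∃ f : List (LRec (n + 1)) → unitInterval → Fin (M.numAct i),
      Measurable (Function.uncurry f) ∧ ∀ l a, M.toDistIMC.localLast i.succ l = nil →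
        volume {u | f l u = a} = actProb σ i l a := by
    intro i
    have : Nonempty (Fin (M.numAct i)) := ⟨⟨0, M.numAct_pos i⟩⟩
    have hm : Measurable (Function.invFun (M.choiceOf i)) := .of_discrete
    have : IsMarkovKernel ((σ i.succ).kernel.map (Function.invFun (M.choiceOf i))) :=
      Kernel.IsMarkovKernel.map _ hm
    obtain ⟨f, hf, hlaw⟩ := Kernel.exists_measurable_map_eq_unitInterval
      ((σ i.succ).kernel.map (Function.invFun (M.choiceOf i)))
    refine ⟨f, hf, fun l a hl => ?_⟩
    have h1 : volume {u | f l u = a} = (volume.map (f l)) {a} := by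
      have hfl : Measurable (f l) := hf.comp measurable_prodMk_left
      rw [Measure.map_apply hfl (measurableSet_singleton a)]
      rfl
    rw [h1, hlaw, Kernel.map_apply _ hm, Measure.map_apply hm (measurableSet_singleton a), actProb]
    refine measure_congr ?_
    have hav := (σ i.succ).available l
    rw [hl] at hav
    filter_upwards [hav] with d hd
    obtain ⟨a', rfl⟩ := available_nil.1 hd
    refine propext ?_
    change Function.invFun (M.choiceOf i) (M.choiceOf i a') = a ↔ M.choiceOf i a' = M.choiceOf i a
    rw [Function.leftInverse_invFun (M.choiceOf_injective i), (M.choiceOf_injective i).eq_iff]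
  choose act h1 h2 using key
  exact ⟨act, h1, h2⟩

variable (act : ∀ i, List (LRec (n + 1)) → unitInterval → Fin (M.numAct i))

/-- The action of player `i` after a sequence of observations, for given randomness: the player
simulates the rounds. -/
def pureAction (i : Fin n) : (ℕ → Seed n) → List (LRec (n + 1)) → ℝ →
    List (Fin (M.numObs i)) → Fin (M.numAct i)
  | ω, l, _, [] => act i l ((ω 0).2 i)
  | ω, l, t, y :: ys =>
    pureAction i (streamTail ω)
      (localRun (M.localRound i (act i l ((ω 0).2 i)) y) (l, t, (ω 0).1)).1
      (localRun (M.localRound i (act i l ((ω 0).2 i)) y) (l, t, (ω 0).1)).2.1 ys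

/-- The deterministic profile of the DEC-POMDP for given randomness. -/
noncomputable def pureProfile (ω : ℕ → Seed n) (l : Fin n → List (LRec (n + 1))) (t : ℝ) :
    M.Profile := fun i ys => PMF.pure (pureAction act i ω (l i) t ys)

/-- After one round, the deterministic profile is the one for the remaining randomness and for the
local histories and the time at the end of the round. -/
theorem pureProfile_after (ω : ℕ → Seed n) (l : Fin n → List (LRec (n + 1))) (t : ℝ)
    {a : M.GAct} (ha : ∀ i, act i (l i) ((ω 0).2 i) = a i) (o : M.GObs) :
    (pureProfile act ω l t).after o = pureProfile act (streamTail ω)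
      (run (M.roundEvents a o) (l, t, (ω 0).1)).1
      (run (M.roundEvents a o) (l, t, (ω 0).1)).2.1 := by
  funext i ys
  have h := localRun_roundEvents i a o (l, t, (ω 0).1)
  have h1 := congrArg (fun z => z.1) h
  have h2 := congrArg (fun z => z.2.1) h
  dsimp only at h1 h2
  simp only [Profile.after, pureProfile, pureAction]
  rw [ha i, h1, h2]

open Classical in
/-- The indicator of the event that the players choose `a` in the first round. -/
noncomputable def chooseInd (a : M.GAct) (l : Fin n → List (LRec (n + 1)))
    (u : Fin n → unitInterval) : ℝ≥0∞ := if ∀ i, act i (l i) (u i) = a i then 1 else 0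

theorem horizonValue_pureProfile (T : Finset (Fin M.numS)) (k : ℕ) (s : Fin M.numS)
    (ω : ℕ → Seed n) (l : Fin n → List (LRec (n + 1))) (t : ℝ) :
    horizonValue T (k + 1) s (pureProfile act ω l t) = if s ∈ T then 1 else
      ∑ a : M.GAct, chooseInd act a l (ω 0).2 * envAverage s a fun s' o =>
        horizonValue T k s' (pureProfile act (streamTail ω)
          (run (M.roundEvents a o) (l, t, (ω 0).1)).1
          (run (M.roundEvents a o) (l, t, (ω 0).1)).2.1) := by
  classical
  rw [horizonValue_succ]
  refine if_congr Iff.rfl rfl (Finset.sum_congr rfl fun a _ => ?_)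
  by_cases h : ∀ i, act i (l i) ((ω 0).2 i) = a i
  · congr 1
    · rw [chooseInd, if_pos h]
      refine Finset.prod_eq_one fun i _ => ?_
      simp only [pureProfile, pureAction]
      rw [h i, PMF.pure_apply, if_pos rfl]
    · simp_rw [pureProfile_after act ω l t h]
  · rw [chooseInd, if_neg h, zero_mul]
    obtain ⟨i, hi⟩ := not_forall.1 h
    rw [Finset.prod_eq_zero (Finset.mem_univ i), zero_mul]
    simp only [pureProfile, pureAction]
    rw [PMF.pure_apply, if_neg (Ne.symm hi)]

variable {act} {σ : M.toDistIMC.Profile}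

theorem Responds.measurable_chooseInd (h : Responds σ act) (a : M.GAct) :
    Measurable fun y : (Fin n → List (LRec (n + 1))) × (Fin n → unitInterval) =>
      chooseInd act a y.1 y.2 := by
  classical
  refine Measurable.ite ?_ measurable_const measurable_const
  have : {y : (Fin n → List (LRec (n + 1))) × (Fin n → unitInterval) |
      ∀ i, act i (y.1 i) (y.2 i) = a i} = ⋂ i, {y | act i (y.1 i) (y.2 i) = a i} := by
    ext y; simp
  rw [this]
  refine MeasurableSet.iInter fun i => ?_
  have hm : Measurable fun y : (Fin n → List (LRec (n + 1))) × (Fin n → unitInterval) =>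
      act i (y.1 i) (y.2 i) := by
    have hp : Measurable fun y : (Fin n → List (LRec (n + 1))) × (Fin n → unitInterval) =>
        (y.1 i, y.2 i) := ((measurable_pi_apply i).comp measurable_fst).prodMk
      ((measurable_pi_apply i).comp measurable_snd)
    exact (h.measurable i).comp hp
  exact hm (measurableSet_singleton (a i))

theorem Responds.measurable_horizonValue (h : Responds σ act) (T : Finset (Fin M.numS)) (k : ℕ)
    (s : Fin M.numS) :
    Measurable fun y : (ℕ → Seed n) × (Fin n → List (LRec (n + 1))) × ℝ =>
      horizonValue T k s (pureProfile act y.1 y.2.1 y.2.2) := by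
  induction k generalizing s with
  | zero => exact measurable_const
  | succ k ih =>
    simp only [horizonValue_pureProfile]
    split_ifs
    · exact measurable_const
    have h0 : Measurable fun y : (ℕ → Seed n) × (Fin n → List (LRec (n + 1))) × ℝ => y.1 0 :=
      (measurable_pi_apply 0).comp measurable_fst
    refine Finset.measurable_sum _ fun a _ => Measurable.mul ?_ ?_
    · exact (h.measurable_chooseInd a).comp (measurable_snd.fst.prodMk h0.snd)
    · refine measurable_envAverage s a fun s' o => ?_
      have hrun : Measurable fun y : (ℕ → Seed n) × (Fin n → List (LRec (n + 1))) × ℝ =>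
          run (M.roundEvents a o) (y.2.1, y.2.2, (y.1 0).1) :=
        (measurable_run _).comp (measurable_snd.fst.prodMk (measurable_snd.snd.prodMk h0.fst))
      exact (ih s').comp ((measurable_streamTail.comp measurable_fst).prodMk
        (hrun.fst.prodMk hrun.snd.fst))

theorem Responds.measurable_horizonValue_left (h : Responds σ act) (T : Finset (Fin M.numS))
    (k : ℕ) (s : Fin M.numS) (l : Fin n → List (LRec (n + 1))) (t : ℝ) :
    Measurable fun ω => horizonValue T k s (pureProfile act ω l t) := by
  have hp : Measurable fun ω : ℕ → Seed n => (ω, l, t) := measurable_id.prodMk measurable_const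
  exact (h.measurable_horizonValue T k s).comp hp

theorem lintegral_envAverage {α : Type*} [MeasurableSpace α] (μ : Measure α) (s : Fin M.numS)
    (a : M.GAct) {F : Fin M.numS → M.GObs → α → ℝ≥0∞} (hF : ∀ s' o, Measurable (F s' o)) :
    ∫⁻ x, envAverage s a (fun s' o => F s' o x) ∂μ
      = envAverage s a fun s' o => ∫⁻ x, F s' o x ∂μ := by
  unfold envAverage
  rw [lintegral_finsetSum _ fun s' _ => (Finset.measurable_sum _ fun o _ =>
    (hF s' o).const_mul _).const_mul _]
  refine Finset.sum_congr rfl fun s' _ => ?_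
  rw [lintegral_const_mul _ (Finset.measurable_sum _ fun o _ => (hF s' o).const_mul _),
    lintegral_finsetSum _ fun o _ => (hF s' o).const_mul _]
  congr 1
  exact Finset.sum_congr rfl fun o _ => lintegral_const_mul _ (hF s' o)

theorem Responds.lintegral_chooseInd (h : Responds σ act) (a : M.GAct)
    {l : Fin n → List (LRec (n + 1))} (hl : ∀ i, M.toDistIMC.localLast (Fin.succ i) (l i) = nil) :
    ∫⁻ u, chooseInd act a l u ∂(Measure.pi fun _ => volume) = ∏ i, actProb σ i (l i) (a i) := by
  classical
  have h1 : ∀ u, chooseInd act a l u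
      = (Set.univ.pi fun i => {v | act i (l i) v = a i}).indicator 1 u := by
    intro u
    simp [chooseInd, Set.indicator_apply, Set.mem_pi]
  simp_rw [h1]
  rw [lintegral_indicator_one, Measure.pi_pi]
  · exact Finset.prod_congr rfl fun i _ => h.law i (l i) (a i) (hl i)
  · refine MeasurableSet.univ_pi fun i => ?_
    exact ((h.measurable i).comp measurable_prodMk_left) (measurableSet_singleton (a i))

/-- The value of a profile of the distributed IMC is an average of values of deterministic profiles
of the DEC-POMDP: the times and the seeds are independent of the simulated process. -/
theorem Responds.lintegral_horizonValue (h : Responds σ act) (T : Finset (Fin M.numS)) (k : ℕ)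
    (s : Fin M.numS) {l : Fin n → List (LRec (n + 1))} (t : ℝ)
    (hl : ∀ i, M.toDistIMC.localLast (Fin.succ i) (l i) = nil) :
    ∫⁻ ω, horizonValue T k s (pureProfile act ω l t) ∂(seedsLaw n) = roundValue σ T k s l t := by
  induction k generalizing s l t with
  | zero => exact lintegral_zero
  | succ k ih =>
    have hm : ∀ s' (l : Fin n → List (LRec (n + 1))) (t : ℝ),
        Measurable fun ω => horizonValue T k s' (pureProfile act ω l t) := fun s' l t =>
      h.measurable_horizonValue_left T k s' l t
    have hm' : Measurable fun ω => horizonValue T (k + 1) s (pureProfile act ω l t) :=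
      h.measurable_horizonValue_left T (k + 1) s l t
    rw [roundValue_succ]
    unfold seedsLaw at ih ⊢
    rw [lintegral_infinitePi_cons _ hm']
    simp only [horizonValue_pureProfile]
    split_ifs with hs
    · simp
    have hroll : ∀ (x : Seed n) (ω : ℕ → Seed n), streamCons x ω 0 = x ∧
        streamTail (streamCons x ω) = ω := fun x ω => ⟨rfl, rfl⟩
    simp only [hroll]
    have hinner : ∀ x : Seed n, ∫⁻ ω, ∑ a : M.GAct, chooseInd act a l x.2 *
        envAverage s a (fun s' o => horizonValue T k s' (pureProfile act ω
          (run (M.roundEvents a o) (l, t, x.1)).1 (run (M.roundEvents a o) (l, t, x.1)).2.1))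
          ∂(Measure.infinitePi fun _ => seedLaw n)
        = ∑ a : M.GAct, envAverage s a (fun s' o => roundValue σ T k s'
          (run (M.roundEvents a o) (l, t, x.1)).1 (run (M.roundEvents a o) (l, t, x.1)).2.1) *
            chooseInd act a l x.2 := by
      intro x
      rw [lintegral_finsetSum _ fun a _ =>
        (measurable_envAverage s a fun s' o => hm s' _ _).const_mul _]
      refine Finset.sum_congr rfl fun a _ => ?_
      rw [lintegral_const_mul _ (measurable_envAverage s a fun s' o => hm s' _ _),
        lintegral_envAverage _ s a fun s' o => hm s' _ _, mul_comm]
      congr 2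
      funext s' o
      refine ih s' _ fun i => ?_
      have := congrArg Prod.fst (localRun_roundEvents i a o (l, t, x.1))
      dsimp only at this
      rw [this]
      exact localLast_localRound i _ _ _
    simp_rw [hinner]
    have hr : ∀ a : M.GAct, Measurable fun D : ℕ → ℝ => envAverage s a (fun s' o =>
        roundValue σ T k s' (run (M.roundEvents a o) (l, t, D)).1
          (run (M.roundEvents a o) (l, t, D)).2.1) := by
      intro a
      refine measurable_envAverage s a fun s' o => ?_
      have hrun : Measurable fun D : ℕ → ℝ => run (M.roundEvents a o) (l, t, D) :=
        (measurable_run _).comp (measurable_const.prodMk (measurable_const.prodMk measurable_id))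
      exact (measurable_roundValue σ T k s').comp (hrun.fst.prodMk hrun.snd.fst)
    have hc : ∀ a, Measurable fun u => chooseInd act a l u := fun a =>
      (h.measurable_chooseInd a).comp measurable_prodMk_left
    have hmul : ∀ a : M.GAct, Measurable fun x : Seed n => envAverage s a (fun s' o =>
        roundValue σ T k s' (run (M.roundEvents a o) (l, t, x.1)).1
          (run (M.roundEvents a o) (l, t, x.1)).2.1) * chooseInd act a l x.2 := fun a =>
      ((hr a).comp measurable_fst).mul ((hc a).comp measurable_snd)
    rw [lintegral_finsetSum _ fun a _ => hmul a]
    refine Finset.sum_congr rfl fun a _ => ?_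
    unfold seedLaw
    rw [lintegral_prod_mul (hr a).aemeasurable (hc a).aemeasurable, h.lintegral_chooseInd a hl,
      mul_comm]

end Mixture

/-- Every reach probability of the distributed IMC is a reach probability of the DEC-POMDP. -/
theorem exists_profile_of_toDistIMC (T : Finset (Fin M.numS)) (σ : M.toDistIMC.Profile)
    (δ : M.toDistIMC.Scheduler) : ∃ τ : M.Profile, M.playLaw τ (M.reach T)
      = M.toDistIMC.playLaw σ δ (M.toDistIMC.reach (M.targets T)) := by
  obtain ⟨act, h⟩ := exists_responds σ
  have hm : ∀ k, Measurable fun ω =>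
      horizonValue T k M.init (pureProfile act ω (fun _ => []) 0) := fun k =>
    h.measurable_horizonValue_left T k M.init _ 0
  have hpr : ∀ τ : M.Profile, IsProbabilityMeasure (M.playLaw τ) := fun τ => by
    unfold DecPOMDP.playLaw; infer_instance
  have : IsProbabilityMeasure (M.toDistIMC.playLaw σ δ) := by
    unfold DistIMC.playLaw; infer_instance
  have hint : M.toDistIMC.playLaw σ δ (M.toDistIMC.reach (M.targets T))
      = ∫⁻ ω, ⨆ k, horizonValue T k M.init (pureProfile act ω (fun _ => []) 0) ∂(seedsLaw n) := by
    rw [toDistIMC_playLaw_reach, lintegral_iSup hm fun k m hkm ω =>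
      monotone_horizonValue T M.init _ hkm]
    exact iSup_congr fun k => (h.lintegral_horizonValue T k M.init 0 fun _ => rfl).symm
  have hfin : ∫⁻ ω, ⨆ k, horizonValue T k M.init (pureProfile act ω (fun _ => []) 0)
      ∂(seedsLaw n) ≠ ∞ := by
    rw [← hint]; exact measure_ne_top _ _
  -- An average lies between two of the averaged values.
  obtain ⟨ω, hω⟩ := exists_le_lintegral (Measurable.iSup hm).aemeasurable (μ := seedsLaw n)
  obtain ⟨ω', hω'⟩ := exists_lintegral_le hfin
  obtain ⟨τ, hτ⟩ := exists_iSup_horizonValue_eq T M.init hω hω' fun τ => by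
    rw [← playLaw_reach]; exact measure_ne_top _ _
  exact ⟨τ, by rw [playLaw_reach, hτ, hint]⟩

end DecPOMDP

namespace DecPOMDP

variable {n : ℕ} (M : DecPOMDP n)

/-! ### Decoding observations from the times of ticks -/

/-- Lists of discrete data form a discrete space. -/
instance discreteMeasurableSpace_list {α : Type*} [MeasurableSpace α] [Countable α]
    [DiscreteMeasurableSpace α] : DiscreteMeasurableSpace (List α) :=
  ⟨fun _ => measurableSet_list.2 fun _ => .of_discrete⟩

/-- The state of the decoder of player `i`: the observations of the completed rounds, the number of
ticks of the current round that came at the time of its first tick, and the time of the last first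
tick. -/
abbrev DecState (i : Fin n) : Type := (List (Fin (M.numObs i)) × ℕ) × ℝ

/-- The observation after which `c` ticks come before the pause, as a list of length one. -/
def obsOfCount (i : Fin n) (c : ℕ) : List (Fin (M.numObs i)) :=
  (List.finRange (M.numObs i)).filter fun y => (y : ℕ) + 1 = c

open Classical in
/-- The effect of a record on the decoder. The state `nil` marks the end of a round. -/
noncomputable def decodeStep (i : Fin n) (z : M.DecState i) (r : LRec (n + 1)) : M.DecState i :=
  if r.2.2.1 = nil then ((z.1.1 ++ M.obsOfCount i z.1.2, 0), z.2)
  else if r.2.1 = .act (lTick (M.obsSets (i + 1))) then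
    if z.1.2 = 0 then ((z.1.1, 1), r.2.2.2)
    else if r.2.2.2 = z.2 then ((z.1.1, z.1.2 + 1), z.2) else z
  else z

/-- The decoder of player `i`. -/
noncomputable def decode (i : Fin n) (l : List (LRec (n + 1))) : M.DecState i :=
  l.foldl (M.decodeStep i) (([], 0), 0)

variable {M}

theorem obsOfCount_succ (i : Fin n) (y : Fin (M.numObs i)) : M.obsOfCount i (y + 1) = [y] := by
  have h : (fun x : Fin (M.numObs i) => decide ((x : ℕ) + 1 = y + 1)) = fun x => x == y := by
    funext x
    rw [Bool.eq_iff_iff]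
    simp [Fin.ext_iff]
  rw [obsOfCount, h, List.filter_beq, List.count_eq_one_of_mem (List.nodup_finRange _)
    (List.mem_finRange y)]
  rfl

theorem decode_snoc (i : Fin n) (l : List (LRec (n + 1))) (r : LRec (n + 1)) :
    M.decode i (l ++ [r]) = M.decodeStep i (M.decode i l) r := by
  simp [decode, List.foldl_append]

theorem measurable_decode (i : Fin n) : Measurable (M.decode i) := by
  refine measurable_list_foldl (f := M.decodeStep i) ?_ _
  have hz : Measurable fun p : M.DecState i × LRec (n + 1) => p.1.1 :=
    measurable_fst.comp measurable_fst
  have hτ : Measurable fun p : M.DecState i × LRec (n + 1) => p.1.2 :=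
    measurable_snd.comp measurable_fst
  have hr : Measurable fun p : M.DecState i × LRec (n + 1) => p.2.2.2.2 := by fun_prop
  have hs : Measurable fun p : M.DecState i × LRec (n + 1) => p.2.2.2.1 := by fun_prop
  have ha : Measurable fun p : M.DecState i × LRec (n + 1) => p.2.2.1 := by fun_prop
  have hd : ∀ {β : Type} [MeasurableSpace β] (f : List (Fin (M.numObs i)) × ℕ → β),
      Measurable fun p : M.DecState i × LRec (n + 1) => f p.1.1 := fun f =>
    (Measurable.of_discrete (f := f)).comp hz
  unfold decodeStep
  refine Measurable.ite (hs (measurableSet_singleton nil)) ?_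
    (Measurable.ite (ha (measurableSet_singleton _)) (Measurable.ite ?_ ?_
      (Measurable.ite (measurableSet_eq_fun hr hτ) ?_ measurable_fst)) measurable_fst)
  · exact (hd fun z => (z.1 ++ M.obsOfCount i z.2, 0)).prodMk hτ
  · exact hz (.of_discrete (s := {z | z.2 = 0}))
  · exact (hd fun z => (z.1, 1)).prodMk hr
  · exact (hd fun z => (z.1, z.2 + 1)).prodMk hτ

/-- The events do not end a round. -/
def Inner (es : List (LocalEvent n)) : Prop := ∀ e ∈ es, ∀ r ∈ e, r.2.2 ≠ nil

/-- The events contain no tick for player `i`. -/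
def Untold (M : DecPOMDP n) (i : Fin n) (es : List (LocalEvent n)) : Prop :=
  ∀ e ∈ es, ∀ r ∈ e, r.2.1 ≠ .act (lTick (M.obsSets (i + 1)))

theorem pos_localRun (es : List (LocalEvent n)) {x : LocalCfg n} (h : ∀ k, 0 < x.2.2 k) :
    (∀ k, 0 < (localRun es x).2.2 k) ∧ x.2.1 ≤ (localRun es x).2.1 := by
  induction es generalizing x with
  | nil => exact ⟨h, le_rfl⟩
  | cons e es ih =>
    cases e with
    | none =>
      obtain ⟨h1, h2⟩ := ih (x := localStep x none) fun k => h (k + 1)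
      refine ⟨h1, le_trans ?_ h2⟩
      change x.2.1 ≤ x.2.1 + x.2.2 0
      linarith [h 0]
    | some r => exact ih (x := localStep x (some r)) h

/-- The decoder reacts only to ticks and to the end of a round. -/
theorem decode_of_untold (i : Fin n) {es : List (LocalEvent n)} (h : Inner es)
    (h' : M.Untold i es) (x : LocalCfg n) :
    M.decode i (localRun es x).1 = M.decode i x.1 := by
  induction es generalizing x with
  | nil => rfl
  | cons e es ih =>
    have hstep := ih (fun e' he' => h e' (List.mem_cons_of_mem _ he'))
      (fun e' he' => h' e' (List.mem_cons_of_mem _ he')) (localStep x e)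
    change M.decode i (localRun es (localStep x e)).1 = _
    rw [hstep]
    cases e with
    | none => rfl
    | some r =>
      obtain ⟨c, a, s⟩ := r
      have h1 := h _ List.mem_cons_self _ rfl
      have h2 := h' _ List.mem_cons_self _ rfl
      simp only [localStep, decode_snoc, decodeStep]
      rw [if_neg h1, if_neg h2]

/-- Ticks that come after the pause do not count. -/
theorem decode_of_lt (i : Fin n) {es : List (LocalEvent n)} (h : Inner es) {x : LocalCfg n}
    (hx : ∀ k, 0 < x.2.2 k) (hc : (M.decode i x.1).1.2 ≠ 0) (ht : (M.decode i x.1).2 < x.2.1) :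
    M.decode i (localRun es x).1 = M.decode i x.1 := by
  induction es generalizing x with
  | nil => rfl
  | cons e es ih =>
    have h' : Inner es := fun e' he' => h e' (List.mem_cons_of_mem _ he')
    change M.decode i (localRun es (localStep x e)).1 = _
    cases e with
    | none =>
      refine ih h' (fun k => hx (k + 1)) hc (lt_trans ht ?_)
      change x.2.1 < x.2.1 + x.2.2 0
      linarith [hx 0]
    | some r =>
      obtain ⟨c, a, s⟩ := r
      have h1 := h _ List.mem_cons_self _ rfl
      have hd : M.decode i (localStep x (some (c, a, s))).1 = M.decode i x.1 := by
        simp only [localStep, decode_snoc, decodeStep]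
        rw [if_neg h1]
        split_ifs with h2 h3
        · exact absurd h3 ht.ne'
        · rfl
        · rfl
      rw [ih h' (x := localStep x (some (c, a, s))) hx (by rwa [hd]) (by rwa [hd]), hd]

theorem inner_localTell (i : Fin n) (x K : BTree) : Inner (M.localTell i x K) := by
  induction K with
  | nil => simp [localTell, Inner]
  | cons k K _ ih =>
    intro e he r hr
    rw [localTell] at he
    rcases List.mem_cons.1 he with rfl | he
    · obtain rfl := Option.mem_some_iff.1 hr
      simp
    · split_ifs at he
      · rcases List.mem_cons.1 he with rfl | he
        · simp at hr
        · exact ih e he r hr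
      · exact ih e he r hr

/-- The number of ticks before the pause is the index of the observation plus one. -/
theorem decode_localTell (i : Fin n) (y : Fin (M.numObs i)) {x : LocalCfg n}
    (hx : ∀ k, 0 < x.2.2 k) (k : ℕ) (hk : k ≤ y) {os : List (Fin (M.numObs i))} {τ : ℝ}
    (hd : M.decode i x.1 = ((os, k), τ)) (hτ : k ≠ 0 → τ = x.2.1) :
    ∃ τ', M.decode i (localRun (M.localTell i (ofFin y)
        (dropT (ofFin : Fin (M.numObs i) → BTree) k)) x).1 = ((os, (y : ℕ) + 1), τ') ∧
      τ' < (localRun (M.localTell i (ofFin y)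
        (dropT (ofFin : Fin (M.numObs i) → BTree) k)) x).2.1 := by
  obtain ⟨m, hm⟩ := Nat.exists_eq_add_of_le hk
  induction m generalizing k x τ with
  | zero =>
    obtain rfl : k = y := by omega
    have hb : sameBits (ofFin (⟨y, y.2⟩ : Fin (M.numObs i))) (ofFin y) = true :=
      (sameBits_ofNat _ _).2 rfl
    rw [dropT_of_lt _ y.2, localTell, if_pos hb]
    set K := dropT (ofFin : Fin (M.numObs i) → BTree) (y + 1)
    set r : Choice × Label (n + 1) × BTree := (M.playerChoice i nil (cons (ofFin ⟨y, y.2⟩) K),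
      .act (lTick (M.obsSets (i + 1))), cons nil K) with hr
    have h1 : M.decode i (localStep (localStep x (some r)) none).1 = ((os, (y : ℕ) + 1), x.2.1) := by
      simp only [localStep, hr, decode_snoc, decodeStep, hd]
      by_cases hy : (y : ℕ) = 0
      · simp [hy]
      · simp [hy, hτ hy]
    have hpos : ∀ k, 0 < (localStep (localStep x (some r)) none).2.2 k := fun k => hx (k + 1)
    have hlt : x.2.1 < (localStep (localStep x (some r)) none).2.1 := by
      change x.2.1 < x.2.1 + x.2.2 0
      linarith [hx 0]
    refine ⟨x.2.1, ?_, ?_⟩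
    · change M.decode i (localRun _ (localStep (localStep x (some r)) none)).1 = _
      rw [decode_of_lt i (inner_localTell i _ _) hpos (by rw [h1]; simp) (by rwa [h1]), h1]
    · exact lt_of_lt_of_le hlt (pos_localRun (M.localTell i (ofFin y) K) hpos).2
  | succ m ih =>
    have hlt : k < M.numObs i := by have := y.2; omega
    have hb : ¬ sameBits (ofFin (⟨k, hlt⟩ : Fin (M.numObs i))) (ofFin y) = true := by
      intro h
      have h' : k = y := (sameBits_ofNat _ _).1 h
      omega
    rw [dropT_of_lt _ hlt, localTell, if_neg hb]
    refine ih (x := localStep x (some _)) hx (k + 1) (by omega) (τ := x.2.1) ?_ (fun _ => rfl)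
      (by omega)
    simp only [localStep, decode_snoc, decodeStep, hd]
    by_cases hk0 : k = 0
    · simp [hk0]
    · simp [hk0, hτ hk0]

theorem inner_localPoll (i : Fin n) (r : BTree) :
    Inner (M.localPoll i r) ∧ M.Untold i (M.localPoll i r) := by
  induction r with
  | nil => exact ⟨by simp [localPoll, Inner], by simp [localPoll, Untold]⟩
  | cons x r _ ih =>
    have key : ∀ e ∈ M.localPoll i (cons x r), ∀ r ∈ e,
        r.2.2 ≠ nil ∧ r.2.1 ≠ .act (lTick (M.obsSets (i + 1))) := by
      intro e he r hr
      rw [localPoll] at he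
      rcases List.mem_cons.1 he with rfl | he
      · obtain rfl := Option.mem_some_iff.1 hr
        exact ⟨by simp, fun h => lNext_ne_lTick _ _ (Label.act.inj h)⟩
      · exact ⟨ih.1 e he r hr, ih.2 e he r hr⟩
    exact ⟨fun e he r hr => (key e he r hr).1, fun e he r hr => (key e he r hr).2⟩

theorem inner_localActs (i : Fin n) (x : Fin (M.numAct i)) :
    Inner (M.localActs i x) ∧ M.Untold i (M.localActs i x) := by
  have key : ∀ e ∈ M.localActs i x, ∀ r ∈ e,
      r.2.2 ≠ nil ∧ r.2.1 ≠ .act (lTick (M.obsSets (i + 1))) := by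
    intro e he r hr
    obtain ⟨j, -, hj⟩ := List.mem_flatMap.1 he
    rcases List.mem_append.1 hj with hj | hj
    · split_ifs at hj
      · exact ⟨(inner_localPoll i _).1 e hj r hr, (inner_localPoll i _).2 e hj r hr⟩
      · simp at hj
    · obtain rfl := List.mem_singleton.1 hj
      simp at hr
  exact ⟨fun e he r hr => (key e he r hr).1, fun e he r hr => (key e he r hr).2⟩

/-- The decoder of a player recovers the observation of the round. -/
theorem decode_localRound (i : Fin n) (a : Fin (M.numAct i)) (y : Fin (M.numObs i))
    {x : LocalCfg n} (hx : ∀ k, 0 < x.2.2 k) {os : List (Fin (M.numObs i))} {τ : ℝ}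
    (hd : M.decode i x.1 = ((os, 0), τ)) :
    ∃ τ', M.decode i (localRun (M.localRound i a y) x).1 = ((os ++ [y], 0), τ') := by
  obtain ⟨L, L', hL⟩ := List.append_of_mem (List.mem_finRange i)
  have hnd := List.nodup_finRange n
  rw [hL, List.nodup_middle, List.nodup_cons, List.mem_append, not_or] at hnd
  obtain ⟨⟨hi, hi'⟩, -⟩ := hnd
  have hother : ∀ L'' : List (Fin n), i ∉ L'' → ∀ e ∈ L''.flatMap (fun j => if j = i then
      M.localTell i (ofFin y) (ofRange (M.numObs i)) else [none]), ∀ r ∈ e, False := by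
    intro L'' hL'' e he r hr
    obtain ⟨j, hj, he⟩ := List.mem_flatMap.1 he
    rw [if_neg (by rintro rfl; exact hL'' hj)] at he
    obtain rfl := List.mem_singleton.1 he
    simp at hr
  set g : Fin n → List (LocalEvent n) := fun j => if j = i then
      M.localTell i (ofFin y) (ofRange (M.numObs i)) else [none] with hg
  have hsplit : M.localRound i a y = (([none] ++ ([M.startEvent i a] ++ (M.localActs i a ++
      ([none] ++ ([none] ++ L.flatMap g))))) ++ (M.localTell i (ofFin y) (ofRange (M.numObs i)) ++
        (L'.flatMap g ++ [M.endEvent i]))) := by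
    rw [localRound, localObs, hL, List.flatMap_append, List.flatMap_cons, ← hg, if_pos rfl]
    simp only [List.append_assoc]
  have hpre : ∀ e ∈ [none] ++ ([M.startEvent i a] ++ (M.localActs i a ++
      ([none] ++ ([none] ++ L.flatMap g)))), ∀ r ∈ e,
      r.2.2 ≠ nil ∧ r.2.1 ≠ .act (lTick (M.obsSets (i + 1))) := by
    intro e he r hr
    simp only [List.mem_append, List.mem_singleton] at he
    rcases he with rfl | rfl | he | rfl | rfl | he
    · simp at hr
    · obtain rfl := Option.mem_some_iff.1 hr
      exact ⟨by simp, fun h => lGo_ne_lTick _ (Label.act.inj h)⟩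
    · exact ⟨(inner_localActs i a).1 e he r hr, (inner_localActs i a).2 e he r hr⟩
    · simp at hr
    · simp at hr
    · exact (hother L hi e he r hr).elim
  rw [hsplit, localRun_append, localRun_append, localRun_append]
  set x₁ := localRun ([none] ++ ([M.startEvent i a] ++ (M.localActs i a ++
      ([none] ++ ([none] ++ L.flatMap g))))) x with hx₁
  have h1 : M.decode i x₁.1 = ((os, 0), τ) := by
    rw [hx₁, decode_of_untold i (fun e he r hr => (hpre e he r hr).1)
      (fun e he r hr => (hpre e he r hr).2), hd]
  have hp1 : ∀ k, 0 < x₁.2.2 k := (pos_localRun _ hx).1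
  obtain ⟨τ', h2, ht2⟩ := decode_localTell i y hp1 0 (Nat.zero_le _) h1 fun h => absurd rfl h
  rw [← ofRange_eq] at h2 ht2
  set x₂ := localRun (M.localTell i (ofFin y) (ofRange (M.numObs i))) x₁
  have hp2 : ∀ k, 0 < x₂.2.2 k := (pos_localRun _ hp1).1
  have h3 : M.decode i (localRun (L'.flatMap g) x₂).1 = ((os, (y : ℕ) + 1), τ') := by
    rw [decode_of_lt i (fun e he r hr => (hother L' hi' e he r hr).elim) hp2 (by rw [h2]; simp)
      (by rwa [h2]), h2]
  refine ⟨τ', ?_⟩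
  change M.decode i (localStep (localRun (L'.flatMap g) x₂) (M.endEvent i)).1 = _
  simp only [endEvent, localStep, decode_snoc, decodeStep, h3, if_true, obsOfCount_succ]

/-! ### Simulating the DEC-POMDP -/

theorem exists_available (m : IMC) (s : BTree) : ∃ d, m.Available s d := by
  by_cases h : ∃ e ∈ m.trans, e.1 = s
  · obtain ⟨e, he, hs⟩ := h
    exact ⟨.trans e, he, hs⟩
  · exact ⟨.bot, fun e he hs => h ⟨e, he, hs⟩⟩

theorem measurable_localLast (G : DistIMC n) (j : Fin n) : Measurable (G.localLast j) :=
  measurable_getLast (f := fun o : Option (LRec n) => match o with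
    | none => (G.mod j).init
    | some r => r.2.2.1) (by fun_prop)

/-- The strategy that makes some available choice in every state. -/
noncomputable def anyStrategy (G : DistIMC n) (j : Fin n) : G.Strategy j where
  kernel := Kernel.deterministic (fun l => (exists_available (G.mod j) (G.localLast j l)).choose)
    ((Measurable.of_discrete (f := fun s => (exists_available (G.mod j) s).choose)).comp
      (measurable_localLast G j))
  markov := inferInstance
  available h := by
    rw [Kernel.deterministic_apply, ae_dirac_eq, Filter.eventually_pure]
    exact (exists_available (G.mod j) (G.localLast j h)).choose_spec

/-- The law of the choice of player `i` in the state `s` after the observations `os`. -/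
noncomputable def simChoice (τ : M.Profile) (i : Fin n)
    (z : BTree × List (Fin (M.numObs i))) : Measure Choice :=
  if z.1 = nil then (τ i z.2).toMeasure.map (M.choiceOf i)
  else Measure.dirac (exists_available (M.playerModule i) z.1).choose

instance (τ : M.Profile) (i : Fin n) (z : BTree × List (Fin (M.numObs i))) :
    IsProbabilityMeasure (simChoice τ i z) := by
  unfold simChoice
  split_ifs
  · exact Measure.isProbabilityMeasure_map (Measurable.of_discrete).aemeasurable
  · infer_instance

/-- The strategy of player `i` that follows the profile `τ`. -/
noncomputable def simStrategy (τ : M.Profile) (i : Fin n) : M.toDistIMC.Strategy i.succ where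
  kernel :=
    { toFun := fun l => simChoice τ i (M.toDistIMC.localLast i.succ l, (M.decode i l).1.1)
      measurable' := (Measurable.of_discrete (f := simChoice τ i)).comp
        ((measurable_localLast M.toDistIMC i.succ).prodMk
          (measurable_decode i).fst.fst) }
  markov := ⟨fun l => inferInstanceAs (IsProbabilityMeasure (simChoice τ i _))⟩
  available l := by
    change ∀ᵐ d ∂(simChoice τ i _), (M.playerModule i).Available _ d
    rw [simChoice]
    split_ifs with h
    · refine (ae_map_iff (Measurable.of_discrete).aemeasurable .of_discrete).2 ?_
      refine Filter.Eventually.of_forall fun a => ?_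
      dsimp only at h
      rw [h]
      exact available_nil.2 ⟨a, rfl⟩
    · rw [ae_dirac_eq, Filter.eventually_pure]
      exact (exists_available (M.playerModule i) _).choose_spec

/-- The profile of the distributed IMC that follows the profile `τ` of the DEC-POMDP. -/
noncomputable def simProfile (τ : M.Profile) : M.toDistIMC.Profile :=
  Fin.cons (anyStrategy M.toDistIMC 0) (simStrategy τ)

theorem actProb_simProfile (τ : M.Profile) (i : Fin n) {l : List (LRec (n + 1))}
    (hl : M.toDistIMC.localLast i.succ l = nil) (a : Fin (M.numAct i)) :
    actProb (simProfile τ) i l a = τ i (M.decode i l).1.1 a := by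
  change simChoice τ i (M.toDistIMC.localLast i.succ l, (M.decode i l).1.1) _ = _
  rw [simChoice, if_pos hl, Measure.map_apply .of_discrete .of_discrete]
  have : M.choiceOf i ⁻¹' {M.choiceOf i a} = {a} := by
    ext a'
    exact (M.choiceOf_injective i).eq_iff
  rw [this, PMF.toMeasure_apply_singleton _ _ (measurableSet_singleton a)]

/-- For the profile that simulates `τ`, the value of the rounds is the value of `τ`, whatever the
delays are: almost surely they are positive, so that the players decode their observations. -/
theorem roundValue_simProfile (τ : M.Profile) (T : Finset (Fin M.numS)) (k : ℕ) (s : Fin M.numS)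
    {l : Fin n → List (LRec (n + 1))} (t : ℝ)
    (hl : ∀ i, M.toDistIMC.localLast (Fin.succ i) (l i) = nil)
    (hc : ∀ i, (M.decode i (l i)).1.2 = 0) : roundValue (simProfile τ) T k s l t
      = horizonValue T k s fun i os => τ i ((M.decode i (l i)).1.1 ++ os) := by
  induction k generalizing s l t with
  | zero => rfl
  | succ k ih =>
    rw [roundValue_succ, horizonValue_succ]
    refine if_congr Iff.rfl rfl (Finset.sum_congr rfl fun a _ => ?_)
    congr 1
    · refine Finset.prod_congr rfl fun i _ => ?_
      rw [actProb_simProfile τ i (hl i), List.append_nil]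
    · have key : ∀ᵐ D ∂delayStream, envAverage s a (fun s' o => roundValue (simProfile τ) T k s'
          (run (M.roundEvents a o) (l, t, D)).1 (run (M.roundEvents a o) (l, t, D)).2.1)
          = envAverage s a fun s' o => horizonValue T k s'
            (Profile.after (fun i os => τ i ((M.decode i (l i)).1.1 ++ os)) o) := by
        filter_upwards [ae_pos_delayStream] with D hD
        congr 1
        funext s' o
        have hrun : ∀ i, (run (M.roundEvents a o) (l, t, D)).1 i
            = (localRun (M.localRound i (a i) (o i)) (l i, t, D)).1 := fun i =>
          congrArg Prod.fst (localRun_roundEvents i a o (l, t, D))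
        have hdec : ∀ i, ∃ τ', M.decode i ((run (M.roundEvents a o) (l, t, D)).1 i)
            = (((M.decode i (l i)).1.1 ++ [o i], 0), τ') := by
          intro i
          rw [hrun]
          refine decode_localRound i (a i) (o i) hD (τ := (M.decode i (l i)).2) ?_
          rw [← hc i]
        rw [ih s' _ (fun i => by rw [hrun]; exact localLast_localRound i _ _ _) fun i => by
          obtain ⟨τ', h⟩ := hdec i
          rw [h]]
        congr 1
        funext i os
        obtain ⟨τ', h⟩ := hdec i
        rw [h, Profile.after, List.append_assoc, List.singleton_append]
      rw [lintegral_congr_ae key, lintegral_const, measure_univ, mul_one]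

/-- Every reach probability of the DEC-POMDP is a reach probability of the distributed IMC. -/
theorem toDistIMC_playLaw_simProfile (T : Finset (Fin M.numS)) (τ : M.Profile)
    (δ : M.toDistIMC.Scheduler) : M.toDistIMC.playLaw (simProfile τ) δ
      (M.toDistIMC.reach (M.targets T)) = M.playLaw τ (M.reach T) := by
  rw [toDistIMC_playLaw_reach, playLaw_reach]
  exact iSup_congr fun k => roundValue_simProfile τ T k M.init 0 (fun _ => rfl) fun _ => rfl

end DecPOMDP

/-! ### Functions computable in polynomial time -/

/-- The function `f` is computed by a program whose running time is bounded by a polynomial in the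
size of the input. Several arguments are passed as one tree. -/
def PolyTime (f : BTree → BTree) : Prop :=
  ∃ (p : Prog) (q : Polynomial ℕ), ∀ x, ∃ t, Runs p x (f x) t ∧ t ≤ q.eval x.size

theorem Runs.size_le {p : Prog} {x y : BTree} {t : ℕ} (h : Runs p x y t) : y.size ≤ t := by
  induction h with
  | skip x => exact le_rfl
  | nil x => cases x <;> simp [size]
  | hd x => cases x <;> simp only [BTree.hd, size]; · rfl
            omega
  | tl x => cases x <;> simp only [BTree.tl, size]; · rfl
            omega
  | pair _ _ ih ih' => simp only [size]; rename_i x _ _ _ _ _ _; cases x <;> simp only [size] <;> omega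
  | seq _ _ _ ih => omega
  | condTrue _ _ _ ih => omega
  | condFalse _ _ _ ih => omega
  | loopDone _ _ => omega
  | loopStep _ _ _ _ _ ih => omega

theorem Polynomial.eval_nat_mono (q : Polynomial ℕ) : Monotone fun m => q.eval m := by
  intro a b h
  simp only [Polynomial.eval_eq_sum, Polynomial.sum]
  exact Finset.sum_le_sum fun k _ => Nat.mul_le_mul_left _ (Nat.pow_le_pow_left h k)

namespace PolyTime

variable {f g c : BTree → BTree}

theorem size_le (hf : PolyTime f) : ∃ q : Polynomial ℕ, ∀ x, (f x).size ≤ q.eval x.size := by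
  obtain ⟨p, q, h⟩ := hf
  refine ⟨q, fun x => ?_⟩
  obtain ⟨t, h1, h2⟩ := h x
  exact h1.size_le.trans h2

theorem id : PolyTime fun x => x := ⟨.skip, .X, fun x => ⟨_, .skip x, by simp⟩⟩

theorem comp (hg : PolyTime g) (hf : PolyTime f) : PolyTime fun x => g (f x) := by
  obtain ⟨p, q, h⟩ := hf
  obtain ⟨p', q', h'⟩ := hg
  refine ⟨.seq p p', q + q'.comp q + 1, fun x => ?_⟩
  obtain ⟨t, h1, h2⟩ := h x
  obtain ⟨u, h3, h4⟩ := h' (f x)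
  refine ⟨_, .seq h1 h3, ?_⟩
  have := q'.eval_nat_mono (h1.size_le.trans h2)
  simp only [Polynomial.eval_add, Polynomial.eval_comp, Polynomial.eval_one]
  dsimp only at this
  omega

theorem hd (hf : PolyTime f) : PolyTime fun x => (f x).hd :=
  comp (g := BTree.hd) ⟨.hd, .X, fun x => ⟨_, .hd x, by simp⟩⟩ hf

theorem tl (hf : PolyTime f) : PolyTime fun x => (f x).tl :=
  comp (g := BTree.tl) ⟨.tl, .X, fun x => ⟨_, .tl x, by simp⟩⟩ hf

theorem cons (hf : PolyTime f) (hg : PolyTime g) : PolyTime fun x => .cons (f x) (g x) := by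
  obtain ⟨p, q, h⟩ := hf
  obtain ⟨p', q', h'⟩ := hg
  refine ⟨.pair p p', q + q' + .X, fun x => ?_⟩
  obtain ⟨t, h1, h2⟩ := h x
  obtain ⟨u, h3, h4⟩ := h' x
  refine ⟨_, .pair h1 h3, ?_⟩
  simp only [Polynomial.eval_add, Polynomial.eval_X]
  omega

theorem const (y : BTree) : PolyTime fun _ => y := by
  induction y with
  | nil => exact ⟨.nil, .X, fun x => ⟨_, .nil x, by simp⟩⟩
  | cons a b ha hb => exact ha.cons hb

theorem ite (hc : PolyTime c) (hf : PolyTime f) (hg : PolyTime g) :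
    PolyTime fun x => if c x = nil then f x else g x := by
  obtain ⟨p, q, h⟩ := hc
  obtain ⟨p', q', h'⟩ := hf
  obtain ⟨p'', q'', h''⟩ := hg
  refine ⟨.cond p p'' p', q + q' + q'' + .X, fun x => ?_⟩
  obtain ⟨s, h1, h2⟩ := h x
  obtain ⟨t, h3, h4⟩ := h' x
  obtain ⟨u, h5, h6⟩ := h'' x
  simp only [Polynomial.eval_add, Polynomial.eval_X]
  cases hcx : c x with
  | nil => exact ⟨_, .condFalse (hcx ▸ h1) (by simpa using h3), by omega⟩
  | cons a b => exact ⟨_, .condTrue (hcx ▸ h1) (by simpa using h5), by omega⟩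

/-! ### Iteration over lists -/

/-- Iteration over a list. The loop works on trees `cons l (cons x acc)`, where `l` is the rest of
the list, `x` the input and `acc` the accumulator. The time is polynomial because the size of the
accumulator grows by an amount that depends on the entry of the list and on `x` only. -/
theorem foldl {L a₀ : BTree → BTree} {f : BTree → BTree → BTree → BTree} (hL : PolyTime L)
    (h₀ : PolyTime a₀) (hf : PolyTime fun z => f z.hd z.tl.hd z.tl.tl)
    (Inv : BTree → BTree → Prop) (hInv : ∀ x, Inv x (a₀ x)) (s : Polynomial ℕ)
    (hs : ∀ a x acc, Inv x acc → Inv x (f a x acc) ∧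
      (f a x acc).size ≤ acc.size + s.eval (a.size + x.size)) :
    PolyTime fun x => (L x).toList.foldl (fun acc a => f a x acc) (a₀ x) := by
  have hbody : PolyTime fun w => .cons w.hd.tl (.cons w.tl.hd (f w.hd.hd w.tl.hd w.tl.tl)) :=
    id.hd.tl.cons (id.tl.hd.cons (hf.comp (id.hd.hd.cons id.tl)))
  obtain ⟨p, q, hp⟩ := hbody
  obtain ⟨p₀, q₀, hp₀⟩ := hL.cons (id.cons h₀)
  obtain ⟨p₁, q₁, hp₁⟩ := id.tl.tl
  have loop : ∀ (x : BTree) (R A : ℕ), x.size ≤ R → ∀ l acc, l.size ≤ R → Inv x acc →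
      acc.size + l.len * s.eval (R + R) ≤ A → ∃ t,
        Runs (.loop .hd p) (.cons l (.cons x acc))
          (.cons .nil (.cons x (l.toList.foldl (fun acc a => f a x acc) acc))) t ∧
        t ≤ (l.len + 1) * (2 * (R + R + A + 2) + q.eval (R + R + A + 2)) := by
    intro x R A hx l
    induction l with
    | nil =>
      intro acc hl _ hA
      refine ⟨_, .loopDone (.hd _), ?_⟩
      simp only [len, size] at hl hA ⊢
      omega
    | cons a l _ ih =>
      intro acc hl hi hA
      obtain ⟨hi', hg⟩ := hs a x acc hi
      obtain ⟨u, hu, hu'⟩ := hp (.cons (.cons a l) (.cons x acc))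
      simp only [len, size] at hl hA hu'
      have hmono : s.eval (a.size + x.size) ≤ s.eval (R + R) :=
        s.eval_nat_mono (by omega : a.size + x.size ≤ R + R)
      obtain ⟨t, ht, ht'⟩ := ih (f a x acc) (by omega) hi' (by rw [add_mul] at hA; omega)
      refine ⟨_, .loopStep (.hd _) hu ht, ?_⟩
      have hacc : acc.size ≤ A := le_trans (Nat.le_add_right _ _) hA
      have hq : q.eval (a.size + l.size + 1 + (x.size + acc.size + 1) + 1)
          ≤ q.eval (R + R + A + 2) := q.eval_nat_mono (by omega)
      simp only [len, size]
      rw [add_mul (l.len + 1) 1, one_mul]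
      omega
  let B : Polynomial ℕ := .X + .X * s.comp (.X + .X)
  let W : Polynomial ℕ := .X + .X + B + 2
  let V : Polynomial ℕ := (.X + 1) * (2 * W + q.comp W)
  let U : Polynomial ℕ := .X + V + 1 + q₁.comp V + 1
  refine ⟨.seq (.seq p₀ (.loop .hd p)) p₁, U.comp q₀, fun x => ?_⟩
  obtain ⟨t₀, ht₀, ht₀'⟩ := hp₀ x
  have hR := ht₀.size_le.trans ht₀'
  set R := q₀.eval x.size
  simp only [size] at hR
  have hlen : ∀ l : BTree, l.len ≤ l.size := by
    intro l
    induction l with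
    | nil => simp [len]
    | cons a l _ ih => simp only [len, size]; omega
  have hA : (a₀ x).size + (L x).len * s.eval (R + R) ≤ B.eval R := by
    simp only [B, Polynomial.eval_add, Polynomial.eval_mul, Polynomial.eval_X,
      Polynomial.eval_comp]
    have := hlen (L x)
    exact Nat.add_le_add (by omega) (Nat.mul_le_mul_right _ (by omega))
  obtain ⟨t, ht, ht'⟩ := loop x R (B.eval R) (by omega) (L x) (a₀ x) (by omega) (hInv x) hA
  obtain ⟨t₁, ht₁, ht₁'⟩ := hp₁ (.cons .nil (.cons x ((L x).toList.foldl (fun acc a => f a x acc)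
    (a₀ x))))
  refine ⟨_, .seq (.seq ht₀ ht) ht₁, ?_⟩
  have hW : R + R + B.eval R + 2 = W.eval R := by simp [W]
  have hV : t ≤ V.eval R := by
    refine ht'.trans ?_
    rw [hW]
    simp only [V, Polynomial.eval_add, Polynomial.eval_mul, Polynomial.eval_X,
      Polynomial.eval_comp, Polynomial.eval_one, Polynomial.eval_ofNat]
    have := hlen (L x)
    exact Nat.mul_le_mul_right _ (by omega)
  have h1 : t₁ ≤ q₁.eval (V.eval R) :=
    ht₁'.trans (q₁.eval_nat_mono (ht.size_le.trans hV))
  rw [Polynomial.eval_comp]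
  change _ ≤ U.eval R
  simp only [U, Polynomial.eval_add, Polynomial.eval_X, Polynomial.eval_comp, Polynomial.eval_one]
  omega

end PolyTime

namespace BTree

theorem hd_cons (a b : BTree) : (cons a b).hd = a := rfl

theorem tl_cons (a b : BTree) : (cons a b).tl = b := rfl

theorem revAppend_eq (acc x : BTree) :
    revAppend acc x = x.toList.foldl (fun acc a => cons a acc) acc := by
  induction x generalizing acc with
  | nil => rfl
  | cons a b _ ih => rw [revAppend, ih]; rfl

theorem toList_revAppend (acc x : BTree) :
    (revAppend acc x).toList = x.toList.reverse ++ acc.toList := by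
  induction x generalizing acc with
  | nil => rfl
  | cons a b _ ih => rw [revAppend, ih, toList, toList]; simp

theorem size_revAppend (acc x : BTree) : (revAppend acc x).size + 1 = acc.size + x.size := by
  induction x generalizing acc with
  | nil => rfl
  | cons a b _ ih => rw [revAppend, ih]; simp only [size]; omega

/-- Concatenation of lists. -/
def append (x y : BTree) : BTree := revAppend y (revAppend nil x)

theorem append_ofList (l l' : List BTree) : append (ofList l) (ofList l') = ofList (l ++ l') := by
  rw [← ofList_toList (append _ _), append, toList_revAppend, toList_revAppend]
  simp [toList]

/-- The concatenation of the lists `f a` for the entries `a` of a list. -/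
def bind (x : BTree) (f : BTree → BTree) : BTree := ofList (x.toList.flatMap fun a => (f a).toList)

theorem bind_ofList {α β : Type*} (l : List α) {g : α → BTree} {f : BTree → BTree}
    {h : α → List β} {e : β → BTree} (H : ∀ a, f (g a) = ofList ((h a).map e)) :
    bind (ofList (l.map g)) f = ofList ((l.flatMap h).map e) := by
  rw [bind, toList_ofList, List.flatMap_map, List.map_flatMap]
  simp only [H, toList_ofList]

theorem bind_single {α : Type*} (l : List α) {g : α → BTree} {f : BTree → BTree} {e : α → BTree}
    (H : ∀ a, f (g a) = ofList [e a]) : bind (ofList (l.map g)) f = ofList (l.map e) := by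
  have := bind_ofList l (h := fun a => [a]) (e := e) H
  simpa using this

theorem bind_eq (x : BTree) (f : BTree → BTree) : bind x f
    = revAppend nil (x.toList.foldl (fun acc a => revAppend acc (f a)) nil) := by
  have key : ∀ (l : List BTree) acc, (l.foldl (fun acc a => revAppend acc (f a)) acc).toList
      = (l.flatMap fun a => (f a).toList).reverse ++ acc.toList := by
    intro l
    induction l with
    | nil => intro acc; rfl
    | cons a l ih => intro acc; rw [List.foldl_cons, ih, toList_revAppend]; simp
  rw [← ofList_toList (revAppend _ _), toList_revAppend, key]
  simp [bind, toList]

end BTree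

namespace PolyTime

variable {f g x y : BTree → BTree}

theorem revAppend (hf : PolyTime f) (hg : PolyTime g) :
    PolyTime fun x => BTree.revAppend (f x) (g x) := by
  simp only [revAppend_eq]
  refine foldl hg hf (f := fun a _ acc => .cons a acc) (id.hd.cons id.tl.tl) (fun _ _ => True)
    (fun _ => trivial) (.X + 1) fun a x acc _ => ⟨trivial, ?_⟩
  simp [size]
  omega

theorem append (hf : PolyTime f) (hg : PolyTime g) : PolyTime fun x => BTree.append (f x) (g x) :=
  hg.revAppend ((const nil).revAppend hf)

theorem bind {F : BTree → BTree → BTree} (hf : PolyTime f)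
    (hF : PolyTime fun z => F z.hd z.tl) : PolyTime fun x => BTree.bind (f x) fun a => F a x := by
  simp only [bind_eq]
  obtain ⟨q, hq⟩ := hF.size_le
  refine (const nil).revAppend (foldl hf (const nil)
    (f := fun a x acc => BTree.revAppend acc (F a x)) ?_ (fun _ _ => True) (fun _ => trivial)
    (q.comp (.X + 1)) fun a x acc _ => ⟨trivial, ?_⟩)
  · exact id.tl.tl.revAppend (hF.comp (id.hd.cons id.tl.hd))
  · have h1 := size_revAppend acc (F a x)
    have h2 := hq (.cons a x)
    simp only [BTree.hd, BTree.tl, size] at h2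
    simp only [Polynomial.eval_comp, Polynomial.eval_add, Polynomial.eval_X, Polynomial.eval_one]
    omega

theorem foldr {L a₀ : BTree → BTree} {f : BTree → BTree → BTree → BTree} (hL : PolyTime L)
    (h₀ : PolyTime a₀) (hf : PolyTime fun z => f z.hd z.tl.hd z.tl.tl) (s : Polynomial ℕ)
    (hs : ∀ a x acc, (f a x acc).size ≤ acc.size + s.eval (a.size + x.size)) :
    PolyTime fun x => (L x).toList.foldr (fun a acc => f a x acc) (a₀ x) := by
  have h : ∀ x, (L x).toList.foldr (fun a acc => f a x acc) (a₀ x)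
      = (BTree.revAppend nil (L x)).toList.foldl (fun acc a => f a x acc) (a₀ x) := by
    intro x
    rw [toList_revAppend, toList, List.append_nil, List.foldl_reverse]
  simp only [h]
  exact foldl ((const nil).revAppend hL) h₀ hf (fun _ _ => True) (fun _ => trivial) s
    fun a x acc _ => ⟨trivial, hs a x acc⟩

/-- The list of the iterates of a function that does not increase the size. -/
theorem iterate {L a₀ : BTree → BTree} {f : BTree → BTree} (hL : PolyTime L)
    (h₀ : PolyTime a₀) (hf : PolyTime f) (hs : ∀ a, (f a).size ≤ a.size) :
    PolyTime fun x => ofList (List.iterate f (a₀ x) (L x).len) := by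
  obtain ⟨q, hq⟩ := h₀.size_le
  have h : ∀ x, ofList (List.iterate f (a₀ x) (L x).len) = BTree.revAppend nil
      ((L x).toList.foldl (fun acc _ => BTree.cons (f acc.hd) (.cons acc.hd acc.tl))
        (.cons (a₀ x) nil)).tl := by
    intro x
    have key : ∀ l a o, ((toList l).foldl (fun acc _ => BTree.cons (f acc.hd) (.cons acc.hd acc.tl))
        (.cons a o)).tl.toList = (List.iterate f a l.len).reverse ++ o.toList := by
      intro l
      induction l with
      | nil => intro a o; rfl
      | cons b l _ ih =>
        intro a o
        rw [toList, List.foldl_cons, len, List.iterate, hd_cons, tl_cons, ih]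
        simp [toList]
    rw [← ofList_toList (BTree.revAppend _ _), toList_revAppend, key]
    simp [toList]
  simp only [h]
  refine (const nil).revAppend (tl (foldl hL (h₀.cons (const nil))
    (f := fun _ _ acc => BTree.cons (f acc.hd) (.cons acc.hd acc.tl)) ?_
    (fun x acc => acc.hd.size ≤ (a₀ x).size) (fun _ => le_rfl) (q + 4) fun a x acc hi => ⟨?_, ?_⟩))
  · exact (hf.comp id.tl.tl.hd).cons (id.tl.tl.hd.cons id.tl.tl.tl)
  · exact (hs _).trans hi
  · have h1 := hs acc.hd
    have h2 := hi.trans (hq x)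
    have h3 := q.eval_nat_mono (Nat.le_add_left x.size a.size)
    simp only [Polynomial.eval_add, Polynomial.eval_ofNat] at h3 ⊢
    cases acc with
    | nil => simp only [BTree.hd, BTree.tl, size] at h1 h2 ⊢; omega
    | cons b c => simp only [BTree.hd, BTree.tl, size] at h1 h2 ⊢; omega

theorem suffixes (hf : PolyTime f) : PolyTime fun x => ofList (f x).suffixes := by
  have h : ∀ x : BTree, x.suffixes = List.iterate BTree.tl x (BTree.cons nil x).len := by
    intro x
    induction x with
    | nil => rfl
    | cons a b _ ih => rw [BTree.suffixes, ih]; rfl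
  simp only [h]
  refine iterate ((const nil).cons hf) hf id.tl fun a => ?_
  cases a <;> simp only [BTree.tl, size] <;> omega

/-- The splits of a list, as trees. -/
theorem splits {f g h : BTree → BTree} (hf : PolyTime f) (hg : PolyTime g) (hh : PolyTime h) :
    PolyTime fun x => ofList ((BTree.splits (f x) (g x) (h x)).map fun t =>
      .cons t.1 (.cons t.2.1 t.2.2)) := by
  let F : BTree → BTree := fun w => if w.tl.hd = nil then w else
    .cons (.cons w.tl.hd.hd w.hd) (.cons w.tl.hd.tl w.tl.tl.tl)
  have key : ∀ acc a b : BTree, (BTree.splits acc a b).map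
      (fun t => BTree.cons t.1 (.cons t.2.1 t.2.2))
      = List.iterate F (.cons acc (.cons a b)) a.len := by
    intro acc a
    induction a generalizing acc with
    | nil => intro b; rfl
    | cons x a _ ih =>
      intro b
      rw [BTree.splits, List.map_cons, ih, len, List.iterate]
      rfl
  simp only [key]
  refine iterate hg (hf.cons (hg.cons hh)) ?_ fun w => ?_
  · exact ite id.tl.hd id ((id.tl.hd.hd.cons id.hd).cons (id.tl.hd.tl.cons id.tl.tl.tl))
  · rcases w with _ | ⟨acc, _ | ⟨_ | ⟨x, a⟩, _ | ⟨y, b⟩⟩⟩ <;>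
      simp [F, BTree.hd, BTree.tl, size] <;> omega

theorem sameBits (hf : PolyTime f) (hg : PolyTime g) :
    PolyTime fun x => ofBool (BTree.sameBits (f x) (g x)) := by
  -- The accumulator is `nil` after a difference, and `cons nil` of the rest of the second list
  -- otherwise.
  let F : BTree → BTree → BTree := fun a acc =>
    if acc = nil then nil else if acc.tl = nil then nil else
      if a = nil then (if acc.tl.hd = nil then .cons nil acc.tl.tl else nil)
      else (if acc.tl.hd = nil then nil else .cons nil acc.tl.tl)
  have hnil : ∀ l : List BTree, l.foldl (fun acc a => F a acc) nil = nil := by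
    intro l
    induction l with
    | nil => rfl
    | cons a l ih => rw [List.foldl_cons]; exact ih
  have hF0 : ∀ a, F a (.cons nil nil) = nil := fun a => by simp [F, BTree.tl]
  have hF1 : ∀ a b m, F a (.cons nil (.cons b m))
      = if decide (a = nil) == decide (b = nil) then .cons nil m else nil := by
    intro a b m
    by_cases ha : a = nil <;> by_cases hb : b = nil <;> simp [F, BTree.tl, BTree.hd, ha, hb]
  have h : ∀ a b : BTree, ofBool (BTree.sameBits a b)
      = (fun r : BTree => if r = nil then nil else if r.tl = nil then .cons nil nil else nil)
        (a.toList.foldl (fun acc a => F a acc) (.cons nil b)) := by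
    intro a
    induction a with
    | nil => intro b; cases b <;> rfl
    | cons a l _ ih =>
      intro b
      rw [toList, List.foldl_cons]
      rcases b with _ | ⟨b, m⟩
      · rw [hF0, hnil]
        rfl
      · rw [hF1, BTree.sameBits]
        cases decide (a = nil) == decide (b = nil)
        · rw [if_neg (by simp), hnil]
          rfl
        · rw [if_pos rfl, ← ih, Bool.true_and]
  simp only [h]
  have hF : PolyTime fun x => (f x).toList.foldl (fun acc a => F a acc) (.cons nil (g x)) := by
    refine foldl hf ((const nil).cons hg) (f := fun a _ acc => F a acc) ?_ (fun _ _ => True)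
      (fun _ => trivial) 2 fun a x acc _ => ⟨trivial, ?_⟩
    · exact ite id.tl.tl (const nil) (ite id.tl.tl.tl (const nil)
        (ite id.hd (ite id.tl.tl.tl.hd ((const nil).cons id.tl.tl.tl.tl) (const nil))
          (ite id.tl.tl.tl.hd (const nil) ((const nil).cons id.tl.tl.tl.tl))))
    · have hor : F a acc = nil ∨ F a acc = .cons nil acc.tl.tl := by
        simp only [F]
        split_ifs <;> simp
      rw [Polynomial.eval_ofNat]
      rcases hor with hr | hr <;> rw [hr] <;> rcases acc with _ | ⟨_, _ | ⟨c, d⟩⟩ <;>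
        simp only [BTree.tl, size] <;> omega
  exact ite hF (const nil) (ite hF.tl (const _) (const nil))

end PolyTime

namespace BTree

variable {α β : Type*}

theorem bind_ofList_self {l : List BTree} {f : BTree → BTree} {h : BTree → List β} {e : β → BTree}
    (H : ∀ a, f a = ofList ((h a).map e)) : bind (ofList l) f = ofList ((l.flatMap h).map e) := by
  have := bind_ofList l (g := fun a => a) H
  rwa [List.map_id'] at this

theorem size_hd_le (x : BTree) : x.hd.size ≤ x.size := by
  cases x <;> simp only [hd, size] <;> omega

theorem size_tl_le (x : BTree) : x.tl.size ≤ x.size := by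
  cases x <;> simp only [tl, size] <;> omega

theorem tellOne_eq (v x K z : BTree) : tellOne v x K z = K.toList.foldr (fun k acc =>
    cons v (if ofBool (sameBits k x) = nil then acc else cons nil acc)) z := by
  induction K with
  | nil => rfl
  | cons k K _ ih =>
    rw [tellOne, toList, List.foldr_cons, ← ih]
    cases sameBits k x <;> simp [ofBool]

theorem size_tellOne_le (v x K z : BTree) :
    (tellOne v x K z).size ≤ z.size + K.size * (v.size + 3) := by
  induction K with
  | nil => exact Nat.le_add_right _ _
  | cons k K _ ih =>
    rw [tellOne]
    have h1 : (K.size + 1) * (v.size + 3) ≤ (k.size + K.size + 1) * (v.size + 3) :=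
      Nat.mul_le_mul_right _ (by omega)
    rw [add_mul, one_mul] at h1
    split_ifs <;> simp only [size] <;> omega

/-- A triple as a tree. -/
def ofTriple (t : BTree × BTree × BTree) : BTree := cons t.1 (cons t.2.1 t.2.2)

theorem script_eq (acc o b : BTree) : script o b
    = ((splits acc o b).map ofTriple).foldr (fun t z =>
      tellOne (lTick t.tl.tl.tl) t.tl.hd.hd t.tl.tl.hd z) nil := by
  induction o generalizing acc b with
  | nil => rfl
  | cons x o _ ih =>
    rw [script, splits, List.map_cons, List.foldr_cons, ← ih]
    rfl

end BTree

namespace PolyTime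

variable {f g : BTree → BTree}

theorem tellOne {v y K z : BTree → BTree} (hv : PolyTime v) (hy : PolyTime y) (hK : PolyTime K)
    (hz : PolyTime z) : PolyTime fun x => BTree.tellOne (v x) (y x) (K x) (z x) := by
  obtain ⟨q, hq⟩ := hv.size_le
  simp only [tellOne_eq]
  refine foldr hK hz (f := fun k x acc => .cons (v x)
    (if ofBool (BTree.sameBits k (y x)) = nil then acc else .cons nil acc)) ?_ (q + 3)
    fun a x acc => ?_
  · exact (hv.comp id.tl.hd).cons (ite (id.hd.sameBits (hy.comp id.tl.hd)) id.tl.tl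
      ((const nil).cons id.tl.tl))
  · have h1 := hq x
    have h2 := q.eval_nat_mono (Nat.le_add_left x.size a.size)
    simp only [Polynomial.eval_add, Polynomial.eval_ofNat] at h2 ⊢
    split_ifs <;> simp only [size] <;> omega

theorem script (hf : PolyTime f) (hg : PolyTime g) :
    PolyTime fun x => BTree.script (f x) (g x) := by
  have h : ∀ x, BTree.script (f x) (g x) = (ofList ((BTree.splits nil (f x) (g x)).map
      ofTriple)).toList.foldr (fun t z =>
        BTree.tellOne (lTick t.tl.tl.tl) t.tl.hd.hd t.tl.tl.hd z) nil := by
    intro x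
    rw [toList_ofList, ← script_eq]
  simp only [h]
  refine foldr ((const nil).splits hf hg) (const nil)
    (f := fun t _ z => BTree.tellOne (lTick t.tl.tl.tl) t.tl.hd.hd t.tl.tl.hd z) ?_
    (.X * (.X + 7)) fun a x acc => ?_
  · exact tellOne ((const _).cons id.hd.tl.tl.tl) id.hd.tl.hd.hd id.hd.tl.tl.hd id.tl.tl
  · refine (size_tellOne_le _ _ _ _).trans (Nat.add_le_add_left ?_ _)
    have h1 := (size_tl_le a.tl.tl).trans ((size_tl_le a.tl).trans (size_tl_le a))
    have h2 := (size_hd_le a.tl.tl).trans ((size_tl_le a.tl).trans (size_tl_le a))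
    simp only [Polynomial.eval_mul, Polynomial.eval_add, Polynomial.eval_X, Polynomial.eval_ofNat]
    refine Nat.mul_le_mul (by omega) ?_
    simp only [lTick, tag, size]
    omega

end PolyTime

namespace DecPOMDP

/-! ### The reduction as a function on trees -/

/-- The tree of a transition. -/
def transTree (a b c : BTree) : BTree := cons a (cons b (cons c nil))

/-- The list with one entry. -/
def single (a : BTree) : BTree := cons a nil

/-- The endpoints of a list of transitions. -/
def endpointsTree (R : BTree) : BTree := bind R fun e => cons e.hd (cons e.tl.tl.hd nil)

/-- The tree of a module. -/
def moduleTree (s₀ acts R D : BTree) : BTree :=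
  cons (cons s₀ (append (endpointsTree R) (endpointsTree D)))
    (cons s₀ (cons acts (cons R (cons D nil))))

/-- The tree of the action transitions of a player. -/
def playerTransTree (A O u v : BTree) : BTree :=
  append (append (append
    (bind (ofList A.tl.suffixes) fun r => single (transTree nil lGo (cons r O)))
    (bind (ofList A.tl.suffixes) fun r => if r = nil then nil else
      single (transTree (cons r O) u (cons r.tl O))))
    (bind (ofList O.suffixes) fun q => if q = nil then nil else
      single (transTree (cons nil q) v (cons nil q.tl))))
    (single (transTree (cons nil nil) lGo nil))

/-- The tree of the module of a player, given by the suffixes of the lists of action sets and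
observation sets that start at this player. -/
def playerTree (a o : BTree) : BTree :=
  moduleTree nil (cons (lNext a.tl) (cons (lTick o.tl) (cons lGo nil)))
    (playerTransTree a.hd o.hd (lNext a.tl) (lTick o.tl)) nil

/-- The tree of the action transitions of the environment, given by the states, the tables of
transition and observation probabilities, the action sets and the observation sets. -/
def envTransTree (S P O A B : BTree) : BTree :=
  append (append
    (bind S fun s => single (transTree (stReady s) lGo (stPoll s nil A)))
    (bind P fun r => bind (ofList ((splits nil r.tl.hd A).map ofTriple)) fun w =>
      bind (ofList w.tl.tl.hd.suffixes) fun rem => if rem.tl = nil then nil else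
        single (transTree (stPoll r.hd w.hd (cons rem w.tl.tl.tl)) (lNext w.tl.tl.tl)
          (stPoll r.hd w.hd (cons rem.tl w.tl.tl.tl)))))
    (bind O fun r => bind (ofList (script r.tl.tl.tl.hd B).suffixes) fun z =>
      if z = nil then
        single (transTree (stTell r.tl.tl.hd r.tl.tl.tl.hd nil) lGo (stCheck r.tl.tl.hd)) else
      if z.hd = nil then nil else single (transTree (stTell r.tl.tl.hd r.tl.tl.tl.hd z) z.hd
        (stTell r.tl.tl.hd r.tl.tl.tl.hd z.tl)))

/-- The tree of the delay transitions of the environment. -/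
def envDelaysTree (S P O A B : BTree) : BTree :=
  append (append (append (append
    (bind S fun s => single (transTree (stCheck s) (ofRat 1) (stReady s)))
    (bind P fun r => bind (ofList ((splits nil r.tl.hd A).map ofTriple)) fun w =>
      bind (ofList w.tl.tl.hd.suffixes) fun rem => if rem = nil then nil else
        single (transTree (stPoll r.hd w.hd (cons rem w.tl.tl.tl)) (ofRat 1)
          (stPoll r.hd (cons rem.hd w.hd) w.tl.tl.tl))))
    (bind P fun r => if r.tl.tl.tl.hd.hd = nil then nil else
      single (transTree (stPoll r.hd (revAppend nil r.tl.hd) nil) r.tl.tl.tl.hd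
        (stObs r.hd r.tl.hd r.tl.tl.hd))))
    (bind O fun r => if r.tl.tl.tl.tl.hd.hd = nil then nil else
      single (transTree (stObs r.hd r.tl.hd r.tl.tl.hd) r.tl.tl.tl.tl.hd
        (stTell r.tl.tl.hd r.tl.tl.tl.hd (script r.tl.tl.tl.hd B)))))
    (bind O fun r => bind (ofList (script r.tl.tl.tl.hd B).suffixes) fun z =>
      if z = nil then nil else if z.hd = nil then
        single (transTree (stTell r.tl.tl.hd r.tl.tl.tl.hd z) (ofRat 1)
          (stTell r.tl.tl.hd r.tl.tl.tl.hd z.tl)) else nil)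

/-- The tree of the set of all actions. -/
def allActsTree (A B : BTree) : BTree :=
  cons lGo (bind (ofList ((splits nil A B).map ofTriple)) fun z =>
    cons (lNext z.tl.hd.tl) (cons (lTick z.tl.tl.tl) nil))

/-- The tree of the list of target states. -/
def targetsTree (T A : BTree) : BTree :=
  bind T fun s => single (cons (stCheck s) (bind A fun _ => single nil))

/-- The reduction: it maps the tree of a DEC-POMDP with a target set to the tree of a distributed
IMC with a target set. -/
def reduction (x : BTree) : BTree :=
  cons (cons
    (moduleTree (stCheck x.tl.hd) (allActsTree x.tl.tl.hd x.tl.tl.tl.hd)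
      (envTransTree x.hd x.tl.tl.tl.tl.hd x.tl.tl.tl.tl.tl.hd x.tl.tl.hd x.tl.tl.tl.hd)
      (envDelaysTree x.hd x.tl.tl.tl.tl.hd x.tl.tl.tl.tl.tl.hd x.tl.tl.hd x.tl.tl.tl.hd))
    (bind (ofList ((splits nil x.tl.tl.hd x.tl.tl.tl.hd).map ofTriple)) fun z =>
      single (playerTree z.tl.hd z.tl.tl)))
    (targetsTree x.tl.tl.tl.tl.tl.tl.hd x.tl.tl.hd)

theorem polyTime_moduleTree {s₀ acts R D : BTree → BTree} (hs : PolyTime s₀) (ha : PolyTime acts)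
    (hR : PolyTime R) (hD : PolyTime D) :
    PolyTime fun x => moduleTree (s₀ x) (acts x) (R x) (D x) := by
  have h : ∀ {f : BTree → BTree}, PolyTime f → PolyTime fun x => endpointsTree (f x) := fun hf =>
    hf.bind (PolyTime.id.hd.hd.cons (PolyTime.id.hd.tl.tl.hd.cons (.const nil)))
  exact (hs.cons ((h hR).append (h hD))).cons (hs.cons (ha.cons (hR.cons (hD.cons (.const nil)))))

theorem polyTime_playerTransTree : PolyTime fun x =>
    playerTransTree x.hd.hd x.tl.hd (lNext x.hd.tl) (lTick x.tl.tl) := by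
  unfold playerTransTree single transTree lNext lTick
  repeat' first
    | exact .const _
    | exact .id
    | apply PolyTime.hd
    | apply PolyTime.tl
    | apply PolyTime.cons
    | apply PolyTime.append
    | apply PolyTime.bind
    | apply PolyTime.ite
    | apply PolyTime.suffixes

theorem polyTime_playerTree : PolyTime fun x => playerTree x.hd x.tl :=
  polyTime_moduleTree (.const nil) (((PolyTime.const _).cons PolyTime.id.hd.tl).cons
    (((PolyTime.const _).cons PolyTime.id.tl.tl).cons (.const _))) polyTime_playerTransTree
    (.const nil)

theorem polyTime_envTransTree : PolyTime fun x => envTransTree x.hd x.tl.tl.tl.tl.hd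
    x.tl.tl.tl.tl.tl.hd x.tl.tl.hd x.tl.tl.tl.hd := by
  unfold envTransTree single transTree stReady stPoll stTell stCheck lNext
  repeat' first
    | exact .const _
    | exact .id
    | apply PolyTime.hd
    | apply PolyTime.tl
    | apply PolyTime.cons
    | apply PolyTime.append
    | apply PolyTime.bind
    | apply PolyTime.ite
    | apply PolyTime.suffixes
    | apply PolyTime.splits
    | apply PolyTime.script

theorem polyTime_envDelaysTree : PolyTime fun x => envDelaysTree x.hd x.tl.tl.tl.tl.hd
    x.tl.tl.tl.tl.tl.hd x.tl.tl.hd x.tl.tl.tl.hd := by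
  unfold envDelaysTree single transTree stReady stPoll stTell stCheck stObs
  repeat' first
    | exact .const _
    | exact .id
    | apply PolyTime.hd
    | apply PolyTime.tl
    | apply PolyTime.cons
    | apply PolyTime.append
    | apply PolyTime.bind
    | apply PolyTime.ite
    | apply PolyTime.suffixes
    | apply PolyTime.splits
    | apply PolyTime.script
    | apply PolyTime.revAppend

theorem polyTime_allActsTree : PolyTime fun x => allActsTree x.tl.tl.hd x.tl.tl.tl.hd := by
  unfold allActsTree lNext lTick
  repeat' first
    | exact .const _
    | exact .id
    | apply PolyTime.hd
    | apply PolyTime.tl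
    | apply PolyTime.cons
    | apply PolyTime.append
    | apply PolyTime.bind
    | apply PolyTime.ite
    | apply PolyTime.suffixes
    | apply PolyTime.splits

theorem polyTime_targetsTree :
    PolyTime fun x => targetsTree x.tl.tl.tl.tl.tl.tl.hd x.tl.tl.hd := by
  unfold targetsTree single stCheck
  repeat' first
    | exact .const _
    | exact .id
    | apply PolyTime.hd
    | apply PolyTime.tl
    | apply PolyTime.cons
    | apply PolyTime.append
    | apply PolyTime.bind

theorem polyTime_reduction : PolyTime reduction :=
  ((polyTime_moduleTree ((PolyTime.const _).cons PolyTime.id.tl.hd) polyTime_allActsTree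
    polyTime_envTransTree polyTime_envDelaysTree).cons
      (((PolyTime.const nil).splits PolyTime.id.tl.tl.hd PolyTime.id.tl.tl.tl.hd).bind
        ((polyTime_playerTree.comp (PolyTime.id.hd.tl.hd.cons PolyTime.id.hd.tl.tl)).cons
          (.const nil)))).cons polyTime_targetsTree

end DecPOMDP

namespace DecPOMDP

/-! ### Correctness of the reduction -/

theorem bind_suffixes {α : Type*} {x : BTree} {f : BTree → BTree} {h : BTree → List α}
    {e : α → BTree} (H : ∀ a, f a = ofList ((h a).map e)) :
    bind (ofList x.suffixes) f = ofList ((x.suffixes.flatMap h).map e) := bind_ofList_self H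

theorem endpointsTree_encTrans (R : List (BTree × BTree × BTree)) :
    endpointsTree (ofList (R.map encTrans)) = ofList (endpoints R) := by
  have := bind_ofList R (g := encTrans) (f := fun e => cons e.hd (cons e.tl.tl.hd nil))
    (h := fun e => [e.1, e.2.2]) (e := id) fun a => rfl
  rw [List.map_id] at this
  exact this

theorem endpointsTree_encDelay (D : List (BTree × ℚ≥0 × BTree)) :
    endpointsTree (ofList (D.map encDelay)) = ofList (endpoints D) := by
  have := bind_ofList D (g := encDelay) (f := fun e => cons e.hd (cons e.tl.tl.hd nil))
    (h := fun e => [e.1, e.2.2]) (e := id) fun a => rfl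
  rw [List.map_id] at this
  exact this

theorem moduleTree_eq (s₀ : BTree) (acts : List BTree) (R : List (BTree × BTree × BTree))
    (D : List (BTree × ℚ≥0 × BTree)) :
    moduleTree s₀ (ofList acts) (ofList (R.map encTrans)) (ofList (D.map encDelay))
      = listIMCTree s₀ acts R D := by
  rw [moduleTree, endpointsTree_encTrans, endpointsTree_encDelay, append_ofList]
  rfl

theorem playerTransTree_eq (A O u v : BTree) :
    playerTransTree A O u v = ofList ((playerTrans A O u v).map encTrans) := by
  have h1 : bind (ofList A.tl.suffixes) (fun r => single (transTree nil lGo (cons r O)))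
      = ofList ((A.tl.suffixes.flatMap fun r => [(nil, lGo, cons r O)]).map encTrans) :=
    bind_suffixes fun _ => rfl
  have h2 : bind (ofList A.tl.suffixes) (fun r => if r = nil then nil else
      single (transTree (cons r O) u (cons r.tl O)))
      = ofList ((A.tl.suffixes.flatMap fun r => if r = nil then [] else
        [(cons r O, u, cons r.tl O)]).map encTrans) :=
    bind_suffixes fun r => by split_ifs <;> rfl
  have h3 : bind (ofList O.suffixes) (fun q => if q = nil then nil else
      single (transTree (cons nil q) v (cons nil q.tl)))
      = ofList ((O.suffixes.flatMap fun q => if q = nil then [] else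
        [(cons nil q, v, cons nil q.tl)]).map encTrans) :=
    bind_suffixes fun r => by split_ifs <;> rfl
  have h4 : single (transTree (cons nil nil) lGo nil)
      = ofList ([(cons nil nil, lGo, nil)].map encTrans) := rfl
  rw [playerTransTree, h1, h2, h3, h4, append_ofList, append_ofList, append_ofList, playerTrans,
    List.map_eq_flatMap (l := A.tl.suffixes)]
  simp only [List.map_append]

variable {n : ℕ} (M : DecPOMDP n)

/-- A row of the table of transition probabilities. -/
def rowP (r : Fin M.numS × M.GAct × Fin M.numS) : BTree :=
  ofList [ofFin r.1, ofTuple r.2.1, ofFin r.2.2, ofRat (M.P r.1 r.2.1 r.2.2)]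

/-- A row of the table of observation probabilities. -/
def rowO (r : Fin M.numS × M.GAct × Fin M.numS × M.GObs) : BTree :=
  ofList [ofFin r.1, ofTuple r.2.1, ofFin r.2.2.1, ofTuple r.2.2.2,
    ofRat (M.O r.1 r.2.1 r.2.2.1 r.2.2.2)]

variable {M}

theorem encode_eq (T : Finset (Fin M.numS)) : M.encode T = ofList [ofRange M.numS, ofFin M.init,
    M.actSets 0, M.obsSets 0, ofList (M.transRows.map M.rowP), ofList (M.obsRows.map M.rowO),
    ofList (((List.finRange M.numS).filter (· ∈ T)).map ofFin)] := by
  simp only [encode, transRows, obsRows, List.map_flatMap, List.map_map]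
  rfl

theorem hd_ofRat_eq_nil {q : ℚ≥0} : (ofRat q).hd = nil ↔ q = 0 := by
  rw [ofRat, hd_cons, ofNat_eq_nil, ← not_iff_not, ← ne_eq, NNRat.num_ne_zero]

/-- The transitions of the environment are computed correctly. -/
theorem envTransTree_eq : envTransTree (ofRange M.numS) (ofList (M.transRows.map M.rowP))
    (ofList (M.obsRows.map M.rowO)) (M.actSets 0) (M.obsSets 0)
      = ofList (M.envTrans.map encTrans) := by
  rw [envTransTree, envTrans, List.map_append, List.map_append, ← append_ofList, ← append_ofList]
  congr 2
  · rw [List.map_map]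
    exact bind_single _ fun s => rfl
  · refine bind_ofList _ fun r => ?_
    refine bind_ofList _ fun w => ?_
    refine bind_suffixes fun rem => ?_
    rw [pollTrans]
    split_ifs <;> rfl
  · refine bind_ofList _ fun r => ?_
    refine bind_suffixes fun z => ?_
    rw [tellTrans]
    split_ifs <;> rfl

/-- The delay transitions of the environment are computed correctly. -/
theorem envDelaysTree_eq : envDelaysTree (ofRange M.numS) (ofList (M.transRows.map M.rowP))
    (ofList (M.obsRows.map M.rowO)) (M.actSets 0) (M.obsSets 0)
      = ofList (M.envDelays.map encDelay) := by
  rw [envDelaysTree, envDelays, List.map_append, List.map_append, List.map_append,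
    List.map_append, ← append_ofList, ← append_ofList, ← append_ofList, ← append_ofList]
  congr 2
  · congr 1
    · congr 1
      · rw [List.map_map]
        exact bind_single _ fun s => rfl
      · refine bind_ofList _ fun r => ?_
        refine bind_ofList _ fun w => ?_
        refine bind_suffixes fun rem => ?_
        rw [pollDelays]
        split_ifs <;> rfl
    · refine bind_ofList _ fun r => ?_
      have h0 : (M.rowP r).tl.tl.tl.hd.hd = nil ↔ M.P r.1 r.2.1 r.2.2 = 0 := hd_ofRat_eq_nil
      simp only [h0]
      split_ifs <;> rfl
  · refine bind_ofList _ fun r => ?_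
    have h0 : (M.rowO r).tl.tl.tl.tl.hd.hd = nil ↔ M.O r.1 r.2.1 r.2.2.1 r.2.2.2 = 0 :=
      hd_ofRat_eq_nil
    simp only [h0]
    split_ifs <;> rfl
  · refine bind_ofList _ fun r => ?_
    refine bind_suffixes fun z => ?_
    rw [tellDelays]
    split_ifs <;> rfl

theorem splits_sets : (splits nil (M.actSets 0) (M.obsSets 0)).map ofTriple
    = (List.finRange n).map fun i : Fin n => ofTriple
      (revT (fun i => ofRange (M.numAct i)) i, M.actSets i, M.obsSets i) := by
  rw [actSets, obsSets, splits_dropT, List.map_map]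
  rfl

theorem actSets_eq (i : Fin n) : M.actSets i = cons (ofRange (M.numAct i)) (M.actSets (i + 1)) :=
  dropT_of_lt _ i.2

theorem obsSets_eq (i : Fin n) : M.obsSets i = cons (ofRange (M.numObs i)) (M.obsSets (i + 1)) :=
  dropT_of_lt _ i.2

theorem allActsTree_eq : allActsTree (M.actSets 0) (M.obsSets 0) = ofList M.allActs := by
  have h := bind_ofList (List.finRange n) (g := fun i : Fin n => ofTriple
      (revT (fun i => ofRange (M.numAct i)) i, M.actSets i, M.obsSets i))
    (f := fun z => cons (lNext z.tl.hd.tl) (cons (lTick z.tl.tl.tl) nil))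
    (h := fun i : Fin n => [lNext (M.actSets (i + 1)), lTick (M.obsSets (i + 1))]) (e := id)
    fun i => by
      rw [actSets_eq, obsSets_eq]
      rfl
  rw [List.map_id] at h
  rw [allActsTree, splits_sets, h]
  rfl

theorem playerTree_eq (i : Fin n) : playerTree (M.actSets i) (M.obsSets i)
    = listIMCTree nil [lNext (M.actSets (i + 1)), lTick (M.obsSets (i + 1)), lGo]
      (playerTrans (ofRange (M.numAct i)) (ofRange (M.numObs i)) (lNext (M.actSets (i + 1)))
        (lTick (M.obsSets (i + 1)))) [] := by
  rw [← moduleTree_eq, ← playerTransTree_eq, actSets_eq, obsSets_eq]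
  rfl

theorem targetsTree_eq (L : List (Fin M.numS)) : targetsTree (ofList (L.map ofFin)) (M.actSets 0)
    = ofList ((L.map M.startState).map fun s => ofList ((List.finRange (n + 1)).map s)) := by
  rw [List.map_map]
  refine bind_single L fun s => ?_
  have h : bind (M.actSets 0) (fun _ => single nil) = ofList ((List.finRange n).map fun _ => nil) :=
    bind_single (List.finRange n) (g := fun i => ofRange (M.numAct i)) fun i => rfl
  rw [h, Function.comp, List.finRange_succ, List.map_cons, List.map_map]
  rfl

/-- The reduction produces the distributed IMC that simulates `M`. -/
theorem encodes_reduction (T : Finset (Fin M.numS)) :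
    M.toDistIMC.Encodes (reduction (M.encode T)) (M.targets T) := by
  let m : Fin (n + 1) → BTree := Fin.cons
    (listIMCTree (stCheck (ofFin M.init)) M.allActs M.envTrans M.envDelays)
    fun i => playerTree (M.actSets i) (M.obsSets i)
  refine ⟨m, ((List.finRange M.numS).filter (· ∈ T)).map M.startState, fun j => ?_, ?_, ?_⟩
  · refine Fin.cases ?_ (fun i => ?_) j
    · change EncodesModule _ M.envModule
      exact encodesModule_listIMC
    · change EncodesModule (playerTree (M.actSets i) (M.obsSets i)) (M.playerModule i)
      rw [playerTree_eq]
      exact encodesModule_listIMC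
  · ext s
    simp [targets]
  · rw [← targetsTree_eq, encode_eq]
    have h : bind (ofList ((splits nil (M.actSets 0) (M.obsSets 0)).map ofTriple))
        (fun z => single (playerTree z.tl.hd z.tl.tl))
        = ofList ((List.finRange n).map fun i : Fin n =>
          playerTree (M.actSets i) (M.obsSets i)) := by
      rw [splits_sets]
      exact bind_single _ fun i => rfl
    rw [List.finRange_succ, List.map_cons, List.map_map, ofList_cons]
    change cons (cons (moduleTree (stCheck (ofFin M.init)) (allActsTree (M.actSets 0) (M.obsSets 0))
      (envTransTree (ofRange M.numS) (ofList (M.transRows.map M.rowP))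
        (ofList (M.obsRows.map M.rowO)) (M.actSets 0) (M.obsSets 0))
      (envDelaysTree (ofRange M.numS) (ofList (M.transRows.map M.rowP))
        (ofList (M.obsRows.map M.rowO)) (M.actSets 0) (M.obsSets 0)))
      (bind (ofList ((splits nil (M.actSets 0) (M.obsSets 0)).map ofTriple))
        fun z => single (playerTree z.tl.hd z.tl.tl))) (targetsTree _ (M.actSets 0)) = _
    rw [h, allActsTree_eq, envTransTree_eq, envDelaysTree_eq, moduleTree_eq]
    rfl

end DecPOMDP

/-- One program, running in polynomial time, turns every DEC-POMDP `M` with `n` players and target set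
`T` (for every `n`) into a distributed IMC `G` with `n + 1` players and a target set `T'` of global
states, such that reach probabilities in `G` do not depend on the scheduler, and such that for every
`p` some strategy profile of `M` reaches `T` with probability `p` iff some strategy profile of `G`
reaches `T'` with probability `p`. -/
theorem mainTheorem6 :
    ∃ (f : Prog) (q : Polynomial ℕ),
      ∀ (n : ℕ) (M : DecPOMDP n) (T : Finset (Fin M.numS)),
        ∃ (y : BTree) (t : ℕ) (G : DistIMC (n + 1)) (T' : Finset (DistIMC.GState (n + 1))),
          Runs f (M.encode T) y t ∧
          t ≤ q.eval (M.encode T).size ∧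
          G.Encodes y T' ∧
          (∀ s ∈ T', s ∈ G.globalStates) ∧
          (∀ (σ : G.Profile) (δ δ' : G.Scheduler),
            G.playLaw σ δ (G.reach T') = G.playLaw σ δ' (G.reach T')) ∧
          ∀ p : ℝ,
            (∃ σ : M.Profile, (M.playLaw σ).real (M.reach T) = p) ↔
              ∃ σ : G.Profile, ∀ δ : G.Scheduler, (G.playLaw σ δ).real (G.reach T') = p := by
  obtain ⟨f, q, h⟩ := DecPOMDP.polyTime_reduction
  refine ⟨f, q, fun n M T => ?_⟩
  obtain ⟨t, hrun, ht⟩ := h (M.encode T)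
  refine ⟨_, t, M.toDistIMC, M.targets T, hrun, ht, DecPOMDP.encodes_reduction T,
    M.targets_subset T, fun σ δ δ' => by rw [DecPOMDP.scheduler_eq δ δ'], fun p => ⟨?_, ?_⟩⟩
  · rintro ⟨τ, rfl⟩
    exact ⟨DecPOMDP.simProfile τ, fun δ => congrArg ENNReal.toReal
      (DecPOMDP.toDistIMC_playLaw_simProfile T τ δ)⟩
  · rintro ⟨σ, hσ⟩
    obtain ⟨δ⟩ := (inferInstance : Nonempty M.toDistIMC.Scheduler)
    obtain ⟨τ, hτ⟩ := DecPOMDP.exists_profile_of_toDistIMC T σ δ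
    exact ⟨τ, (congrArg ENNReal.toReal hτ).trans (hσ δ)⟩
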